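/- Let $\Omega=\mathbb T_{2\pi}\times\mathbb R$ and, for $\epsilon\in[0,1)$, let $$\psi_\epsilon(x,y)=\ln\frac{\cosh y+\epsilon\cos x}{\sqrt{1-\epsilon^2}},\qquad \omega_\epsilon=-\Delta\psi_\epsilon=g(\psi_\epsilon),\quad g(s)=-e^{-2s},\qquad \vec u_\epsilon=(\partial_y\psi_\epsilon,-\partial_x\psi_\epsilon)$$ be the Kelvin–Stuart vortices, which are steady states of the 2D Euler equation. Put $g'(\psi_\epsilon)=2e^{-2\psi_\epsilon}$ and $$X_\epsilon=\Big\{\omega:\iint_\Omega\frac{|\omega|^2}{g'(\psi_\epsilon)}\,dx\,dy<\infty,\ \iint_\Omega\omega\,dx\,dy=0\Big\},$$ with the norm of $L^2(\Omega,dx\,dy/g'(\psi_\epsilon))$. Let $$\tilde X_\epsilon=\Big\{\psi:\nabla\psi\in L^2(\Omega),\ \int_0^{2\pi}\frac{\psi(x,0)}{1+\epsilon\cos x}\,dx=0\Big\},$$ and for $\omega\in X_\epsilon$ let $(-\Delta)^{-1}\omega$ be the unique weak solution $\psi\in\tilde X_\epsilon$ of $-\Delta\psi=\omega$, i.e. $\iint_\Omega\nabla\psi\cdot\nabla\chi=\iint_\Omega\omega\chi$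 for all $\chi\in\tilde X_\epsilon$. The vorticity equation linearized at $\omega_\epsilon$ is $\partial_t\omega=J_\epsilon L_\epsilon\omega$ on $X_\epsilon$, where $$L_\epsilon=\frac1{g'(\psi_\epsilon)}-(-\Delta)^{-1}:X_\epsilon\to X_\epsilon^*,\qquad J_\epsilon=-g'(\psi_\epsilon)\,\vec u_\epsilon\cdot\nabla:X_\epsilon^*\supset D(J_\epsilon)\to X_\epsilon;$$ here the derivative in $J_\epsilon$ is distributional, $D(J_\epsilon)$ is the maximal domain, and $D(J_\epsilon L_\epsilon)=\{\omega\in X_\epsilon: L_\epsilon\omega\in D(J_\epsilon)\}$. **Theorem.** For every $\epsilon\in[0,1)$, the steady state $\omega_\epsilon$ is spectrally stable for co-periodic ($2\pi$-periodic in $x$) perturbations: the spectrum of $J_\epsilon L_\epsilon$ on (the complexification of) $X_\epsilon$ is contained in the imaginary axis. Moreover, on the real space $X_\epsilon$ the energy form is nonnegative, $$\langle L_\epsilon\omega,\omega\rangle=\iint_\Omega\Big(\frac{|\omega|^2}{g'(\psi_\epsilon)}-\omega\,(-\Delta)^{-1}\omega\Big)dx\,dy\ \ge 0\qquad(\omega\in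 X_\epsilon),$$ and $\dim_{\mathbb R}\ker L_\epsilon=3$. -/

import Mathlib

open MeasureTheory Set Filter Topology
open scoped ENNReal

noncomputable section

namespace KelvinStuart

/-! ### The steady states -/

/-- The Kelvin-Stuart stream function `ψ_ε(x, y) = ln ((cosh y + ε cos x) / √(1 - ε²))`. -/
def psi (ε : ℝ) (z : ℝ × ℝ) : ℝ :=
  Real.log ((Real.cosh z.2 + ε * Real.cos z.1) / Real.sqrt (1 - ε ^ 2))

/-- The nonlinearity `g(s) = -exp (-2 s)` of Liouville's equation `-Δψ_ε = g(ψ_ε)`. -/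
def g (s : ℝ) : ℝ := -Real.exp (-2 * s)

/-- The steady vorticity `ω_ε = g(ψ_ε)`. -/
def omegaSteady (ε : ℝ) (z : ℝ × ℝ) : ℝ := g (psi ε z)

/-- `g'(ψ_ε) = 2 exp (-2 ψ_ε)`, as a function on the plane. -/
def gp (ε : ℝ) (z : ℝ × ℝ) : ℝ := 2 * Real.exp (-2 * psi ε z)

/-- First component `∂_y ψ_ε` of the steady velocity. -/
def vel1 (ε : ℝ) (z : ℝ × ℝ) : ℝ := Real.sinh z.2 / (Real.cosh z.2 + ε * Real.cos z.1)

/-- Second component `-∂_x ψ_ε` of the steady velocity. -/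
def vel2 (ε : ℝ) (z : ℝ × ℝ) : ℝ := ε * Real.sin z.1 / (Real.cosh z.2 + ε * Real.cos z.1)

theorem gp_pos (ε : ℝ) (z : ℝ × ℝ) : 0 < gp ε z := by unfold gp; positivity

theorem hasDerivAt_g (ε : ℝ) (z : ℝ × ℝ) : HasDerivAt g (gp ε z) (psi ε z) := by
  have h : HasDerivAt (fun s : ℝ => -2 * s) (-2) (psi ε z) := by
    simpa using (hasDerivAt_id (psi ε z)).const_mul (-2 : ℝ)
  have h2 := h.exp.neg
  refine h2.congr_deriv ?_
  unfold gp
  ring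

theorem denom_pos {ε : ℝ} (h0 : 0 ≤ ε) (h1 : ε < 1) (x y : ℝ) :
    0 < Real.cosh y + ε * Real.cos x := by
  nlinarith [Real.one_le_cosh y, Real.neg_one_le_cos x]

theorem sqrt_pos' {ε : ℝ} (h0 : 0 ≤ ε) (h1 : ε < 1) : 0 < Real.sqrt (1 - ε ^ 2) :=
  Real.sqrt_pos.2 (by nlinarith)

/-- The steady vorticity is `-(1 - ε²) / (cosh y + ε cos x)²`. -/
theorem omegaSteady_eq {ε : ℝ} (h0 : 0 ≤ ε) (h1 : ε < 1) (x y : ℝ) :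
    omegaSteady ε (x, y) = -(1 - ε ^ 2) / (Real.cosh y + ε * Real.cos x) ^ 2 := by
  have hd := denom_pos h0 h1 x y
  have hs := sqrt_pos' h0 h1
  have hsq : Real.sqrt (1 - ε ^ 2) ^ 2 = 1 - ε ^ 2 := Real.sq_sqrt (by nlinarith)
  simp only [omegaSteady, g, psi]
  rw [show ∀ a : ℝ, -2 * a = -(a + a) from fun a => by ring, Real.exp_neg, Real.exp_add,
    Real.exp_log (div_pos hd hs), ← sq, div_pow, inv_div, hsq, neg_div]

theorem hasDerivAt_psi_y {ε : ℝ} (h0 : 0 ≤ ε) (h1 : ε < 1) (x y : ℝ) :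
    HasDerivAt (fun t => psi ε (x, t)) (vel1 ε (x, y)) y := by
  have hd := denom_pos h0 h1 x y
  have hs := sqrt_pos' h0 h1
  have h := (((Real.hasDerivAt_cosh y).add_const (ε * Real.cos x)).div_const
    (Real.sqrt (1 - ε ^ 2))).log (div_pos hd hs).ne'
  refine h.congr_deriv ?_
  simp only [vel1]
  field_simp

theorem hasDerivAt_psi_x {ε : ℝ} (h0 : 0 ≤ ε) (h1 : ε < 1) (x y : ℝ) :
    HasDerivAt (fun t => psi ε (t, y)) (-vel2 ε (x, y)) x := by
  have hd := denom_pos h0 h1 x y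
  have hs := sqrt_pos' h0 h1
  have h := ((((Real.hasDerivAt_cos x).const_mul ε).const_add (Real.cosh y)).div_const
    (Real.sqrt (1 - ε ^ 2))).log (div_pos hd hs).ne'
  refine h.congr_deriv ?_
  simp only [vel2]
  field_simp

/-! ### The cylinder `Ω = 𝕋_{2π} × ℝ` and weak derivatives on it

Functions on `Ω` are represented by functions on `ℝ × ℝ` of which only the values on the
fundamental strip `(0, 2π] × ℝ` matter.  Test functions are smooth, `2π`-periodic in `x` and
compactly supported in `y`, that is, they are the smooth compactly supported functions on `Ω`. -/

/-- Lebesgue measure on `Ω`. -/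
def cyl : Measure (ℝ × ℝ) := volume.restrict (Ioc 0 (2 * Real.pi) ×ˢ univ)

/-- Smooth compactly supported real functions on `Ω`. -/
structure IsTest (φ : ℝ × ℝ → ℝ) : Prop where
  smooth : ContDiff ℝ (⊤ : ℕ∞) φ
  periodic : ∀ x y, φ (x + 2 * Real.pi, y) = φ (x, y)
  compact : ∃ R : ℝ, ∀ x y, R < |y| → φ (x, y) = 0

/-- `∂_x φ`. -/
def dx (φ : ℝ × ℝ → ℝ) (z : ℝ × ℝ) : ℝ := fderiv ℝ φ z (1, 0)

/-- `∂_y φ`. -/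
def dy (φ : ℝ × ℝ → ℝ) (z : ℝ × ℝ) : ℝ := fderiv ℝ φ z (0, 1)

/-- `ψ` is locally integrable on `Ω` and its distributional gradient on `Ω` is `(p, q) ∈ L²(Ω)`. -/
structure HasWeakGrad {𝕜 : Type*} [RCLike 𝕜] (ψ p q : ℝ × ℝ → 𝕜) : Prop where
  locInt : ∀ R : ℝ, IntegrableOn ψ (univ ×ˢ Icc (-R) R) cyl
  memLp_x : MemLp p 2 cyl
  memLp_y : MemLp q 2 cyl
  weak_x : ∀ φ, IsTest φ → ∫ z, dx φ z • ψ z ∂cyl = -∫ z, φ z • p z ∂cyl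
  weak_y : ∀ φ, IsTest φ → ∫ z, dy φ z • ψ z ∂cyl = -∫ z, φ z • q z ∂cyl

/-- The trace condition `∫_0^{2π} ψ(x, 0) / (1 + ε cos x) dx = 0`.  The trace on `y = 0` is
expressed as the limit of averages over `|y| ≤ δ`. -/
def TraceZero {𝕜 : Type*} [RCLike 𝕜] (ε : ℝ) (ψ : ℝ × ℝ → 𝕜) : Prop :=
  Tendsto (fun δ : ℝ => (2 * δ)⁻¹ •
      ∫ z in univ ×ˢ Icc (-δ) δ, (1 + ε * Real.cos z.1)⁻¹ • ψ z ∂cyl)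
    (𝓝[>] 0) (𝓝 0)

/-- `ψ` belongs to the space `X̃_ε` of stream functions and has weak gradient `(p, q)`. -/
def InStreamSpace {𝕜 : Type*} [RCLike 𝕜] (ε : ℝ) (ψ p q : ℝ × ℝ → 𝕜) : Prop :=
  HasWeakGrad ψ p q ∧ TraceZero ε ψ

/-! ### The vorticity space `X_ε` -/

/-- The weighted measure `dx dy / g'(ψ_ε)` on `Ω`. -/
def weighted (ε : ℝ) : Measure (ℝ × ℝ) :=
  cyl.withDensity fun z => ENNReal.ofReal (1 / gp ε z)

theorem measurable_psi (ε : ℝ) : Measurable (psi ε) := by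
  unfold psi
  refine Real.measurable_log.comp ?_
  have h : Continuous fun z : ℝ × ℝ => Real.cosh z.2 + ε * Real.cos z.1 := by fun_prop
  exact h.measurable.div_const _

theorem measurable_gp (ε : ℝ) : Measurable (gp ε) := by
  unfold gp
  exact (Real.measurable_exp.comp ((measurable_psi ε).const_mul _)).const_mul _

theorem cyl_ac_weighted (ε : ℝ) : cyl ≪ weighted ε := by
  refine withDensity_absolutelyContinuous' ?_ ?_
  · exact ((measurable_gp ε).const_div 1).ennreal_ofReal.aemeasurable
  · refine Eventually.of_forall fun z => ?_
    have h := gp_pos ε z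
    simp [h]

/-- The vorticity space: `ω` with `∬ |ω|² / g'(ψ_ε) < ∞` and `∬ ω = 0` (the integral being taken
with respect to `dx dy`), with the norm of `L²(Ω, dx dy / g'(ψ_ε))`.  Taking `𝕜 = ℝ` gives the
real space, and `𝕜 = ℂ` its complexification. -/
def X (𝕜 : Type*) [RCLike 𝕜] (ε : ℝ) : Submodule 𝕜 (Lp 𝕜 2 (weighted ε)) where
  carrier := {ω | Integrable ω cyl ∧ ∫ z, ω z ∂cyl = 0}
  zero_mem' := by
    have h : (⇑(0 : Lp 𝕜 2 (weighted ε))) =ᵐ[cyl] 0 :=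
      (cyl_ac_weighted ε).ae_le (Lp.coeFn_zero 𝕜 2 (weighted ε))
    refine ⟨(integrable_zero (ℝ × ℝ) 𝕜 cyl).congr h.symm, ?_⟩
    rw [integral_congr_ae h]
    simp
  add_mem' := by
    rintro a b ⟨ha, ha0⟩ ⟨hb, hb0⟩
    have h : (⇑(a + b)) =ᵐ[cyl] ⇑a + ⇑b := (cyl_ac_weighted ε).ae_le (Lp.coeFn_add a b)
    refine ⟨(ha.add hb).congr h.symm, ?_⟩
    rw [integral_congr_ae h, integral_add' ha hb, ha0, hb0, add_zero]
  smul_mem' := by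
    rintro c a ⟨ha, ha0⟩
    have h : (⇑(c • a)) =ᵐ[cyl] c • ⇑a := (cyl_ac_weighted ε).ae_le (Lp.coeFn_smul c a)
    refine ⟨(ha.smul c).congr h.symm, ?_⟩
    rw [integral_congr_ae h]
    simp only [Pi.smul_apply]
    rw [integral_smul, ha0, smul_zero]

/-- A representative of an element of `X_ε`, as a function. -/
def rep {𝕜 : Type*} [RCLike 𝕜] {ε : ℝ} (ω : X 𝕜 ε) : ℝ × ℝ → 𝕜 := ⇑(ω : Lp 𝕜 2 (weighted ε))

/-! ### The operators `(-Δ)⁻¹`, `L_ε`, `J_ε` -/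

/-- `ψ ∈ X̃_ε` is a weak solution of `-Δψ = ω`:
`∬ ∇ψ · ∇χ = ∬ ω χ` for every `χ ∈ X̃_ε`. -/
def IsPoissonSolution {𝕜 : Type*} [RCLike 𝕜] {ε : ℝ} (ω : X 𝕜 ε) (ψ : ℝ × ℝ → 𝕜) : Prop :=
  ∃ p q : ℝ × ℝ → 𝕜, InStreamSpace ε ψ p q ∧
    ∀ χ a b : ℝ × ℝ → 𝕜, InStreamSpace ε χ a b →
      ∫ z, (p z * a z + q z * b z) ∂cyl = ∫ z, rep ω z * χ z ∂cyl

/-- `(-Δ)⁻¹ ω`: the weak solution in `X̃_ε` of `-Δψ = ω` (it is unique almost everywhere). -/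
def invLaplace {𝕜 : Type*} [RCLike 𝕜] {ε : ℝ} (ω : X 𝕜 ε) : ℝ × ℝ → 𝕜 :=
  Classical.epsilon fun ψ => IsPoissonSolution ω ψ

/-- `L_ε ω = ω / g'(ψ_ε) - (-Δ)⁻¹ ω`, a function which represents an element of the dual
space `X_ε*` through the pairing `ω₂ ↦ ∬ (L_ε ω) ω₂`. -/
def Lfun {𝕜 : Type*} [RCLike 𝕜] {ε : ℝ} (ω : X 𝕜 ε) (z : ℝ × ℝ) : 𝕜 :=
  (gp ε z)⁻¹ • rep ω z - invLaplace ω z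

/-- The dual bracket `⟨L_ε ω₁, ω₂⟩ = ∬ (ω₁ ω₂ / g'(ψ_ε) - ((-Δ)⁻¹ ω₁) ω₂)`. -/
def Lform {ε : ℝ} (ω₁ ω₂ : X ℝ ε) : ℝ := ∫ z, Lfun ω₁ z * rep ω₂ z ∂cyl

/-- `Φ` is in the domain of `J_ε = -g'(ψ_ε) u_ε · ∇` and `J_ε Φ = f ∈ X_ε`, in the sense of
distributions on `Ω`.  As `g'(ψ_ε) u_ε` is divergence free, the derivatives are moved to the
test function by `∬ (-g'(ψ_ε) u_ε · ∇Φ) φ = ∬ Φ g'(ψ_ε) u_ε · ∇φ`. -/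
def IsJ {𝕜 : Type*} [RCLike 𝕜] {ε : ℝ} (Φ : ℝ × ℝ → 𝕜) (f : X 𝕜 ε) : Prop :=
  ∀ φ, IsTest φ →
    ∫ z, (gp ε z * (vel1 ε z * dx φ z + vel2 ε z * dy φ z)) • Φ z ∂cyl = ∫ z, φ z • rep f z ∂cyl

/-- The graph of the linearized vorticity operator `J_ε L_ε` on the complexified space `X_ε`,
with its maximal domain `{ω ∈ X_ε | L_ε ω ∈ D(J_ε)}`. -/
def JLGraph (ε : ℝ) (ω f : X ℂ ε) : Prop := IsJ (Lfun ω) f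

/-! ### Spectral stability -/

/-- `lam` is in the resolvent set of the unbounded operator with graph `A`:
`lam - A` has a bounded, everywhere defined two-sided inverse `R`. -/
def InResolventSet {E : Type*} [NormedAddCommGroup E] [NormedSpace ℂ E]
    (A : E → E → Prop) (lam : ℂ) : Prop :=
  ∃ R : E →L[ℂ] E,
    (∀ w f, A w f → R (lam • w - f) = w) ∧ ∀ h, A (R h) (lam • R h - h)

/-- The spectrum of an unbounded operator given by its graph. -/
def opSpectrum {E : Type*} [NormedAddCommGroup E] [NormedSpace ℂ E]
    (A : E → E → Prop) : Set ℂ := {lam | ¬ InResolventSet A lam}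

/-- Spectral stability of `ω_ε` for `2π`-periodic perturbations: the spectrum of the
linearized vorticity operator `J_ε L_ε` on `X_ε` lies on the imaginary axis. -/
def SpectrallyStable (ε : ℝ) : Prop := ∀ lam ∈ opSpectrum (JLGraph ε), lam.re = 0

end KelvinStuart

end

/-!
The proof rests on the geometry behind Liouville's equation.  The functions `sph ε i` map the
cylinder conformally onto the unit sphere without the two points `(±√(1 - ε²), 0, ε)`, with area
density `rho ε = g'(ψ_ε) / 2` (`grad_sph_mul`, `lap_sph`).  Writing vorticities as
`ω = g'(ψ_ε) F` turns the weighted `L²` space into `L²` of the sphere and `-Δ / g'(ψ_ε)` into half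
the Laplacian of the sphere, with eigenvalues `n (n + 1) / 2`.  Hence `L_ε` becomes, up to constants,
`P = 1 - D⁻¹`, where `D` has these eigenvalues: it vanishes on spherical harmonics of degree one,
and is at least `2 / 3` on those of higher degree.  This gives the sign of the energy form
(`Lform_self_nonneg`) and a kernel spanned by the three functions `g'(ψ_ε) sph ε i`
(`exists_kernel`).

No spectral theorem for the sphere is used.  All that matters is that polynomials in the coordinates
of the sphere are dense (`denseRange_polEmb`), and that the symmetric operator `D` is triangular for
the filtration by degree (`lap_Pol`); the degree-`n` parts then are eigenspaces.

The transport operator `T = u_ε · ∇` is first order with quadratic coefficients on the sphere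
(`transport_sph`).  So it raises the degree of polynomials by at most one (`transport_mem_Pol`), it
is skew-symmetric because `g'(ψ_ε) u_ε` is divergence free (`polT_skew`), and it is bounded by
`√D` (`polT_bound`); its norm on polynomials of degree `n` is thus `O(n)`.  These facts are collected
in the structure `BandModel`.  Since `∑ 1 / n` diverges, Carleman's argument shows that the maximal
operator belonging to `T` is skew-symmetric (`BandModel.Weak.inner_eq`), and therefore that `L²`
solutions of `T v = k` may be tested against each other.

Off the imaginary axis, `λ + T P` is invertible (`BandModel.exists_resolvent`): its formal adjoint
`conj λ - P T` is bounded below on polynomials, by the sign and the spectral gap of `P`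
(`BandModel.adjointOp_bound`), and has dense range, by the skew-symmetry of the maximal operator
(`BandModel.adjointOp_denseRange`).

What remains is to identify the operators of the theorem with those of the model.  A function with
square integrable gradient on the cylinder has a trace on `y = 0` and grows at most like `√|y|`
(`HasWeakGrad.exists_trace`), so that it is integrable against `g'(ψ_ε)`, its trace can be normalized
by a constant, and Green's formula against polynomials holds (`integral_grad_Pol_mul`).  This yields
existence and uniqueness for the Poisson equation (`exists_isPoissonSolution`,
`IsPoissonSolution.ae_eq`) and the description of `L_ε` by `P` (`exists_Lfun_ae_eq`).  Finally,
distributional derivatives, defined by compactly supported test functions, agree with weak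
derivatives defined by polynomials (`weak_of_isJ`, `isJ_of_weak`).
-/

noncomputable section

namespace KelvinStuart

/-! ### Hilbert spaces filtered by degree -/

section Filtration

variable {𝕜 H : Type*} [RCLike 𝕜] [NormedAddCommGroup H] [InnerProductSpace 𝕜 H]
  (U : ℕ → Submodule 𝕜 H) [∀ n, (U n).HasOrthogonalProjection]

/-- Orthogonal projection onto the degree-`n` part `U (n + 1) ⊖ U n` of a filtered Hilbert space;
`U n` plays the role of the elements of degree less than `n`. -/
def degProj (n : ℕ) : H →L[𝕜] H := (U (n + 1)).starProjection - (U n).starProjection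

variable {U}

theorem degProj_mem (hU : Monotone U) (n : ℕ) (x : H) : degProj U n x ∈ U (n + 1) :=
  (U (n + 1)).sub_mem ((U (n + 1)).starProjection_apply_mem x)
    (hU n.le_succ ((U n).starProjection_apply_mem x))

theorem inner_degProj_left (n : ℕ) (x y : H) :
    inner 𝕜 (degProj U n x) y = inner 𝕜 x (degProj U n y) := by
  simp only [degProj, _root_.sub_apply, inner_sub_left, inner_sub_right,
    Submodule.inner_starProjection_left_eq_right]

theorem degProj_of_mem (hU : Monotone U) {m n : ℕ} (h : m ≤ n) {x : H} (hx : x ∈ U m) :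
    degProj U n x = 0 := by
  have h1 : (U n).starProjection x = x := Submodule.starProjection_eq_self_iff.2 (hU h hx)
  have h2 : (U (n + 1)).starProjection x = x :=
    Submodule.starProjection_eq_self_iff.2 (hU (h.trans n.le_succ) hx)
  simp [degProj, h1, h2]

theorem inner_degProj_of_mem (hU : Monotone U) {n : ℕ} {y : H} (hy : y ∈ U n) (x : H) :
    inner 𝕜 (degProj U n x) y = 0 := by
  rw [inner_degProj_left, degProj_of_mem hU le_rfl hy, inner_zero_right]

theorem starProjection_degProj (hU : Monotone U) (n : ℕ) (x : H) :
    (U n).starProjection (degProj U n x) = 0 := by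
  rw [Submodule.starProjection_apply_eq_zero_iff]
  intro y hy
  rw [inner_eq_zero_symm]
  exact inner_degProj_of_mem hU hy x

theorem degProj_degProj_self (hU : Monotone U) (n : ℕ) (x : H) :
    degProj U n (degProj U n x) = degProj U n x := by
  have h : (U (n + 1)).starProjection (degProj U n x) = degProj U n x :=
    Submodule.starProjection_eq_self_iff.2 (degProj_mem hU n x)
  have h2 := starProjection_degProj hU n x
  generalize degProj U n x = y at h h2
  rw [degProj, _root_.sub_apply, h, h2, sub_zero]

theorem degProj_degProj_of_ne (hU : Monotone U) {m n : ℕ} (h : m ≠ n) (x : H) :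
    degProj U m (degProj U n x) = 0 := by
  rcases lt_or_gt_of_ne h with h | h
  · refine ext_inner_right 𝕜 fun y => ?_
    rw [inner_degProj_left, inner_degProj_of_mem hU (hU h (degProj_mem hU m y)), inner_zero_left]
  · exact degProj_of_mem hU h (degProj_mem hU n x)

theorem inner_degProj_self (hU : Monotone U) (n : ℕ) (x : H) :
    inner 𝕜 (degProj U n x) x = ((‖degProj U n x‖ ^ 2 : ℝ) : 𝕜) := by
  rw [← degProj_degProj_self hU, inner_degProj_left, inner_self_eq_norm_sq_to_K,
    degProj_degProj_self hU]
  norm_cast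

theorem starProjection_succ (n : ℕ) (x : H) :
    (U (n + 1)).starProjection x = (U n).starProjection x + degProj U n x := by
  simp [degProj]

theorem norm_sq_starProjection_succ (hU : Monotone U) (n : ℕ) (x : H) :
    ‖(U (n + 1)).starProjection x‖ ^ 2 =
      ‖(U n).starProjection x‖ ^ 2 + ‖degProj U n x‖ ^ 2 := by
  rw [starProjection_succ, sq, sq, sq, norm_add_sq_eq_norm_sq_add_norm_sq_of_inner_eq_zero (𝕜 := 𝕜)]
  rw [inner_eq_zero_symm]
  exact inner_degProj_of_mem hU ((U n).starProjection_apply_mem x) x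

theorem norm_degProj_le (hU : Monotone U) (n : ℕ) (x : H) : ‖degProj U n x‖ ≤ ‖x‖ := by
  have h1 := norm_sq_starProjection_succ hU n x
  have h2 := (U (n + 1)).norm_starProjection_apply_le x
  have h3 := norm_nonneg ((U (n + 1)).starProjection x)
  nlinarith [sq_nonneg ‖(U n).starProjection x‖, norm_nonneg (degProj U n x), norm_nonneg x]

theorem hasSum_norm_sq_degProj (hU : Monotone U) (h0 : U 0 = ⊥)
    (hd : ∀ x, Tendsto (fun n => (U n).starProjection x) atTop (𝓝 x)) (x : H) :
    HasSum (fun n => ‖degProj U n x‖ ^ 2) (‖x‖ ^ 2) := by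
  rw [hasSum_iff_tendsto_nat_of_nonneg (fun n => by positivity)]
  have h : ∀ n, ∑ i ∈ Finset.range n, ‖degProj U i x‖ ^ 2 = ‖(U n).starProjection x‖ ^ 2 := by
    intro n
    induction n with
    | zero => simp [(U 0).starProjection_apply_eq_zero_iff.2 (by rw [h0]; simp : x ∈ (U 0)ᗮ)]
    | succ n ih => rw [Finset.sum_range_succ, ih, norm_sq_starProjection_succ hU]
  simp only [h]
  exact (hd x).norm.pow 2

end Filtration

/-- If `u n → l` and `‖u n‖ ≤ C (n + 1) a n` with `a` summable, then `l = 0`, since otherwise `a`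
would dominate a multiple of the harmonic series. -/
theorem eq_zero_of_tendsto_of_le_mul_summable {E : Type*} [NormedAddCommGroup E] {u : ℕ → E}
    {l : E} (hu : Tendsto u atTop (𝓝 l)) {a : ℕ → ℝ} (ha : Summable a) {C : ℝ}
    (h : ∀ n, ‖u n‖ ≤ C * (n + 1) * a n) : l = 0 := by
  by_contra hl
  have hl' : 0 < ‖l‖ := norm_pos_iff.2 hl
  have hev : ∀ᶠ n in atTop, ‖l‖ / 2 < ‖u n‖ := hu.norm.eventually (lt_mem_nhds (by linarith))
  obtain ⟨N, hN⟩ := eventually_atTop.1 hev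
  have hs : Summable fun n : ℕ => 1 / (((n + N : ℕ) : ℝ) + 1) := by
    have ha' : Summable fun n : ℕ => 2 * C / ‖l‖ * a (n + N) :=
      (((summable_nat_add_iff N).2 ha)).mul_left _
    refine Summable.of_nonneg_of_le (fun n => by positivity) (fun n => ?_) ha'
    have h1 := (hN (n + N) (by omega)).trans_le (h (n + N))
    have h2 : (0 : ℝ) < ((n + N : ℕ) : ℝ) + 1 := by positivity
    rw [div_le_iff₀ h2]
    have h3 : 2 * C / ‖l‖ * a (n + N) * (((n + N : ℕ) : ℝ) + 1) =
      (C * (((n + N : ℕ) : ℝ) + 1) * a (n + N)) * (2 / ‖l‖) := by ring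
    rw [h3]
    calc (1 : ℝ) = ‖l‖ / 2 * (2 / ‖l‖) := by field_simp
      _ ≤ _ := by gcongr
  have := (summable_nat_add_iff N (f := fun n : ℕ => 1 / ((n : ℝ) + 1))).1 hs
  have h5 := (summable_nat_add_iff 1 (f := fun n : ℕ => 1 / (n : ℝ))).1 (by simpa using this)
  exact Real.not_summable_one_div_natCast h5

/-! ### Polynomial models of an unbounded skew-symmetric operator -/

/-- Data of a Hilbert space `H` with a dense "polynomial" module `M` filtered by degree
(`F n` consists of the polynomials of degree less than `n`), a skew-symmetric operator `T` which
raises degrees by at most one and is bounded by the square root of the symmetric operator `D`,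
where `D` is triangular with diagonal entries `n (n + 1) / 2`. -/
structure BandModel (𝕜 M H : Type*) [RCLike 𝕜] [AddCommGroup M] [Module 𝕜 M]
    [NormedAddCommGroup H] [InnerProductSpace 𝕜 H] where
  /-- The map from polynomials to the Hilbert space. -/
  j : M →ₗ[𝕜] H
  /-- The skew-symmetric operator. -/
  T : M →ₗ[𝕜] M
  /-- The symmetric operator which controls `T`. -/
  D : M →ₗ[𝕜] M
  /-- The polynomials of degree less than `n`. -/
  F : ℕ → Submodule 𝕜 M
  mono : Monotone F
  F_zero : F 0 = ⊥
  exhaust : ∀ f, ∃ n, f ∈ F n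
  finDim : ∀ n, FiniteDimensional 𝕜 (F n)
  dense : DenseRange j
  T_mem : ∀ n, ∀ f ∈ F n, T f ∈ F (n + 1)
  D_mem : ∀ n : ℕ, ∀ f ∈ F (n + 1), D f - ((n : 𝕜) * (n + 1) / 2) • f ∈ F n
  T_skew : ∀ f g, inner 𝕜 (j (T f)) (j g) = -inner 𝕜 (j f) (j (T g))
  D_symm : ∀ f g, inner 𝕜 (j (D f)) (j g) = inner 𝕜 (j f) (j (D g))
  /-- The constant in the bound of `T` by `√D`. -/
  C : ℝ
  C_nonneg : 0 ≤ C
  T_bound : ∀ f, ‖j (T f)‖ ^ 2 ≤ C ^ 2 * RCLike.re (inner 𝕜 (j f) (j (D f)))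

namespace BandModel

variable {𝕜 M H : Type*} [RCLike 𝕜] [AddCommGroup M] [Module 𝕜 M]
    [NormedAddCommGroup H] [InnerProductSpace 𝕜 H] (B : BandModel 𝕜 M H)

/-- The image in `H` of the polynomials of degree less than `n`. -/
def U (n : ℕ) : Submodule 𝕜 H := (B.F n).map B.j

instance (n : ℕ) : FiniteDimensional 𝕜 (B.U n) := by
  have := B.finDim n
  unfold U
  infer_instance

theorem U_mono : Monotone B.U := fun _ _ h => Submodule.map_mono (B.mono h)

theorem U_zero : B.U 0 = ⊥ := by simp [U, B.F_zero]

theorem tendsto_starProjection (x : H) :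
    Tendsto (fun n => (B.U n).starProjection x) atTop (𝓝 x) := by
  refine Submodule.starProjection_tendsto_self B.U B.U_mono x ?_
  have h : (range B.j) ⊆ ((⨆ n, B.U n : Submodule 𝕜 H) : Set H) := by
    rintro _ ⟨f, rfl⟩
    obtain ⟨n, hn⟩ := B.exhaust f
    exact (le_iSup B.U n) ⟨f, hn, rfl⟩
  intro y _
  exact closure_mono h (B.dense y)

theorem hasSum_norm_sq (x : H) : HasSum (fun n => ‖degProj B.U n x‖ ^ 2) (‖x‖ ^ 2) :=
  hasSum_norm_sq_degProj B.U_mono B.U_zero B.tendsto_starProjection x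

theorem exists_starProjection_eq (n : ℕ) (x : H) :
    ∃ f ∈ B.F n, B.j f = (B.U n).starProjection x := (B.U n).starProjection_apply_mem x

theorem exists_degProj_eq (n : ℕ) (x : H) : ∃ f ∈ B.F (n + 1), B.j f = degProj B.U n x :=
  degProj_mem B.U_mono n x

theorem j_mem {n : ℕ} {f : M} (hf : f ∈ B.F n) : B.j f ∈ B.U n := ⟨f, hf, rfl⟩

theorem D_mem' {n : ℕ} {f : M} (hf : f ∈ B.F n) : B.D f ∈ B.F n := by
  cases n with
  | zero => rw [B.F_zero, Submodule.mem_bot] at hf; simp [hf]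
  | succ n =>
    have h := (B.F (n + 1)).add_mem (B.mono n.le_succ (B.D_mem n f hf))
      ((B.F (n + 1)).smul_mem ((n : 𝕜) * (n + 1) / 2) hf)
    simpa using h

/-- The degree-`n` parts consist of eigenvectors of `D`. -/
theorem j_D_of_orthogonal {n : ℕ} {f : M} (hf : f ∈ B.F (n + 1))
    (ho : ∀ y ∈ B.U n, inner 𝕜 (B.j f) y = 0) :
    B.j (B.D f) = ((n : 𝕜) * (n + 1) / 2) • B.j f := by
  rw [← sub_eq_zero, ← map_smul, ← map_sub, ← inner_self_eq_zero (𝕜 := 𝕜)]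
  have hm := B.D_mem n f hf
  have key : ∀ r ∈ B.F n, inner 𝕜 (B.j (B.D f - ((n : 𝕜) * (n + 1) / 2) • f)) (B.j r) = 0 := by
    intro r hr
    rw [map_sub, map_smul, inner_sub_left, B.D_symm, inner_smul_left, ho _ (B.j_mem hr),
      ho _ (B.j_mem (B.D_mem' hr))]
    simp
  exact key _ hm

/-- The quadratic form of `D` on polynomials of degree at most `n` is bounded by the eigenvalue in
degree `n`: the top-degree part is an eigenvector, orthogonal to the rest. -/
theorem re_inner_D_le (n : ℕ) : ∀ f ∈ B.F (n + 1),
    RCLike.re (inner 𝕜 (B.j f) (B.j (B.D f))) ≤ (n * (n + 1) / 2 : ℝ) * ‖B.j f‖ ^ 2 := by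
  induction n with
  | zero =>
    intro f hf
    have h : B.j (B.D f) = (((0 : ℕ) : 𝕜) * ((0 : ℕ) + 1) / 2) • B.j f := by
      refine B.j_D_of_orthogonal hf fun y hy => ?_
      rw [B.U_zero, Submodule.mem_bot] at hy
      simp [hy]
    rw [h]; simp
  | succ n ih =>
    intro f hf
    obtain ⟨g, hg, hgf⟩ := B.exists_starProjection_eq (n + 1) (B.j f)
    have hfg : B.j (f - g) = degProj B.U (n + 1) (B.j f) := by
      rw [map_sub, hgf, degProj, _root_.sub_apply,
        Submodule.starProjection_eq_self_iff.2 (B.j_mem hf)]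
    have hm : f - g ∈ B.F (n + 1 + 1) := Submodule.sub_mem _ hf (B.mono (Nat.le_succ _) hg)
    have ho : ∀ y ∈ B.U (n + 1), inner 𝕜 (B.j (f - g)) y = 0 := fun y hy => by
      rw [hfg]; exact inner_degProj_of_mem B.U_mono hy _
    have hD := B.j_D_of_orthogonal hm ho
    have ih' := ih g hg
    have e1 : f = g + (f - g) := by abel
    set r := f - g with hr
    have c1 : inner 𝕜 (B.j r) (B.j (B.D g)) = 0 := ho _ (B.j_mem (B.D_mem' hg))
    have c2 : inner 𝕜 (B.j g) (B.j r) = 0 := by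
      rw [inner_eq_zero_symm]; exact ho _ (B.j_mem hg)
    have e2 : RCLike.re (inner 𝕜 (B.j f) (B.j (B.D f))) =
        RCLike.re (inner 𝕜 (B.j g) (B.j (B.D g))) +
          ((n + 1 : ℕ) * ((n + 1 : ℕ) + 1) / 2 : ℝ) * ‖B.j r‖ ^ 2 := by
      rw [e1]
      simp only [map_add, inner_add_left, inner_add_right, hD, inner_smul_right, c1, c2,
        inner_self_eq_norm_sq_to_K]
      have : (((n + 1 : ℕ) : 𝕜) * (((n + 1 : ℕ) : 𝕜) + 1) / 2 * (‖B.j r‖ : 𝕜) ^ 2) =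
        (((((n + 1 : ℕ) : ℝ) * (((n + 1 : ℕ) : ℝ) + 1) / 2 * ‖B.j r‖ ^ 2 : ℝ)) : 𝕜) := by
        push_cast; ring
      rw [zero_add, this, RCLike.ofReal_re]
      simp
    have e3 : ‖B.j f‖ ^ 2 = ‖B.j g‖ ^ 2 + ‖B.j r‖ ^ 2 := by
      rw [e1, map_add, sq, sq, sq, norm_add_sq_eq_norm_sq_add_norm_sq_of_inner_eq_zero _ _ c2]
    rw [e2, e3]
    refine (add_le_add (ih'.trans ?_) le_rfl).trans_eq (mul_add _ _ _).symm
    gcongr <;> simp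

/-- `T` has norm `O(n)` on polynomials of degree less than `n`, as it is bounded by `√D`. -/
theorem norm_T_le {n : ℕ} {f : M} (hf : f ∈ B.F n) : ‖B.j (B.T f)‖ ≤ B.C * (n + 1) * ‖B.j f‖ := by
  have hC := B.C_nonneg
  refine abs_le_of_sq_le_sq' ?_ (by positivity) |>.2
  cases n with
  | zero => rw [B.F_zero, Submodule.mem_bot] at hf; simp [hf]
  | succ n =>
    refine (B.T_bound f).trans ?_
    have h1 := B.re_inner_D_le n f hf
    calc _ ≤ B.C ^ 2 * ((n * (n + 1) / 2 : ℝ) * ‖B.j f‖ ^ 2) := by gcongr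
      _ ≤ B.C ^ 2 * ((((n + 1 : ℕ) : ℝ) + 1) ^ 2 * ‖B.j f‖ ^ 2) := by
        gcongr; push_cast; nlinarith [(Nat.cast_nonneg n : (0:ℝ) ≤ n)]
      _ = _ := by ring

/-- `v` lies in the maximal domain of `T`, with image `k`: `⟨T p, v⟩ = -⟨p, k⟩` for all
polynomials `p`. -/
def Weak (v k : H) : Prop := ∀ p : M, inner 𝕜 (B.j (B.T p)) v = -inner 𝕜 (B.j p) k

/-- The error made when the maximal operator is tested against truncations only involves the
top-degree parts, because `T` raises degrees by at most one. -/
theorem inner_T_truncation (n : ℕ) (x v : H) {s : M} (hs : s ∈ B.F (n + 1))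
    (hsv : B.j s = (B.U (n + 1)).starProjection v) :
    ‖inner 𝕜 (x - (B.U (n + 1)).starProjection x) (B.j (B.T s))‖ ≤
      ‖degProj B.U (n + 1) x‖ * (B.C * (n + 2) * ‖degProj B.U n v‖) := by
  obtain ⟨s', hs', hsv'⟩ := B.exists_starProjection_eq n v
  have hd : B.j (s - s') = degProj B.U n v := by
    rw [map_sub, hsv, hsv', degProj, _root_.sub_apply]
  have hm : s - s' ∈ B.F (n + 1) := Submodule.sub_mem _ hs (B.mono n.le_succ hs')
  have h1 : ∀ y ∈ B.U (n + 2), inner 𝕜 (x - (B.U (n + 1)).starProjection x) y =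
      inner 𝕜 (degProj B.U (n + 1) x) y := by
    intro y hy
    have := Submodule.starProjection_inner_eq_zero (K := B.U (n + 2)) x y hy
    rw [inner_sub_left, sub_eq_zero] at this
    rw [inner_sub_left, degProj, _root_.sub_apply, inner_sub_left, this]
  -- `T s` has degree at most `n + 1`, so only the degree-`(n + 1)` part of `x` is seen; it is
  -- orthogonal to `T s'`, where `s'` collects the parts of `s` of degree less than `n`.
  rw [h1 _ (B.j_mem (B.T_mem _ _ hs))]
  have h2 : inner 𝕜 (degProj B.U (n + 1) x) (B.j (B.T s)) =
      inner 𝕜 (degProj B.U (n + 1) x) (B.j (B.T (s - s'))) := by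
    rw [map_sub B.T, map_sub, inner_sub_right,
      inner_degProj_of_mem B.U_mono (B.j_mem (B.T_mem _ _ hs')), sub_zero]
  rw [h2]
  refine (norm_inner_le_norm _ _).trans ?_
  gcongr
  refine (B.norm_T_le hm).trans_eq ?_
  rw [hd]; push_cast; ring

/-- Essential skew-adjointness (Carleman's argument): the maximal operator is skew-symmetric.
Truncating both vectors to degree at most `n` makes an error of at most `n + 1` times a multiple of
`‖aₙ‖² + ‖aₙ₊₁‖² + ‖vₙ‖² + ‖vₙ₊₁‖²`, which is summable in `n`. -/
theorem Weak.inner_eq {a a' v k : H} (ha : B.Weak a a') (hv : B.Weak v k) :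
    inner 𝕜 a' v = -inner 𝕜 a k := by
  rw [← sub_eq_zero, sub_neg_eq_add]
  have hC := B.C_nonneg
  have hlim : Tendsto (fun n => inner 𝕜 a' ((B.U (n + 1)).starProjection v) +
      inner 𝕜 ((B.U (n + 1)).starProjection a) k) atTop (𝓝 (inner 𝕜 a' v + inner 𝕜 a k)) := by
    have h1 := (B.tendsto_starProjection v).comp (tendsto_add_atTop_nat 1)
    have h2 := (B.tendsto_starProjection a).comp (tendsto_add_atTop_nat 1)
    exact (tendsto_const_nhds.inner h1).add (h2.inner tendsto_const_nhds)
  have hsum : Summable fun n => ‖degProj B.U n a‖ ^ 2 + ‖degProj B.U n v‖ ^ 2 :=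
    (B.hasSum_norm_sq a).summable.add (B.hasSum_norm_sq v).summable
  have hsum' := hsum.add ((summable_nat_add_iff 1).2 hsum)
  refine eq_zero_of_tendsto_of_le_mul_summable hlim hsum' (C := 2 * B.C) fun n => ?_
  obtain ⟨p, hp, hpa⟩ := B.exists_starProjection_eq (n + 1) a
  obtain ⟨s, hs, hsv⟩ := B.exists_starProjection_eq (n + 1) v
  have e1 : inner 𝕜 a' (B.j s) = -inner 𝕜 a (B.j (B.T s)) := by
    rw [← inner_conj_symm, ← inner_conj_symm a, ha s]; simp
  have e2 : inner 𝕜 (B.j p) k = -inner 𝕜 (B.j (B.T p)) v := by rw [hv p, neg_neg]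
  have e3 : inner 𝕜 a' (B.j s) + inner 𝕜 (B.j p) k =
      -inner 𝕜 (a - (B.U (n + 1)).starProjection a) (B.j (B.T s)) -
        inner 𝕜 (B.j (B.T p)) (v - (B.U (n + 1)).starProjection v) := by
    rw [e1, e2, ← hpa, ← hsv, inner_sub_left, inner_sub_right, B.T_skew p s]; ring
  have b1 := B.inner_T_truncation n a v hs hsv
  have b2 := B.inner_T_truncation n v a hp hpa
  rw [← hsv, ← hpa, e3]
  refine (norm_sub_le _ _).trans ?_
  rw [norm_neg, norm_inner_symm (B.j (B.T p))]
  refine (add_le_add b1 b2).trans ?_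
  set x0 := ‖degProj B.U n a‖
  set x1 := ‖degProj B.U (n + 1) a‖
  set y0 := ‖degProj B.U n v‖
  set y1 := ‖degProj B.U (n + 1) v‖
  have hn : (0 : ℝ) ≤ n := Nat.cast_nonneg n
  have q1 : x1 * y0 + y1 * x0 ≤ x0 ^ 2 + y0 ^ 2 + (x1 ^ 2 + y1 ^ 2) := by
    nlinarith [sq_nonneg (x1 - y0), sq_nonneg (y1 - x0), sq_nonneg x0, sq_nonneg y0,
      sq_nonneg x1, sq_nonneg y1]
  calc x1 * (B.C * (n + 2) * y0) + y1 * (B.C * (n + 2) * x0)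
      = B.C * (n + 2) * (x1 * y0 + y1 * x0) := by ring
    _ ≤ B.C * (2 * (n + 1)) * (x0 ^ 2 + y0 ^ 2 + (x1 ^ 2 + y1 ^ 2)) := by
        gcongr; linarith
    _ = _ := by ring

end BandModel

/-! ### Functions of the degree -/

namespace BandModel

variable {𝕜 M H : Type*} [RCLike 𝕜] [AddCommGroup M] [Module 𝕜 M]
    [NormedAddCommGroup H] [InnerProductSpace 𝕜 H] (B : BandModel 𝕜 M H)

theorem eq_zero_of_degProj {x : H} (h : ∀ n, degProj B.U n x = 0) : x = 0 := by
  have h1 := B.hasSum_norm_sq x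
  simp only [h, norm_zero, ne_eq, OfNat.ofNat_ne_zero, not_false_eq_true, zero_pow] at h1
  have h2 := h1.unique hasSum_zero
  simpa using h2

theorem eq_of_degProj {x y : H} (h : ∀ n, degProj B.U n x = degProj B.U n y) : x = y :=
  sub_eq_zero.1 (B.eq_zero_of_degProj fun n => by rw [map_sub, h n, sub_self])

theorem mem_U_of_degProj {n : ℕ} {x : H} (h : ∀ m, n ≤ m → degProj B.U m x = 0) : x ∈ B.U n := by
  have h1 : x = (B.U n).starProjection x := by
    refine B.eq_of_degProj fun m => ?_
    rcases le_or_gt n m with hm | hm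
    · rw [h m hm, degProj_of_mem B.U_mono hm (Submodule.starProjection_apply_mem _ _)]
    · refine ext_inner_right 𝕜 fun y => ?_
      rw [inner_degProj_left, inner_degProj_left, Submodule.inner_starProjection_left_eq_right,
        Submodule.starProjection_eq_self_iff.2 (B.U_mono hm (degProj_mem B.U_mono m y))]
  rw [h1]
  exact Submodule.starProjection_apply_mem _ _

/-- The eigenvalues of `D` are real. -/
theorem conj_eig (n : ℕ) :
    (starRingEnd 𝕜) ((n : 𝕜) * (n + 1) / 2) = (n : 𝕜) * (n + 1) / 2 := by
  rw [show ((n : 𝕜) * (n + 1) / 2) = (((n : ℝ) * (n + 1) / 2 : ℝ) : 𝕜) by push_cast; rfl,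
    RCLike.conj_ofReal]

theorem degProj_D (n : ℕ) (f : M) :
    degProj B.U n (B.j (B.D f)) = ((n : 𝕜) * (n + 1) / 2) • degProj B.U n (B.j f) := by
  refine ext_inner_right 𝕜 fun y => ?_
  obtain ⟨r, hr, hry⟩ := B.exists_degProj_eq n y
  have hD := B.j_D_of_orthogonal hr fun z hz => by
    rw [hry]; exact inner_degProj_of_mem B.U_mono hz y
  rw [inner_degProj_left, inner_smul_left, inner_degProj_left, ← hry, B.D_symm, hD,
    inner_smul_right, conj_eig]

variable [CompleteSpace H]

/-- The operator acting on the degree-`n` part as multiplication by `d n`, for summable `d`. -/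
def diag (d : ℕ → ℝ) : H →L[𝕜] H := ∑' n, (d n : 𝕜) • degProj B.U n

theorem hasSum_diag {d : ℕ → ℝ} (hd : Summable fun n => |d n|) (x : H) :
    HasSum (fun n => (d n : 𝕜) • degProj B.U n x) (B.diag d x) := by
  have h : Summable fun n => (d n : 𝕜) • degProj B.U n := by
    refine Summable.of_norm_bounded hd fun n => ?_
    rw [norm_smul, RCLike.norm_ofReal]
    refine mul_le_of_le_one_right (abs_nonneg _) ?_
    refine ContinuousLinearMap.opNorm_le_bound _ zero_le_one fun x => ?_
    rw [one_mul]
    exact norm_degProj_le B.U_mono n x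
  exact h.hasSum.mapL (ContinuousLinearMap.apply 𝕜 H x)

theorem degProj_diag {d : ℕ → ℝ} (hd : Summable fun n => |d n|) (m : ℕ) (x : H) :
    degProj B.U m (B.diag d x) = (d m : 𝕜) • degProj B.U m x := by
  have h := (B.hasSum_diag hd x).mapL (degProj B.U m)
  refine h.unique ?_
  convert hasSum_single m ?_ using 1
  · rw [map_smul, degProj_degProj_self B.U_mono]
  · intro n hn
    rw [map_smul, degProj_degProj_of_ne B.U_mono hn.symm, smul_zero]

theorem inner_diag_left {d : ℕ → ℝ} (hd : Summable fun n => |d n|) (x y : H) :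
    inner 𝕜 (B.diag d x) y = inner 𝕜 x (B.diag d y) := by
  have h1 := (B.hasSum_diag hd x).mapL (innerSL 𝕜 y)
  have h2 := (B.hasSum_diag hd y).mapL (innerSL 𝕜 x)
  have h3 := h1.star
  simp only [innerSL_apply_apply] at h2 h3
  have e : ∀ n, star (inner 𝕜 y ((d n : 𝕜) • degProj B.U n x)) =
      inner 𝕜 x ((d n : 𝕜) • degProj B.U n y) := fun n => by
    rw [inner_smul_right, inner_smul_right, star_mul', ← inner_degProj_left]
    simp [RCLike.star_def]
  simp only [e] at h3
  rw [← h3.unique h2, RCLike.star_def, inner_conj_symm]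

/-! ### The inverse of `D` and the resolvent -/

/-- The inverse eigenvalues `2 / (n (n + 1))` of `D`, with the value `0` at `n = 0`. -/
def invEig (n : ℕ) : ℝ := 2 / (n * (n + 1))

theorem invEig_nonneg (n : ℕ) : 0 ≤ invEig n := by unfold invEig; positivity

theorem summable_invEig : Summable fun n => |invEig n| := by
  have h := (Real.summable_one_div_nat_pow.2 (by norm_num : 1 < 2)).mul_left 2
  refine Summable.of_nonneg_of_le (fun n => abs_nonneg _) (fun n => ?_) h
  rw [abs_of_nonneg (invEig_nonneg n), invEig]
  rcases n.eq_zero_or_pos with rfl | hn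
  · simp
  · have : (0 : ℝ) < n := by exact_mod_cast hn
    rw [mul_one_div]
    gcongr
    nlinarith

theorem invEig_one : invEig 1 = 1 := by norm_num [invEig]

theorem invEig_le {n : ℕ} (hn : n ≠ 1) : invEig n ≤ 1 / 3 := by
  rcases n.eq_zero_or_pos with rfl | h
  · norm_num [invEig]
  · have h2 : (2 : ℝ) ≤ n := by exact_mod_cast (by omega : 2 ≤ n)
    rw [invEig, div_le_div_iff₀ (by positivity) (by norm_num)]
    nlinarith

/-- The inverse of `D` on the complement of the constants, extended by `0`. -/
def Dinv : H →L[𝕜] H := B.diag invEig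

/-- `1 - D⁻¹`, the Hilbert space form of the operator `L_ε`. -/
def P : H →L[𝕜] H := 1 - B.Dinv

omit [CompleteSpace H] in
theorem P_apply (x : H) : B.P x = x - B.Dinv x := rfl

theorem degProj_Dinv (m : ℕ) (x : H) :
    degProj B.U m (B.Dinv x) = (invEig m : 𝕜) • degProj B.U m x :=
  B.degProj_diag summable_invEig m x

theorem degProj_P (m : ℕ) (x : H) :
    degProj B.U m (B.P x) = ((1 - invEig m : ℝ) : 𝕜) • degProj B.U m x := by
  rw [P_apply, map_sub, degProj_Dinv]
  push_cast
  rw [sub_smul, one_smul]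

theorem inner_P_left (x y : H) : inner 𝕜 (B.P x) y = inner 𝕜 x (B.P y) := by
  rw [P_apply, P_apply, inner_sub_left, inner_sub_right, Dinv,
    B.inner_diag_left summable_invEig]

theorem hasSum_inner_P (x : H) :
    HasSum (fun n => (1 - invEig n) * ‖degProj B.U n x‖ ^ 2) (RCLike.re (inner 𝕜 x (B.P x))) := by
  have h1 := (B.hasSum_diag summable_invEig x).mapL (innerSL 𝕜 x)
  have h2 := h1.mapL RCLike.reCLM
  have h3 := (B.hasSum_norm_sq x).sub h2
  have e1 : ∀ n, (1 - invEig n) * ‖degProj B.U n x‖ ^ 2 = ‖degProj B.U n x‖ ^ 2 -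
      RCLike.reCLM (innerSL 𝕜 x ((invEig n : 𝕜) • degProj B.U n x)) := fun n => by
    simp only [innerSL_apply_apply, inner_smul_right, RCLike.reCLM_apply]
    rw [← inner_degProj_left, inner_degProj_self B.U_mono, ← RCLike.ofReal_mul, RCLike.ofReal_re]
    ring
  have e2 : RCLike.re (inner 𝕜 x (B.P x)) = ‖x‖ ^ 2 -
      RCLike.reCLM (innerSL 𝕜 x (B.diag invEig x)) := by
    rw [P_apply, inner_sub_right, map_sub, inner_self_eq_norm_sq]
    rfl
  simp only [e1, e2]
  exact h3

theorem inner_P_nonneg (x : H) : 0 ≤ RCLike.re (inner 𝕜 x (B.P x)) := by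
  refine (B.hasSum_inner_P x).nonneg fun n => mul_nonneg ?_ (by positivity)
  rcases eq_or_ne n 1 with rfl | h
  · simp [invEig_one]
  · linarith [invEig_le h]

/-- Spectral gap: `P ≥ 2/3` on the complement of the degree-one part. -/
theorem gap {x : H} (hx : degProj B.U 1 x = 0) :
    2 / 3 * ‖x‖ ^ 2 ≤ RCLike.re (inner 𝕜 x (B.P x)) := by
  refine hasSum_le (fun n => ?_) ((B.hasSum_norm_sq x).mul_left (2 / 3)) (B.hasSum_inner_P x)
  rcases eq_or_ne n 1 with rfl | h
  · simp [hx]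
  · exact mul_le_mul_of_nonneg_right (by linarith [invEig_le h]) (by positivity)

theorem im_inner_P (x : H) : RCLike.im (inner 𝕜 x (B.P x)) = 0 := by
  have h : inner 𝕜 x (B.P x) = (starRingEnd 𝕜) (inner 𝕜 x (B.P x)) := by
    rw [inner_conj_symm, inner_P_left]
  exact RCLike.conj_eq_iff_im.1 h.symm

theorem inner_P_eq_re (x : H) : inner 𝕜 x (B.P x) = (RCLike.re (inner 𝕜 x (B.P x)) : 𝕜) :=
  RCLike.conj_eq_iff_re.1 (RCLike.conj_eq_iff_im.2 (B.im_inner_P x)) |>.symm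

theorem P_eq_zero_of_re_inner {x : H} (h : RCLike.re (inner 𝕜 x (B.P x)) = 0) : B.P x = 0 := by
  have h1 := B.hasSum_inner_P x
  rw [h] at h1
  have h0 : ∀ n, 0 ≤ (1 - invEig n) * ‖degProj B.U n x‖ ^ 2 := fun n => by
    refine mul_nonneg ?_ (by positivity)
    rcases eq_or_ne n 1 with rfl | h
    · simp [invEig_one]
    · linarith [invEig_le h]
  rw [hasSum_zero_iff_of_nonneg h0] at h1
  refine B.eq_zero_of_degProj fun n => ?_
  rw [degProj_P]
  have h2 := congrFun h1 n
  rcases mul_eq_zero.1 h2 with h3 | h3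
  · simp [h3]
  · rw [norm_eq_zero.1 (pow_eq_zero_iff two_ne_zero |>.1 h3), smul_zero]

/-- The kernel of `P` is the degree-one part. -/
theorem P_eq_zero_iff {x : H} : B.P x = 0 ↔ x ∈ B.U 2 ∧ ∀ y ∈ B.U 1, inner 𝕜 x y = 0 := by
  constructor
  · intro h
    have h1 : ∀ n, n ≠ 1 → degProj B.U n x = 0 := by
      intro n hn
      have h2 := B.degProj_P n x
      rw [h, map_zero] at h2
      refine (smul_eq_zero.1 h2.symm).resolve_left ?_
      rw [RCLike.ofReal_eq_zero]
      linarith [invEig_le hn]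
    have h2 : x = degProj B.U 1 x := by
      refine B.eq_of_degProj fun n => ?_
      rcases eq_or_ne n 1 with rfl | hn
      · rw [degProj_degProj_self B.U_mono]
      · rw [degProj_degProj_of_ne B.U_mono hn, h1 n hn]
    rw [h2]
    exact ⟨degProj_mem B.U_mono 1 x, fun y hy => inner_degProj_of_mem B.U_mono hy x⟩
  · rintro ⟨h1, h2⟩
    refine B.eq_zero_of_degProj fun n => ?_
    rw [degProj_P]
    rcases lt_trichotomy n 1 with hn | rfl | hn
    · have : degProj B.U n x = 0 := by
        refine ext_inner_right 𝕜 fun y => ?_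
        rw [inner_degProj_left, h2 _ (B.U_mono hn (degProj_mem B.U_mono n y)), inner_zero_left]
      rw [this, smul_zero]
    · simp [invEig_one]
    · rw [degProj_of_mem B.U_mono hn h1, smul_zero]

theorem eig_mul_invEig {n : ℕ} (hn : n ≠ 0) : ((n : 𝕜) * (n + 1) / 2) * (invEig n : 𝕜) = 1 := by
  have h : (n : ℝ) ≠ 0 := by exact_mod_cast hn
  have h1 : (n : ℝ) + 1 ≠ 0 := by positivity
  have h2 : ((n : ℝ) * (n + 1) / 2) * invEig n = 1 := by unfold invEig; field_simp
  have h3 := congrArg (fun t : ℝ => (t : 𝕜)) h2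
  push_cast at h3
  exact h3

/-- Weak solutions `y` of `D y = w`, where `w` has no constant part, are `D⁻¹ w` up to
constants. -/
theorem sub_degProj_eq_Dinv {y w : H} (hw : degProj B.U 0 w = 0)
    (h : ∀ f, inner 𝕜 (B.j (B.D f)) y = inner 𝕜 (B.j f) w) :
    y - degProj B.U 0 y = B.Dinv w := by
  refine B.eq_of_degProj fun n => ?_
  rw [degProj_Dinv, map_sub]
  rcases eq_or_ne n 0 with rfl | hn
  · rw [degProj_degProj_self B.U_mono, hw, sub_self, smul_zero]
  rw [degProj_degProj_of_ne B.U_mono hn, sub_zero]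
  have h1 : ((n : 𝕜) * (n + 1) / 2) • degProj B.U n y = degProj B.U n w := by
    refine ext_inner_left 𝕜 fun z => ?_
    obtain ⟨r, hr, hrz⟩ := B.exists_degProj_eq n z
    have hD := B.j_D_of_orthogonal hr fun x hx => by
      rw [hrz]; exact inner_degProj_of_mem B.U_mono hx z
    have h2 := h r
    rw [hD, hrz, inner_smul_left] at h2
    rw [inner_smul_right, ← inner_degProj_left, ← inner_degProj_left, ← h2, conj_eig]
  rw [← h1, smul_smul, mul_comm, eig_mul_invEig hn, one_smul]

/-- Solutions of `D g = w` for polynomial right-hand sides approximate `D⁻¹ w`. -/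
theorem exists_approx_Dinv {w : H} (hw : degProj B.U 0 w = 0) :
    ∃ g : ℕ → M, Tendsto (fun n => B.j (g n)) atTop (𝓝 (B.Dinv w)) ∧
      Tendsto (fun n => B.j (B.D (g n))) atTop (𝓝 w) := by
  have hex : ∀ n, ∃ g : M, B.j g = B.Dinv ((B.U n).starProjection w) := by
    intro n
    have : B.Dinv ((B.U n).starProjection w) ∈ B.U n := B.mem_U_of_degProj fun m hm => by
      rw [degProj_Dinv, degProj_of_mem B.U_mono hm (Submodule.starProjection_apply_mem _ _),
        smul_zero]
    obtain ⟨g, _, hg⟩ := this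
    exact ⟨g, hg⟩
  choose g hg using hex
  refine ⟨g, ?_, ?_⟩
  · simp only [hg]
    exact (B.Dinv.continuous.tendsto w).comp (B.tendsto_starProjection w)
  · have h1 : ∀ n, B.j (B.D (g n)) = (B.U n).starProjection w -
        degProj B.U 0 ((B.U n).starProjection w) := by
      intro n
      refine B.eq_of_degProj fun m => ?_
      rw [degProj_D, hg, degProj_Dinv, map_sub]
      rcases eq_or_ne m 0 with rfl | hm
      · rw [degProj_degProj_self B.U_mono]; simp
      · rw [smul_smul, eig_mul_invEig hm, one_smul, degProj_degProj_of_ne B.U_mono hm, sub_zero]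
    simp only [h1]
    have h2 := B.tendsto_starProjection w
    have h3 := h2.sub (((degProj B.U 0).continuous.tendsto w).comp h2)
    rwa [hw, sub_zero] at h3

/-- The values `2 / ((n - 1) (n + 2))` of `(1 - 2 / (n (n + 1)))⁻¹ - 1`, with the value `0` at
`n = 0`, where `P` is the identity, and at `n = 1`, where `P` vanishes.  They are summable, so that
`P⁻¹ - 1` is given by `diag`. -/
def gapCoeff (n : ℕ) : ℝ := if n ≤ 1 then 0 else 2 / ((n - 1) * (n + 2))

theorem summable_gapCoeff : Summable fun n => |gapCoeff n| := by
  have h := (Real.summable_one_div_nat_pow.2 (by norm_num : 1 < 2)).mul_left 2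
  refine Summable.of_nonneg_of_le (fun n => abs_nonneg _) (fun n => ?_) h
  unfold gapCoeff
  split_ifs with hn
  · simp
  · have h2 : (2 : ℝ) ≤ n := by exact_mod_cast (by omega : 2 ≤ n)
    have h3 : (0 : ℝ) < (n - 1) * (n + 2) := by nlinarith
    rw [abs_of_nonneg (by positivity), mul_one_div]
    gcongr
    nlinarith

theorem one_sub_invEig_mul {n : ℕ} (hn : n ≠ 1) : (1 - invEig n) * (1 + gapCoeff n) = 1 := by
  unfold invEig gapCoeff
  rcases n.eq_zero_or_pos with rfl | h
  · simp
  · have h2 : (2 : ℝ) ≤ n := by exact_mod_cast (by omega : 2 ≤ n)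
    rw [if_neg (by omega)]
    have h3 : (n : ℝ) - 1 ≠ 0 := by linarith
    field_simp
    ring

/-- `P` is invertible on polynomials without degree-one part. -/
theorem exists_P_eq {p : M} (hp : degProj B.U 1 (B.j p) = 0) :
    ∃ y : H, B.P y = B.j p ∧ degProj B.U 1 y = 0 := by
  have hd : ∀ n, degProj B.U n (B.j p + B.diag gapCoeff (B.j p)) =
      ((1 + gapCoeff n : ℝ) : 𝕜) • degProj B.U n (B.j p) := fun n => by
    rw [map_add, B.degProj_diag summable_gapCoeff]
    push_cast
    rw [add_smul, one_smul]
  refine ⟨B.j p + B.diag gapCoeff (B.j p), B.eq_of_degProj fun n => ?_, ?_⟩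
  · rw [degProj_P, hd, smul_smul, ← RCLike.ofReal_mul]
    rcases eq_or_ne n 1 with rfl | hn
    · rw [hp, smul_zero]
    · rw [one_sub_invEig_mul hn, RCLike.ofReal_one, one_smul]
  · rw [hd, hp, smul_zero]

/-- The adjoint expression `conj λ - P T` of `λ + T P`, on polynomials. -/
def adjointOp (lam : 𝕜) : M →ₗ[𝕜] H :=
  (starRingEnd 𝕜 lam) • B.j - (B.P : H →ₗ[𝕜] H) ∘ₗ B.j ∘ₗ B.T

omit [CompleteSpace H] in
theorem adjointOp_apply (lam : 𝕜) (p : M) :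
    B.adjointOp lam p = (starRingEnd 𝕜 lam) • B.j p - B.P (B.j (B.T p)) := rfl

theorem inner_adjointOp (lam : 𝕜) (p : M) (w : H) : inner 𝕜 (B.adjointOp lam p) w =
    lam * inner 𝕜 (B.j p) w - inner 𝕜 (B.j (B.T p)) (B.P w) := by
  rw [adjointOp_apply, inner_sub_left, inner_smul_left, inner_P_left]
  simp

omit [CompleteSpace H] in
theorem re_inner_T_self (p : M) : RCLike.re (inner 𝕜 (B.j p) (B.j (B.T p))) = 0 := by
  have h := congrArg RCLike.re (B.T_skew p p)
  rw [← inner_conj_symm, RCLike.conj_re, map_neg] at h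
  linarith

/-- Coercivity: away from the imaginary axis, `conj λ - P T` is bounded below.  The degree-one
part is controlled because `P` annihilates it, and the remainder `p = P y` by testing against
`y`, where the skew-symmetric term drops out and the spectral gap of `P` applies. -/
theorem adjointOp_bound {lam : 𝕜} (hl : RCLike.re lam ≠ 0) :
    ∃ C, ∀ p, ‖B.j p‖ ≤ C * ‖B.adjointOp lam p‖ := by
  have hl0 : 0 < ‖lam‖ := norm_pos_iff.2 fun h => hl (by simp [h])
  have hre : 0 < |RCLike.re lam| := abs_pos.2 hl
  have hC := B.C_nonneg
  set A := ‖lam‖ + ‖B.P‖ * (B.C * 3) with hA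
  refine ⟨1 / ‖lam‖ + ‖B.P‖ * (3 / (2 * |RCLike.re lam|) * (1 + A * (1 / ‖lam‖))), fun p => ?_⟩
  set b := ‖B.adjointOp lam p‖ with hb
  obtain ⟨p1, hp1, hp1e⟩ := B.exists_degProj_eq 1 (B.j p)
  -- `P` annihilates degree one, so the degree-one part of `conj λ p - P T p` is `conj λ p1`.
  have hone : ‖B.j p1‖ ≤ 1 / ‖lam‖ * b := by
    have h1 : degProj B.U 1 (B.adjointOp lam p) = (starRingEnd 𝕜 lam) • B.j p1 := by
      rw [adjointOp_apply, map_sub, map_smul, degProj_P, invEig_one, hp1e]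
      simp
    have h2 := norm_degProj_le B.U_mono 1 (B.adjointOp lam p)
    rw [h1, norm_smul, RCLike.norm_conj] at h2
    rw [one_div, inv_mul_eq_div, le_div_iff₀ hl0, mul_comm]
    exact h2
  have hB1 : ‖B.adjointOp lam p1‖ ≤ A * ‖B.j p1‖ := by
    rw [adjointOp_apply, hA, add_mul]
    refine (norm_sub_le _ _).trans (add_le_add ?_ ?_)
    · rw [norm_smul, RCLike.norm_conj]
    · refine (B.P.le_opNorm _).trans ?_
      rw [mul_assoc]
      gcongr
      refine (B.norm_T_le hp1).trans_eq ?_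
      norm_num
  have hx' : degProj B.U 1 (B.j (p - p1)) = 0 := by
    rw [map_sub, map_sub, hp1e, degProj_degProj_self B.U_mono, sub_self]
  -- With `p - p1 = P y`, the real part of `⟨y, conj λ P y - P T P y⟩` is `Re λ ⟨y, P y⟩`.
  obtain ⟨y, hy, hy1⟩ := B.exists_P_eq hx'
  have hB' : ‖B.adjointOp lam (p - p1)‖ ≤ (1 + A * (1 / ‖lam‖)) * b := by
    rw [map_sub]
    refine (norm_sub_le _ _).trans ?_
    have : A * ‖B.j p1‖ ≤ A * (1 / ‖lam‖ * b) := by gcongr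
    linarith
  have hyb : ‖y‖ ≤ 3 / (2 * |RCLike.re lam|) * ‖B.adjointOp lam (p - p1)‖ := by
    have h1 : inner 𝕜 y (B.adjointOp lam (p - p1)) = (starRingEnd 𝕜 lam) * inner 𝕜 y (B.P y) -
        inner 𝕜 (B.j (p - p1)) (B.j (B.T (p - p1))) := by
      rw [adjointOp_apply, inner_sub_right, inner_smul_right, ← inner_P_left, hy]
    have h2 := congrArg RCLike.re h1
    rw [map_sub (RCLike.re : 𝕜 →+ ℝ), re_inner_T_self, sub_zero, inner_P_eq_re, mul_comm, RCLike.re_ofReal_mul,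
      RCLike.conj_re] at h2
    have h3 := B.gap hy1
    have h4 : RCLike.re (inner 𝕜 y (B.P y)) * |RCLike.re lam| ≤
        ‖y‖ * ‖B.adjointOp lam (p - p1)‖ := by
      rw [← abs_of_nonneg (B.inner_P_nonneg y), ← abs_mul, ← h2]
      exact (RCLike.abs_re_le_norm _).trans (norm_inner_le_norm _ _)
    rcases (norm_nonneg y).eq_or_lt with h5 | h5
    · rw [← h5]; positivity
    · have h6 : 2 / 3 * ‖y‖ * |RCLike.re lam| ≤ ‖B.adjointOp lam (p - p1)‖ := by
        refine le_of_mul_le_mul_left ?_ h5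
        nlinarith
      rw [div_mul_eq_mul_div, le_div_iff₀ (by positivity)]
      linarith
  have hfin : ‖B.j (p - p1)‖ ≤ ‖B.P‖ * ‖y‖ := by rw [← hy]; exact B.P.le_opNorm _
  calc ‖B.j p‖ = ‖B.j p1 + B.j (p - p1)‖ := by rw [← map_add]; congr 2; abel
    _ ≤ ‖B.j p1‖ + ‖B.j (p - p1)‖ := norm_add_le _ _
    _ ≤ 1 / ‖lam‖ * b + ‖B.P‖ * (3 / (2 * |RCLike.re lam|) * ((1 + A * (1 / ‖lam‖)) * b)) := by
        refine add_le_add hone (hfin.trans ?_)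
        gcongr
        refine hyb.trans ?_
        gcongr
    _ = _ := by ring

/-- If `w` is orthogonal to the range, then `T P w = -λ w` in the sense of the maximal operator.  Its
skew-symmetry gives `Re λ ⟨w, P w⟩ = 0`, hence `P w = 0` and `λ w = 0`. -/
theorem adjointOp_denseRange {lam : 𝕜} (hl : RCLike.re lam ≠ 0) :
    DenseRange (B.adjointOp lam) := by
  have hl0 : lam ≠ 0 := fun h => hl (by simp [h])
  have key : (LinearMap.range (B.adjointOp lam))ᗮ = ⊥ := by
    rw [eq_bot_iff]
    intro w hw
    have h1 : ∀ p, lam * inner 𝕜 (B.j p) w = inner 𝕜 (B.j (B.T p)) (B.P w) := fun p => by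
      have := hw _ ⟨p, rfl⟩
      rw [inner_adjointOp, sub_eq_zero] at this
      exact this
    have hweak : B.Weak (B.P w) (-(lam • w)) := fun p => by
      rw [← h1, inner_neg_right, neg_neg, inner_smul_right]
    have h2 := hweak.inner_eq B hweak
    have h3 : inner 𝕜 (B.P w) w = inner 𝕜 w (B.P w) := B.inner_P_left w w
    rw [inner_neg_left, inner_neg_right, inner_smul_left, inner_smul_right, h3,
      inner_P_eq_re, neg_neg, neg_eq_iff_add_eq_zero, ← add_mul, add_comm, RCLike.add_conj] at h2
    have h4 : RCLike.re (inner 𝕜 w (B.P w)) = 0 := by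
      have h5 : ((2 * RCLike.re lam * RCLike.re (inner 𝕜 w (B.P w)) : ℝ) : 𝕜) = 0 := by
        push_cast; exact h2
      rw [RCLike.ofReal_eq_zero] at h5
      exact (mul_eq_zero.1 h5).resolve_left (mul_ne_zero two_ne_zero hl)
    have h6 := B.P_eq_zero_of_re_inner h4
    have h7 : ∀ p, inner 𝕜 (B.j p) w = 0 := fun p => by
      have := h1 p
      rw [h6, inner_zero_right] at this
      exact (mul_eq_zero.1 this).resolve_left hl0
    exact B.dense.eq_zero_of_inner_right 𝕜 h7
  have h := (Submodule.topologicalClosure_eq_top_iff).2 key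
  have := Submodule.dense_iff_topologicalClosure_eq_top.2 h
  rwa [LinearMap.coe_range] at this

/-- The resolvent of `-T P` at `λ` off the imaginary axis, where `T` stands for the maximal operator:
it is the adjoint of the inverse of `conj λ - P T`. -/
theorem exists_resolvent {lam : 𝕜} (hl : RCLike.re lam ≠ 0) :
    ∃ R : H →L[𝕜] H, ∀ w h, B.Weak (B.P w) (h - lam • w) ↔ R h = w := by
  obtain ⟨C, hC⟩ := B.adjointOp_bound hl
  have hd := B.adjointOp_denseRange hl
  let S : H →L[𝕜] H := B.j.extendOfNorm (B.adjointOp lam)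
  have hS : ∀ p, S (B.adjointOp lam p) = B.j p := B.j.extendOfNorm_eq hd ⟨C, hC⟩
  refine ⟨S.adjoint, fun w h => ?_⟩
  have h1 : B.Weak (B.P w) (h - lam • w) ↔
      ∀ p, inner 𝕜 (B.adjointOp lam p) (S.adjoint h - w) = 0 := by
    refine forall_congr' fun p => ?_
    rw [inner_sub_right, inner_sub_right, ContinuousLinearMap.adjoint_inner_right, hS,
      inner_adjointOp, inner_smul_right]
    constructor
    · intro e; rw [e]; ring
    · intro e; linear_combination e
  rw [h1]
  constructor
  · intro e
    rw [← sub_eq_zero]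
    exact hd.eq_zero_of_inner_right 𝕜 e
  · intro e p
    rw [e, sub_self, inner_zero_right]

end BandModel

/-! ### Families of functions which separate integrable functions -/

theorem measurable_bounded_of_mem_closure {Z ι : Type*} [MeasurableSpace Z] {Φ : ι → Z → ℝ}
    (hm : ∀ i, Measurable (Φ i)) (hb : ∀ i z, Φ i z ∈ Icc (-1 : ℝ) 1) {F : Z → ℝ}
    (hF : F ∈ Submonoid.closure (range Φ)) : Measurable F ∧ ∀ z, ‖F z‖ ≤ 1 := by
  induction hF using Submonoid.closure_induction with
  | mem F hF =>
    obtain ⟨i, rfl⟩ := hF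
    exact ⟨hm i, fun z => abs_le.2 (hb i z)⟩
  | one => exact ⟨measurable_const, fun z => by simp⟩
  | mul F G _ _ hF hG =>
    refine ⟨hF.1.mul hG.1, fun z => ?_⟩
    rw [Pi.mul_apply, norm_mul]
    exact mul_le_one₀ (hF.2 z) (norm_nonneg _) (hG.2 z)

open scoped BoundedContinuousFunction in
/-- If a multiplicative family of functions contains bounded coordinates `Φ` which are injective
on a set of full measure, then an integrable function orthogonal to the family vanishes.  By the
Stone-Weierstrass theorem, the images under `Φ` of the measures with densities the positive and the
negative part of the function agree; injective measurable maps of standard Borel spaces have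
measurable images, so the measures themselves agree. -/
theorem ae_eq_zero_of_separating {Z ι : Type*} [MeasurableSpace Z] [StandardBorelSpace Z]
    [Countable ι] {μ : Measure Z} {S : Set Z} (hS : MeasurableSet S) (hμ : μ Sᶜ = 0)
    (Φ : ι → Z → ℝ) (hm : ∀ i, Measurable (Φ i)) (hb : ∀ i z, Φ i z ∈ Icc (-1 : ℝ) 1)
    (hinj : ∀ z ∈ S, ∀ w ∈ S, (∀ i, Φ i z = Φ i w) → z = w) {v : Z → ℝ} (hv : Integrable v μ)
    (h0 : ∀ F ∈ Submonoid.closure (range Φ), ∫ z, F z * v z ∂μ = 0) : v =ᵐ[μ] 0 := by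
  -- Only these properties of the closure are needed; hiding it behind `N` keeps unification cheap.
  obtain ⟨N, hN, hbd, h0⟩ : ∃ N : Submonoid (Z → ℝ), (∀ i, Φ i ∈ N) ∧
      (∀ F ∈ N, Measurable F ∧ ∀ z, ‖F z‖ ≤ 1) ∧ ∀ F ∈ N, ∫ z, F z * v z ∂μ = 0 :=
    ⟨Submonoid.closure (range Φ), fun i => Submonoid.subset_closure ⟨i, rfl⟩,
      fun F hF => measurable_bounded_of_mem_closure hm hb hF, h0⟩
  let Ψ : Z → ι → Icc (-1 : ℝ) 1 := fun z i => ⟨Φ i z, hb i z⟩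
  have hΨ : Measurable Ψ := measurable_pi_lambda _ fun i => (hm i).subtype_mk
  have hfin : ∀ w : Z → ℝ, Integrable w μ →
      IsFiniteMeasure (μ.withDensity fun z => ENNReal.ofReal (w z)) := fun w hw =>
    isFiniteMeasure_withDensity_ofReal hw.2
  have hf1 := hfin v hv
  have hf2 := hfin (fun z => -v z) hv.neg
  set μ1 := μ.withDensity fun z => ENNReal.ofReal (v z) with hμ1
  set μ2 := μ.withDensity fun z => ENNReal.ofReal (-v z) with hμ2
  -- The continuous functions on the cube whose composition with `Ψ` is a combination of members of `N`.
  let A : StarSubalgebra ℝ ((ι → Icc (-1 : ℝ) 1) →ᵇ ℝ) :=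
    { carrier := {g | (fun z => g (Ψ z)) ∈ Algebra.adjoin ℝ (N : Set (Z → ℝ))}
      mul_mem' := fun {a b} ha hb => (Algebra.adjoin ℝ (N : Set (Z → ℝ))).mul_mem ha hb
      add_mem' := fun {a b} ha hb => (Algebra.adjoin ℝ (N : Set (Z → ℝ))).add_mem ha hb
      algebraMap_mem' := fun r => (Algebra.adjoin ℝ (N : Set (Z → ℝ))).algebraMap_mem r
      star_mem' := fun {a} ha => by
        have : star a = a := by ext; simp
        rw [this]; exact ha }
  have hsep : (A.map (BoundedContinuousFunction.toContinuousMapStarₐ ℝ)).SeparatesPoints := by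
    intro x y hxy
    obtain ⟨i, hi⟩ := Function.ne_iff.1 hxy
    let c : (ι → Icc (-1 : ℝ) 1) →ᵇ ℝ := BoundedContinuousFunction.ofNormedAddCommGroup
      (fun p => (p i : ℝ)) (by fun_prop) 1 (fun p => abs_le.2 (p i).2)
    have hc : c ∈ A := Algebra.subset_adjoin (hN i)
    refine ⟨_, ⟨BoundedContinuousFunction.toContinuousMapStarₐ ℝ c, ⟨c, hc, rfl⟩, rfl⟩, ?_⟩
    exact fun h => hi (Subtype.ext h)
  have hint0 : ∀ F ∈ Algebra.adjoin ℝ (N : Set (Z → ℝ)),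
      Integrable (fun z => F z * v z) μ ∧ ∫ z, F z * v z ∂μ = 0 := by
    intro F hF
    have hF' : F ∈ Submodule.span ℝ (N : Set (Z → ℝ)) := by
      have := Algebra.adjoin_eq_span (R := ℝ) (N : Set (Z → ℝ))
      rw [Submonoid.closure_eq] at this
      rw [← this]; exact hF
    clear hF
    induction hF' using Submodule.span_induction with
    | mem F hF =>
      exact ⟨hv.bdd_mul (hbd F hF).1.aestronglyMeasurable (ae_of_all _ (hbd F hF).2), h0 F hF⟩
    | zero => simp
    | add F G _ _ hF hG =>
      simp only [Pi.add_apply, add_mul]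
      exact ⟨hF.1.add hG.1, by rw [integral_add hF.1 hG.1, hF.2, hG.2, add_zero]⟩
    | smul c F _ hF =>
      simp only [Pi.smul_apply, smul_eq_mul, mul_assoc]
      exact ⟨hF.1.const_mul c, by rw [integral_const_mul, hF.2, mul_zero]⟩
  have hP : μ1.map Ψ = μ2.map Ψ := by
    refine ext_of_forall_mem_subalgebra_integral_eq_of_polish (A := A) hsep fun g hg => ?_
    have hgm : Measurable fun z => g (Ψ z) := g.continuous.measurable.comp hΨ
    have hI : ∀ w : Z → ℝ, Integrable w μ →
        ∫ y, g y ∂((μ.withDensity fun z => ENNReal.ofReal (w z)).map Ψ) =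
          ∫ z, g (Ψ z) * max (w z) 0 ∂μ := by
      intro w hw
      rw [integral_map hΨ.aemeasurable g.continuous.aestronglyMeasurable,
        integral_withDensity_eq_integral_toReal_smul₀
          hw.aestronglyMeasurable.aemeasurable.ennreal_ofReal (ae_of_all _ fun _ => by simp)]
      refine integral_congr_ae (ae_of_all _ fun z => ?_)
      simp only [ENNReal.toReal_ofReal', smul_eq_mul, mul_comm]
    have hJ : ∀ w : Z → ℝ, Integrable w μ → Integrable (fun z => g (Ψ z) * max (w z) 0) μ :=
      fun w hw => hw.pos_part.bdd_mul hgm.aestronglyMeasurable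
        (ae_of_all _ fun z => g.norm_coe_le_norm (Ψ z))
    rw [hI v hv, hI (fun z => -v z) hv.neg, ← sub_eq_zero,
      ← integral_sub (hJ v hv) (hJ (fun z => -v z) hv.neg)]
    refine Eq.trans (integral_congr_ae (ae_of_all _ fun z => ?_)) (hint0 _ hg).2
    have h4 : max (v z) 0 - max (-v z) 0 = v z := max_zero_sub_eq_self (v z)
    simp only [← mul_sub, h4]
  have hEq : μ1 = μ2 := by
    ext B hB
    have h1 : ∀ ν : Measure Z, ν ≪ μ → ν B = (ν.map Ψ) (Ψ '' (B ∩ S)) := by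
      intro ν hν
      have hi : InjOn Ψ (B ∩ S) := fun z hz w hw hzw => hinj z hz.2 w hw.2 fun i =>
        congrArg Subtype.val (congrFun hzw i)
      rw [Measure.map_apply hΨ ((hB.inter hS).image_of_measurable_injOn hΨ hi)]
      have hnull : ν Sᶜ = 0 := hν hμ
      refine measure_congr ?_
      have hae : ∀ᵐ z ∂ν, z ∈ S := hnull
      filter_upwards [hae] with z hz
      refine propext ⟨fun h => ⟨z, ⟨h, hz⟩, rfl⟩, ?_⟩
      rintro ⟨w, hw, hwz⟩
      have : w = z := hinj w hw.2 z hz fun i => congrArg Subtype.val (congrFun hwz i)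
      exact this ▸ hw.1
    rw [h1 μ1 (withDensity_absolutelyContinuous _ _), h1 μ2 (withDensity_absolutelyContinuous _ _),
      hP]
  have hae := (withDensity_eq_iff hv.aestronglyMeasurable.aemeasurable.ennreal_ofReal
    hv.neg.aestronglyMeasurable.aemeasurable.ennreal_ofReal
    hv.lintegral_lt_top.ne).1 hEq
  filter_upwards [hae] with z hz
  have h3 : max (v z) 0 = max (-v z) 0 := by
    rw [← ENNReal.toReal_ofReal', ← ENNReal.toReal_ofReal', hz]; rfl
  have h4 : max (v z) 0 - max (-v z) 0 = v z := max_zero_sub_eq_self (v z)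
  rw [← h4, h3, sub_self]; rfl

theorem ae_eq_zero_of_separating_smul {𝕜 Z ι : Type*} [RCLike 𝕜] [MeasurableSpace Z]
    [StandardBorelSpace Z] [Countable ι] {μ : Measure Z} {S : Set Z} (hS : MeasurableSet S)
    (hμ : μ Sᶜ = 0) (Φ : ι → Z → ℝ) (hm : ∀ i, Measurable (Φ i))
    (hb : ∀ i z, Φ i z ∈ Icc (-1 : ℝ) 1)
    (hinj : ∀ z ∈ S, ∀ w ∈ S, (∀ i, Φ i z = Φ i w) → z = w) {v : Z → 𝕜} (hv : Integrable v μ)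
    (h0 : ∀ F ∈ Submonoid.closure (range Φ), ∫ z, F z • v z ∂μ = 0) : v =ᵐ[μ] 0 := by
  have hFv : ∀ F ∈ Submonoid.closure (range Φ), Integrable (fun z => F z • v z) μ := fun F hF =>
    hv.bdd_smul 1 (measurable_bounded_of_mem_closure hm hb hF).1.aestronglyMeasurable
      (ae_of_all _ (measurable_bounded_of_mem_closure hm hb hF).2)
  have hre := ae_eq_zero_of_separating hS hμ Φ hm hb hinj hv.re fun F hF => by
    have h := integral_re (hFv F hF)
    simp only [h0 F hF, RCLike.smul_re, map_zero] at h
    exact h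
  have him := ae_eq_zero_of_separating hS hμ Φ hm hb hinj hv.im fun F hF => by
    have h := integral_im (hFv F hF)
    simp only [h0 F hF, RCLike.smul_im, map_zero] at h
    exact h
  filter_upwards [hre, him] with z h1 h2
  exact RCLike.ext (by simpa using h1) (by simpa using h2)

/-! ### Directional derivatives -/

section Directional

variable {E : Type*} [NormedAddCommGroup E] [NormedSpace ℝ E]

/-- The derivative of `F` in the direction `v`. -/
def pd (v : ℝ × ℝ) (F : ℝ × ℝ → E) (z : ℝ × ℝ) : E := fderiv ℝ F z v

theorem dx_eq_pd (φ : ℝ × ℝ → ℝ) : dx φ = pd (1, 0) φ := rfl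

theorem dy_eq_pd (φ : ℝ × ℝ → ℝ) : dy φ = pd (0, 1) φ := rfl

theorem pd_const (v : ℝ × ℝ) (a : E) (z : ℝ × ℝ) : pd v (fun _ => a) z = 0 := by simp [pd]

theorem pd_add {F G : ℝ × ℝ → E} {z : ℝ × ℝ} (v : ℝ × ℝ) (hF : DifferentiableAt ℝ F z)
    (hG : DifferentiableAt ℝ G z) : pd v (fun w => F w + G w) z = pd v F z + pd v G z := by
  simp [pd, fderiv_fun_add hF hG]

theorem pd_smul {f : ℝ × ℝ → ℝ} {F : ℝ × ℝ → E} {z : ℝ × ℝ} (v : ℝ × ℝ)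
    (hf : DifferentiableAt ℝ f z) (hF : DifferentiableAt ℝ F z) :
    pd v (fun w => f w • F w) z = f z • pd v F z + pd v f z • F z := by
  simp [pd, fderiv_fun_smul hf hF]

theorem pd_sum {ι : Type*} {s : Finset ι} {F : ι → ℝ × ℝ → E} {z : ℝ × ℝ} (v : ℝ × ℝ)
    (hF : ∀ i ∈ s, DifferentiableAt ℝ (F i) z) :
    pd v (fun w => ∑ i ∈ s, F i w) z = ∑ i ∈ s, pd v (F i) z := by
  simp [pd, fderiv_fun_sum hF]

theorem pd_clm {E' : Type*} [NormedAddCommGroup E'] [NormedSpace ℝ E'] (L : E →L[ℝ] E')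
    {F : ℝ × ℝ → E} {z : ℝ × ℝ} (v : ℝ × ℝ) (hF : DifferentiableAt ℝ F z) :
    pd v (fun w => L (F w)) z = L (pd v F z) := by
  have h := (L.hasFDerivAt.comp z hF.hasFDerivAt).fderiv
  simp only [pd]
  erw [h]
  rfl

theorem pd_mul {𝕜 : Type*} [RCLike 𝕜] {F G : ℝ × ℝ → 𝕜} {z : ℝ × ℝ} (v : ℝ × ℝ)
    (hF : DifferentiableAt ℝ F z) (hG : DifferentiableAt ℝ G z) :
    pd v (fun w => F w * G w) z = F z * pd v G z + pd v F z * G z := by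
  simp [pd, fderiv_fun_mul hF hG, mul_comm]

theorem contDiff_pd {F : ℝ × ℝ → E} (hF : ContDiff ℝ (⊤ : ℕ∞) F) (v : ℝ × ℝ) :
    ContDiff ℝ (⊤ : ℕ∞) (pd v F) :=
  (hF.fderiv_right (m := (⊤ : ℕ∞)) (by simp)).clm_apply contDiff_const

theorem hasDerivAt_pd_x {F : ℝ × ℝ → E} {x y : ℝ} (hF : DifferentiableAt ℝ F (x, y)) :
    HasDerivAt (fun t => F (t, y)) (pd (1, 0) F (x, y)) x := by
  have h1 : HasDerivAt (fun t : ℝ => (t, y)) ((1 : ℝ), (0 : ℝ)) x :=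
    (hasDerivAt_id x).prodMk (hasDerivAt_const x y)
  exact hF.hasFDerivAt.comp_hasDerivAt x h1

theorem hasDerivAt_pd_y {F : ℝ × ℝ → E} {x y : ℝ} (hF : DifferentiableAt ℝ F (x, y)) :
    HasDerivAt (fun t => F (x, t)) (pd (0, 1) F (x, y)) y := by
  have h1 : HasDerivAt (fun t : ℝ => (x, t)) ((0 : ℝ), (1 : ℝ)) y :=
    (hasDerivAt_const y x).prodMk (hasDerivAt_id y)
  exact hF.hasFDerivAt.comp_hasDerivAt y h1

theorem pd_x_eq {F : ℝ × ℝ → E} (hF : Differentiable ℝ F) {x y : ℝ} {d : E}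
    (h : HasDerivAt (fun t => F (t, y)) d x) : pd (1, 0) F (x, y) = d :=
  (hasDerivAt_pd_x (hF _)).unique h

theorem pd_y_eq {F : ℝ × ℝ → E} (hF : Differentiable ℝ F) {x y : ℝ} {d : E}
    (h : HasDerivAt (fun t => F (x, t)) d y) : pd (0, 1) F (x, y) = d :=
  (hasDerivAt_pd_y (hF _)).unique h

end Directional

/-! ### Coordinates on the sphere -/

/-- `cosh y + ε cos x`. -/
def den (ε : ℝ) (z : ℝ × ℝ) : ℝ := Real.cosh z.2 + ε * Real.cos z.1

/-- `(1 - ε²) / (cosh y + ε cos x)² = g'(ψ_ε) / 2`: the area density of the unit sphere in the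
conformal coordinates `(x, y)`. -/
def rho (ε : ℝ) (z : ℝ × ℝ) : ℝ := (1 - ε ^ 2) / den ε z ^ 2

/-- The coordinates of the conformal map from the cylinder onto the unit sphere without the two points
`(±√(1 - ε²), 0, ε)`, which are the limits for `y → ±∞`. -/
def sph (ε : ℝ) : Fin 3 → ℝ × ℝ → ℝ :=
  ![fun z => Real.sqrt (1 - ε ^ 2) * Real.sinh z.2 / den ε z,
    fun z => Real.sqrt (1 - ε ^ 2) * Real.sin z.1 / den ε z,
    fun z => (Real.cos z.1 + ε * Real.cosh z.2) / den ε z]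

section Sphere

variable {ε : ℝ} (h0 : 0 ≤ ε) (h1 : ε < 1)
include h0 h1

theorem den_pos (z : ℝ × ℝ) : 0 < den ε z := denom_pos h0 h1 z.1 z.2

theorem one_sub_sq_pos : 0 < 1 - ε ^ 2 := by nlinarith

theorem sq_sqrt_eps : Real.sqrt (1 - ε ^ 2) ^ 2 = 1 - ε ^ 2 :=
  Real.sq_sqrt (one_sub_sq_pos h0 h1).le

theorem rho_pos (z : ℝ × ℝ) : 0 < rho ε z :=
  div_pos (one_sub_sq_pos h0 h1) (pow_pos (den_pos h0 h1 z) 2)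

theorem gp_eq (z : ℝ × ℝ) : gp ε z = 2 * rho ε z := by
  have h := omegaSteady_eq h0 h1 z.1 z.2
  simp only [omegaSteady, g, Prod.mk.eta] at h
  rw [gp, rho, den, ← neg_neg (Real.exp _), h]
  ring

omit h0 h1 in
theorem contDiff_den : ContDiff ℝ (⊤ : ℕ∞) (den ε) :=
  (Real.contDiff_cosh.comp contDiff_snd).add
    (contDiff_const.mul (Real.contDiff_cos.comp contDiff_fst))

theorem contDiff_sph (i : Fin 3) : ContDiff ℝ (⊤ : ℕ∞) (sph ε i) := by
  have hd := fun z => (den_pos h0 h1 z).ne'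
  fin_cases i
  · exact (contDiff_const.mul (Real.contDiff_sinh.comp contDiff_snd)).div contDiff_den hd
  · exact (contDiff_const.mul (Real.contDiff_sin.comp contDiff_fst)).div contDiff_den hd
  · exact ((Real.contDiff_cos.comp contDiff_fst).add
      (contDiff_const.mul (Real.contDiff_cosh.comp contDiff_snd))).div contDiff_den hd

theorem contDiff_rho : ContDiff ℝ (⊤ : ℕ∞) (rho ε) :=
  contDiff_const.div (contDiff_den.pow 2) fun z => (pow_pos (den_pos h0 h1 z) 2).ne'

omit h0 h1 in
theorem sph_apply (ε : ℝ) (z : ℝ × ℝ) : (fun i => sph ε i z) =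
    ![Real.sqrt (1 - ε ^ 2) * Real.sinh z.2 / den ε z,
      Real.sqrt (1 - ε ^ 2) * Real.sin z.1 / den ε z,
      (Real.cos z.1 + ε * Real.cosh z.2) / den ε z] := by
  funext i
  fin_cases i <;> rfl

theorem sum_sq_sph (z : ℝ × ℝ) : ∑ i, sph ε i z ^ 2 = 1 := by
  have hd := den_pos h0 h1 z
  have hc := sq_sqrt_eps h0 h1
  have hS := Real.cosh_sq z.2
  have hs := Real.sin_sq_add_cos_sq z.1
  simp only [Fin.sum_univ_three, sph, Matrix.cons_val_zero, Matrix.cons_val_one,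
    Matrix.cons_val]
  simp only [div_pow, mul_pow, hc, ← add_div]
  rw [div_eq_one_iff_eq (pow_pos hd 2).ne', den]
  linear_combination (1 - ε ^ 2) * hs - (1 - ε ^ 2) * hS

omit h0 h1 in
theorem hasDerivAt_den_x (x y : ℝ) :
    HasDerivAt (fun t => den ε (t, y)) (-(ε * Real.sin x)) x := by
  have := ((Real.hasDerivAt_cos x).const_mul ε).const_add (Real.cosh y)
  exact this.congr_deriv (by ring)

omit h0 h1 in
theorem hasDerivAt_den_y (x y : ℝ) : HasDerivAt (fun t => den ε (x, t)) (Real.sinh y) y :=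
  (Real.hasDerivAt_cosh y).add_const (ε * Real.cos x)

/-- The `x`-derivatives of the sphere coordinates. -/
theorem pd_x_sph (z : ℝ × ℝ) : (fun i => pd (1, 0) (sph ε i) z) =
    ![Real.sqrt (1 - ε ^ 2) * Real.sinh z.2 * (ε * Real.sin z.1) / den ε z ^ 2,
      Real.sqrt (1 - ε ^ 2) * (Real.cos z.1 * Real.cosh z.2 + ε) / den ε z ^ 2,
      -((1 - ε ^ 2) * Real.sin z.1 * Real.cosh z.2) / den ε z ^ 2] := by
  obtain ⟨x, y⟩ := z
  have hd := (den_pos h0 h1 (x, y)).ne'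
  have hs := Real.sin_sq_add_cos_sq x
  have hdiff := fun i => (contDiff_sph h0 h1 i).differentiable (by simp)
  have hden := hasDerivAt_den_x (ε := ε) x y
  funext i
  refine pd_x_eq (hdiff i) ?_
  fin_cases i
  · refine ((hasDerivAt_const x (Real.sqrt (1 - ε ^ 2) * Real.sinh y)).div hden hd).congr_deriv ?_
    simp
  · refine (((Real.hasDerivAt_sin x).const_mul (Real.sqrt (1 - ε ^ 2))).div hden hd).congr_deriv ?_
    simp only [Fin.mk_one, Matrix.cons_val_one, Matrix.cons_val_zero]
    congr 1
    simp only [den]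
    linear_combination Real.sqrt (1 - ε ^ 2) * ε * hs
  · refine (((Real.hasDerivAt_cos x).add_const (ε * Real.cosh y)).div hden hd).congr_deriv ?_
    simp only [Fin.reduceFinMk, Matrix.cons_val]
    congr 1
    simp only [den]
    ring

/-- The `y`-derivatives of the sphere coordinates. -/
theorem pd_y_sph (z : ℝ × ℝ) : (fun i => pd (0, 1) (sph ε i) z) =
    ![Real.sqrt (1 - ε ^ 2) * (1 + ε * Real.cosh z.2 * Real.cos z.1) / den ε z ^ 2,
      -(Real.sqrt (1 - ε ^ 2) * Real.sin z.1 * Real.sinh z.2) / den ε z ^ 2,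
      -((1 - ε ^ 2) * Real.sinh z.2 * Real.cos z.1) / den ε z ^ 2] := by
  obtain ⟨x, y⟩ := z
  have hd := (den_pos h0 h1 (x, y)).ne'
  have hS := Real.cosh_sq y
  have hdiff := fun i => (contDiff_sph h0 h1 i).differentiable (by simp)
  have hden := hasDerivAt_den_y (ε := ε) x y
  funext i
  refine pd_y_eq (hdiff i) ?_
  fin_cases i
  · refine (((Real.hasDerivAt_sinh y).const_mul
      (Real.sqrt (1 - ε ^ 2))).div hden hd).congr_deriv ?_
    simp only [Fin.zero_eta, Matrix.cons_val_zero]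
    congr 1
    simp only [den]
    linear_combination Real.sqrt (1 - ε ^ 2) * hS
  · refine ((hasDerivAt_const y (Real.sqrt (1 - ε ^ 2) * Real.sin x)).div hden hd).congr_deriv ?_
    simp
  · refine ((((Real.hasDerivAt_cosh y).const_mul ε).const_add
      (Real.cos x)).div hden hd).congr_deriv ?_
    simp only [Fin.reduceFinMk, Matrix.cons_val]
    congr 1
    simp only [den]
    ring

/-- Conformality: `∇Yᵢ · ∇Yⱼ = ρ (δᵢⱼ - Yᵢ Yⱼ)`. -/
theorem grad_sph_mul (i j : Fin 3) (z : ℝ × ℝ) :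
    pd (1, 0) (sph ε i) z * pd (1, 0) (sph ε j) z + pd (0, 1) (sph ε i) z * pd (0, 1) (sph ε j) z =
      rho ε z * ((if i = j then 1 else 0) - sph ε i z * sph ε j z) := by
  have hd := (den_pos h0 h1 z).ne'
  have hc := sq_sqrt_eps h0 h1
  have hS := Real.cosh_sq z.2
  have hs := Real.sin_sq_add_cos_sq z.1
  rw [congrFun (pd_x_sph h0 h1 z) i, congrFun (pd_x_sph h0 h1 z) j,
    congrFun (pd_y_sph h0 h1 z) i, congrFun (pd_y_sph h0 h1 z) j, congrFun (sph_apply ε z) i,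
    congrFun (sph_apply ε z) j]
  have hden : den ε z = Real.cosh z.2 + ε * Real.cos z.1 := rfl
  simp only [rho]
  generalize Real.sqrt (1 - ε ^ 2) = c at *
  generalize Real.cosh z.2 = C at *
  generalize Real.sinh z.2 = S at *
  generalize Real.cos z.1 = k at *
  generalize Real.sin z.1 = s at *
  generalize den ε z = D at *
  fin_cases i <;> fin_cases j <;> simp [← hc] <;> field_simp <;> grind

end Sphere

theorem eq_of_cos_eq_of_sin_eq {x t : ℝ} (hx : x ∈ Ioc 0 (2 * Real.pi))
    (ht : t ∈ Ioc 0 (2 * Real.pi)) (hc : Real.cos x = Real.cos t) (hs : Real.sin x = Real.sin t) :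
    x = t := by
  obtain ⟨k, hk⟩ := Real.Angle.angle_eq_iff_two_pi_dvd_sub.1 (Real.Angle.cos_sin_inj hc hs)
  have hpi := Real.pi_pos
  have h1 : (k : ℝ) < 1 := by nlinarith [hx.2, ht.1]
  have h2 : (-1 : ℝ) < k := by nlinarith [hx.1, ht.2]
  have h3 : k = 0 := by
    have h1' : k < 1 := by exact_mod_cast h1
    have h2' : -1 < k := by exact_mod_cast h2
    omega
  rw [h3] at hk
  simp at hk
  linarith

section Sphere

variable {ε : ℝ} (h0 : 0 ≤ ε) (h1 : ε < 1)
include h0 h1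

/-- The sphere coordinates are eigenfunctions of the Laplacian: `ΔYᵢ = -2 ρ Yᵢ`. -/
theorem lap_sph (i : Fin 3) (z : ℝ × ℝ) :
    pd (1, 0) (pd (1, 0) (sph ε i)) z + pd (0, 1) (pd (0, 1) (sph ε i)) z =
      -2 * rho ε z * sph ε i z := by
  obtain ⟨x, y⟩ := z
  have hd := (den_pos h0 h1 (x, y)).ne'
  have hd2 := (pow_pos (den_pos h0 h1 (x, y)) 2).ne'
  have hc := sq_sqrt_eps h0 h1
  have hS := Real.cosh_sq y
  have hs := Real.sin_sq_add_cos_sq x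
  have hx : pd (1, 0) (pd (1, 0) (sph ε i)) (x, y) = deriv (fun t =>
      ![Real.sqrt (1 - ε ^ 2) * Real.sinh y * (ε * Real.sin t) / den ε (t, y) ^ 2,
      Real.sqrt (1 - ε ^ 2) * (Real.cos t * Real.cosh y + ε) / den ε (t, y) ^ 2,
      -((1 - ε ^ 2) * Real.sin t * Real.cosh y) / den ε (t, y) ^ 2] i) x := by
    have h := hasDerivAt_pd_x (F := pd (1, 0) (sph ε i)) (x := x) (y := y)
      ((contDiff_pd (contDiff_sph h0 h1 i) _).differentiable (by simp) _)
    rw [← h.deriv]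
    congr 1
    funext t
    exact congrFun (pd_x_sph h0 h1 (t, y)) i
  have hy : pd (0, 1) (pd (0, 1) (sph ε i)) (x, y) = deriv (fun t =>
      ![Real.sqrt (1 - ε ^ 2) * (1 + ε * Real.cosh t * Real.cos x) / den ε (x, t) ^ 2,
      -(Real.sqrt (1 - ε ^ 2) * Real.sin x * Real.sinh t) / den ε (x, t) ^ 2,
      -((1 - ε ^ 2) * Real.sinh t * Real.cos x) / den ε (x, t) ^ 2] i) y := by
    have h := hasDerivAt_pd_y (F := pd (0, 1) (sph ε i)) (x := x) (y := y)
      ((contDiff_pd (contDiff_sph h0 h1 i) _).differentiable (by simp) _)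
    rw [← h.deriv]
    congr 1
    funext t
    exact congrFun (pd_y_sph h0 h1 (x, t)) i
  have hdx := (hasDerivAt_den_x (ε := ε) x y).pow 2
  have hdy := (hasDerivAt_den_y (ε := ε) x y).pow 2
  have hden : den ε (x, y) = Real.cosh y + ε * Real.cos x := rfl
  rw [hx, hy, congrFun (sph_apply ε (x, y)) i]
  simp only [rho]
  fin_cases i
  · have e1 := (((Real.hasDerivAt_sin x).const_mul ε).const_mul
      (Real.sqrt (1 - ε ^ 2) * Real.sinh y)).div hdx hd2
    have e2 := ((((((Real.hasDerivAt_cosh y).const_mul ε).mul_const (Real.cos x)).const_add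
      1).const_mul (Real.sqrt (1 - ε ^ 2)))).div hdy hd2
    refine (congrArg₂ _ e1.deriv e2.deriv).trans ?_
    simp
    generalize Real.sqrt (1 - ε ^ 2) = c at *
    generalize Real.cosh y = C at *
    generalize Real.sinh y = S at *
    generalize Real.cos x = k at *
    generalize Real.sin x = s at *
    generalize den ε (x, y) = D at *
    clear e1 e2 hx hy hdx hdy
    field_simp
    grind
  · have e1 := ((((Real.hasDerivAt_cos x).mul_const (Real.cosh y)).add_const ε).const_mul
      (Real.sqrt (1 - ε ^ 2))).div hdx hd2
    have e2 := ((Real.hasDerivAt_sinh y).const_mul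
      (Real.sqrt (1 - ε ^ 2) * Real.sin x)).neg.div hdy hd2
    refine (congrArg₂ _ e1.deriv e2.deriv).trans ?_
    simp
    generalize Real.sqrt (1 - ε ^ 2) = c at *
    generalize Real.cosh y = C at *
    generalize Real.sinh y = S at *
    generalize Real.cos x = k at *
    generalize Real.sin x = s at *
    generalize den ε (x, y) = D at *
    clear e1 e2 hx hy hdx hdy
    field_simp
    grind
  · have e1 := (((Real.hasDerivAt_sin x).const_mul (1 - ε ^ 2)).mul_const
      (Real.cosh y)).neg.div hdx hd2
    have e2 := (((Real.hasDerivAt_sinh y).const_mul (1 - ε ^ 2)).mul_const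
      (Real.cos x)).neg.div hdy hd2
    refine (congrArg₂ _ e1.deriv e2.deriv).trans ?_
    simp
    generalize Real.cosh y = C at *
    generalize Real.sinh y = S at *
    generalize Real.cos x = k at *
    generalize Real.sin x = s at *
    generalize den ε (x, y) = D at *
    clear e1 e2 hx hy hdx hdy
    field_simp
    grind

/-- The transport operator `u_ε · ∇`, where `u_ε` is the steady velocity. -/
def transport {𝕜 : Type*} [RCLike 𝕜] (ε : ℝ) (F : ℝ × ℝ → 𝕜) (z : ℝ × ℝ) : 𝕜 :=
  vel1 ε z • pd (1, 0) F z + vel2 ε z • pd (0, 1) F z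

/-- The steady velocity acts on the sphere coordinates by quadratic polynomials. -/
theorem transport_sph (z : ℝ × ℝ) : (fun i => transport ε (sph ε i) z) =
    ![ε / (1 - ε ^ 2) * (sph ε 1 z - ε * (sph ε 1 z * sph ε 2 z)),
      1 / (1 - ε ^ 2) * (sph ε 0 z * sph ε 2 z - ε * sph ε 0 z),
      -(sph ε 0 z * sph ε 1 z)] := by
  have hd := (den_pos h0 h1 z).ne'
  have hc := sq_sqrt_eps h0 h1
  have hc0 := (one_sub_sq_pos h0 h1).ne'
  have hS := Real.cosh_sq z.2
  have hs := Real.sin_sq_add_cos_sq z.1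
  have hden : den ε z = Real.cosh z.2 + ε * Real.cos z.1 := rfl
  funext i
  rw [congrFun (sph_apply ε z) 0, congrFun (sph_apply ε z) 1, congrFun (sph_apply ε z) 2,
    transport, congrFun (pd_x_sph h0 h1 z) i, congrFun (pd_y_sph h0 h1 z) i, vel1, vel2, ← hden]
  generalize Real.sqrt (1 - ε ^ 2) = c at *
  generalize Real.cosh z.2 = C at *
  generalize Real.sinh z.2 = S at *
  generalize Real.cos z.1 = k at *
  generalize Real.sin z.1 = s at *
  generalize den ε z = D at *
  fin_cases i <;> simp <;> field_simp <;> grind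

/-- `g'(ψ_ε) u_ε` is divergence free. -/
theorem div_gp_vel (z : ℝ × ℝ) :
    pd (1, 0) (fun w => gp ε w * vel1 ε w) z + pd (0, 1) (fun w => gp ε w * vel2 ε w) z = 0 := by
  obtain ⟨x, y⟩ := z
  have hd := (den_pos h0 h1 (x, y)).ne'
  have hd3 := (pow_pos (den_pos h0 h1 (x, y)) 3).ne'
  have e1 : (fun w => gp ε w * vel1 ε w) =
      fun w => 2 * (1 - ε ^ 2) * Real.sinh w.2 / den ε w ^ 3 := by
    funext w
    have := (den_pos h0 h1 w).ne'
    rw [gp_eq h0 h1, rho, vel1, show Real.cosh w.2 + ε * Real.cos w.1 = den ε w from rfl]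
    field_simp
  have e2 : (fun w => gp ε w * vel2 ε w) =
      fun w => 2 * (1 - ε ^ 2) * (ε * Real.sin w.1) / den ε w ^ 3 := by
    funext w
    have := (den_pos h0 h1 w).ne'
    rw [gp_eq h0 h1, rho, vel2, show Real.cosh w.2 + ε * Real.cos w.1 = den ε w from rfl]
    field_simp
  have hden3 : ∀ w, den ε w ^ 3 ≠ 0 := fun w => (pow_pos (den_pos h0 h1 w) 3).ne'
  have d1 : Differentiable ℝ fun w : ℝ × ℝ => 2 * (1 - ε ^ 2) * Real.sinh w.2 / den ε w ^ 3 :=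
    ((contDiff_const.mul (Real.contDiff_sinh.comp contDiff_snd)).div
      (contDiff_den.pow 3) hden3 : ContDiff ℝ (⊤ : ℕ∞) _).differentiable (by simp)
  have d2 : Differentiable ℝ fun w : ℝ × ℝ => 2 * (1 - ε ^ 2) * (ε * Real.sin w.1) / den ε w ^ 3 :=
    ((contDiff_const.mul (contDiff_const.mul (Real.contDiff_sin.comp contDiff_fst))).div
      (contDiff_den.pow 3) hden3 : ContDiff ℝ (⊤ : ℕ∞) _).differentiable (by simp)
  rw [e1, e2]
  rw [pd_x_eq d1 ((hasDerivAt_const x (2 * (1 - ε ^ 2) * Real.sinh y)).div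
      ((hasDerivAt_den_x x y).pow 3) hd3),
    pd_y_eq d2 ((hasDerivAt_const y (2 * (1 - ε ^ 2) * (ε * Real.sin x))).div
      ((hasDerivAt_den_y x y).pow 3) hd3)]
  field_simp
  ring

/-- The sphere coordinates separate the points of the cylinder. -/
theorem sph_injOn {z w : ℝ × ℝ} (hz : z.1 ∈ Ioc 0 (2 * Real.pi)) (hw : w.1 ∈ Ioc 0 (2 * Real.pi))
    (h : ∀ i, sph ε i z = sph ε i w) : z = w := by
  have hd := (den_pos h0 h1 z).ne'
  have hd' := (den_pos h0 h1 w).ne'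
  have hc := (sqrt_pos' h0 h1).ne'
  have hc0 := (one_sub_sq_pos h0 h1).ne'
  have H0 := h 0
  have H1 := h 1
  have H2 := h 2
  rw [congrFun (sph_apply ε z) 0, congrFun (sph_apply ε w) 0] at H0
  rw [congrFun (sph_apply ε z) 1, congrFun (sph_apply ε w) 1] at H1
  rw [congrFun (sph_apply ε z) 2, congrFun (sph_apply ε w) 2] at H2
  simp only [Matrix.cons_val_zero, Matrix.cons_val_one, Matrix.cons_val] at H0 H1 H2
  rw [div_eq_div_iff hd hd'] at H0 H1 H2
  have hden : den ε z = Real.cosh z.2 + ε * Real.cos z.1 := rfl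
  have hden' : den ε w = Real.cosh w.2 + ε * Real.cos w.1 := rfl
  have K0 : Real.sinh z.2 * den ε w = Real.sinh w.2 * den ε z := by
    refine mul_left_cancel₀ hc ?_
    linear_combination H0
  have K1 : Real.sin z.1 * den ε w = Real.sin w.1 * den ε z := by
    refine mul_left_cancel₀ hc ?_
    linear_combination H1
  have K2 : Real.cosh z.2 * den ε w = Real.cosh w.2 * den ε z := by
    refine mul_left_cancel₀ hc0 ?_
    linear_combination -ε * H2 - den ε w * hden + den ε z * hden'
  have K3 : Real.cos z.1 * den ε w = Real.cos w.1 * den ε z := by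
    refine mul_left_cancel₀ hc0 ?_
    linear_combination H2 + ε * den ε w * hden - ε * den ε z * hden'
  have hy : z.2 = w.2 := by
    have h3 : Real.sinh (z.2 - w.2) = 0 := by
      rw [Real.sinh_sub]
      refine mul_right_cancel₀ hd (mul_right_cancel₀ hd' ?_)
      linear_combination K0 * (Real.cosh w.2 * den ε z) - K2 * (Real.sinh w.2 * den ε z)
    linarith [Real.sinh_eq_zero.1 h3]
  have hD : den ε w = den ε z := by
    rw [hy] at K2
    exact mul_left_cancel₀ (Real.cosh_pos w.2).ne' K2
  rw [hD] at K1 K3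
  exact Prod.ext (eq_of_cos_eq_of_sin_eq hz hw (mul_right_cancel₀ hd K3)
    (mul_right_cancel₀ hd K1)) hy

theorem abs_sph_le (i : Fin 3) (z : ℝ × ℝ) : |sph ε i z| ≤ 1 := by
  rw [← sq_le_one_iff_abs_le_one, ← sum_sq_sph h0 h1 z]
  exact Finset.single_le_sum (f := fun i => sph ε i z ^ 2) (fun i _ => sq_nonneg _)
    (Finset.mem_univ i)

end Sphere

/-! ### Polynomials on the sphere -/

section Laplacian

variable {E : Type*} [NormedAddCommGroup E] [NormedSpace ℝ E]

/-- The Laplacian. -/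
def lap (F : ℝ × ℝ → E) (z : ℝ × ℝ) : E := pd (1, 0) (pd (1, 0) F) z + pd (0, 1) (pd (0, 1) F) z

theorem pd_pd_smul {f : ℝ × ℝ → ℝ} {F : ℝ × ℝ → E} (hf : ContDiff ℝ (⊤ : ℕ∞) f)
    (hF : ContDiff ℝ (⊤ : ℕ∞) F) (v z : ℝ × ℝ) :
    pd v (pd v fun w => f w • F w) z =
      f z • pd v (pd v F) z + (2 : ℝ) • pd v f z • pd v F z + pd v (pd v f) z • F z := by
  have df := hf.differentiable (by simp)
  have dF := hF.differentiable (by simp)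
  have df' := (contDiff_pd hf v).differentiable (by simp)
  have dF' := (contDiff_pd hF v).differentiable (by simp)
  have h1 : (pd v fun w => f w • F w) = fun w => f w • pd v F w + pd v f w • F w := by
    funext w; exact pd_smul v (df w) (dF w)
  have k1 : DifferentiableAt ℝ (fun w => f w • pd v F w) z := (df z).smul (dF' z)
  have k2 : DifferentiableAt ℝ (fun w => pd v f w • F w) z := (df' z).smul (dF z)
  rw [h1, pd_add v k1 k2, pd_smul v (df z) (dF' z),
    pd_smul v (df' z) (dF z), two_smul]
  abel

theorem lap_smul {f : ℝ × ℝ → ℝ} {F : ℝ × ℝ → E} (hf : ContDiff ℝ (⊤ : ℕ∞) f)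
    (hF : ContDiff ℝ (⊤ : ℕ∞) F) (z : ℝ × ℝ) :
    lap (fun w => f w • F w) z = f z • lap F z +
      (2 : ℝ) • (pd (1, 0) f z • pd (1, 0) F z + pd (0, 1) f z • pd (0, 1) F z) +
      lap f z • F z := by
  rw [lap, pd_pd_smul hf hF, pd_pd_smul hf hF, lap, lap, add_smul, smul_add, smul_add]
  abel

end Laplacian

variable (𝕜 : Type*) [RCLike 𝕜]

/-- Multiplication by a coordinate of the sphere. -/
def mulSph (ε : ℝ) (i : Fin 3) : (ℝ × ℝ → 𝕜) →ₗ[𝕜] (ℝ × ℝ → 𝕜) where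
  toFun F z := sph ε i z • F z
  map_add' F G := by funext z; simp
  map_smul' a F := by funext z; simp

/-- The polynomials of degree less than `n` in the coordinates of the sphere, as functions on the
cylinder. -/
def Pol (ε : ℝ) : ℕ → Submodule 𝕜 (ℝ × ℝ → 𝕜)
  | 0 => ⊥
  | n + 1 => Submodule.span 𝕜 {fun _ => 1} ⊔ (Pol ε n).map (mulSph 𝕜 ε 0) ⊔
      (Pol ε n).map (mulSph 𝕜 ε 1) ⊔ (Pol ε n).map (mulSph 𝕜 ε 2)

variable {𝕜} {ε : ℝ}

theorem mem_Pol_succ {n : ℕ} {F : ℝ × ℝ → 𝕜} : F ∈ Pol 𝕜 ε (n + 1) ↔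
    ∃ (a : 𝕜) (f : Fin 3 → ℝ × ℝ → 𝕜), (∀ i, f i ∈ Pol 𝕜 ε n) ∧
      F = fun z => a + ∑ i, sph ε i z • f i z := by
  simp only [Pol, Submodule.mem_sup, Submodule.mem_span_singleton, Submodule.mem_map]
  constructor
  · rintro ⟨_, ⟨_, ⟨_, ⟨a, rfl⟩, _, ⟨f0, hf0, rfl⟩, rfl⟩, _, ⟨f1, hf1, rfl⟩, rfl⟩, _,
      ⟨f2, hf2, rfl⟩, rfl⟩
    refine ⟨a, ![f0, f1, f2], fun i => by fin_cases i <;> assumption, ?_⟩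
    funext z
    simp [mulSph, Fin.sum_univ_three, add_assoc]
  · rintro ⟨a, f, hf, rfl⟩
    refine ⟨_, ⟨_, ⟨_, ⟨a, rfl⟩, _, ⟨f 0, hf 0, rfl⟩, rfl⟩, _, ⟨f 1, hf 1, rfl⟩, rfl⟩, _,
      ⟨f 2, hf 2, rfl⟩, ?_⟩
    funext z
    simp [mulSph, Fin.sum_univ_three, add_assoc]

theorem finiteDimensional_Pol (n : ℕ) : FiniteDimensional 𝕜 (Pol 𝕜 ε n) := by
  induction n with
  | zero => rw [Pol]; infer_instance
  | succ n ih => rw [Pol]; infer_instance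

theorem const_mem_Pol (a : 𝕜) (n : ℕ) : (fun _ => a) ∈ Pol 𝕜 ε (n + 1) :=
  mem_Pol_succ.2 ⟨a, fun _ => 0, fun _ => Submodule.zero_mem _, by simp⟩

theorem sph_smul_mem_Pol {n : ℕ} {F : ℝ × ℝ → 𝕜} (hF : F ∈ Pol 𝕜 ε n) (i : Fin 3) :
    (fun z => sph ε i z • F z) ∈ Pol 𝕜 ε (n + 1) := by
  refine mem_Pol_succ.2 ⟨0, fun j => if j = i then F else 0, fun j => ?_, ?_⟩
  · by_cases h : j = i
    · simpa [h] using hF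
    · simp [h]
  · funext z
    rw [Finset.sum_eq_single i (by intro j _ hj; simp [hj]) (by simp)]
    simp

theorem add_mem_Pol {n : ℕ} {F G : ℝ × ℝ → 𝕜} (hF : F ∈ Pol 𝕜 ε n) (hG : G ∈ Pol 𝕜 ε n) :
    (fun z => F z + G z) ∈ Pol 𝕜 ε n := Submodule.add_mem _ hF hG

theorem sum_mem_Pol {n : ℕ} {F : Fin 3 → ℝ × ℝ → 𝕜} (hF : ∀ i, F i ∈ Pol 𝕜 ε n) :
    (fun z => ∑ i, F i z) ∈ Pol 𝕜 ε n := by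
  have := Submodule.sum_mem (Pol 𝕜 ε n) (t := Finset.univ) fun i _ => hF i
  convert this using 1
  funext z
  simp

theorem smul_mem_Pol {n : ℕ} {F : ℝ × ℝ → 𝕜} (r : ℝ) (hF : F ∈ Pol 𝕜 ε n) :
    (fun z => r • F z) ∈ Pol 𝕜 ε n := by
  have := Submodule.smul_mem (Pol 𝕜 ε n) (r : 𝕜) hF
  convert this using 1
  funext z
  simp [RCLike.real_smul_eq_coe_mul]

theorem Pol_le_succ (n : ℕ) : Pol 𝕜 ε n ≤ Pol 𝕜 ε (n + 1) := by
  induction n with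
  | zero => exact bot_le
  | succ n ih =>
    intro F hF
    obtain ⟨a, f, hf, rfl⟩ := mem_Pol_succ.1 hF
    exact mem_Pol_succ.2 ⟨a, f, fun i => ih (hf i), rfl⟩

theorem Pol_mono : Monotone (Pol 𝕜 ε) := monotone_nat_of_le_succ Pol_le_succ

theorem star_mem_Pol (n : ℕ) : ∀ F ∈ Pol 𝕜 ε n, (fun z => (starRingEnd 𝕜) (F z)) ∈ Pol 𝕜 ε n := by
  induction n with
  | zero =>
    intro F hF
    rw [Pol, Submodule.mem_bot] at hF
    rw [hF]
    simp only [Pi.zero_apply, map_zero]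
    exact Submodule.zero_mem _
  | succ n ih =>
    intro F hF
    obtain ⟨a, f, hf, rfl⟩ := mem_Pol_succ.1 hF
    refine mem_Pol_succ.2 ⟨(starRingEnd 𝕜) a, fun i z => (starRingEnd 𝕜) (f i z),
      fun i => ih _ (hf i), ?_⟩
    funext z
    simp [RCLike.real_smul_eq_coe_mul]

/-- Smooth functions on the cylinder, with values in a normed space, as functions on the plane which
are `2π`-periodic in `x`. -/
structure SmoothPer {E : Type*} [NormedAddCommGroup E] [NormedSpace ℝ E] (F : ℝ × ℝ → E) :
    Prop where
  smooth : ContDiff ℝ (⊤ : ℕ∞) F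
  periodic : ∀ x y, F (x + 2 * Real.pi, y) = F (x, y)

theorem sph_periodic (i : Fin 3) (x y : ℝ) : sph ε i (x + 2 * Real.pi, y) = sph ε i (x, y) := by
  rw [congrFun (sph_apply ε (x + 2 * Real.pi, y)) i, congrFun (sph_apply ε (x, y)) i]
  simp [den]

section Estimates

variable (h0 : 0 ≤ ε) (h1 : ε < 1)
include h0 h1

theorem abs_pd_sph_le (i : Fin 3) (z : ℝ × ℝ) :
    |pd (1, 0) (sph ε i) z| ≤ 1 / den ε z ∧ |pd (0, 1) (sph ε i) z| ≤ 1 / den ε z := by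
  have hd := den_pos h0 h1 z
  have h := grad_sph_mul h0 h1 i i z
  have hr := rho_pos h0 h1 z
  have hr1 : rho ε z ≤ (1 / den ε z) ^ 2 := by
    rw [rho, one_div, inv_pow, div_eq_mul_inv]
    have : 0 ≤ (den ε z ^ 2)⁻¹ := by positivity
    nlinarith [sq_nonneg ε]
  simp only [if_true] at h
  have hsq : 0 ≤ rho ε z * (sph ε i z * sph ε i z) := mul_nonneg hr.le (mul_self_nonneg _)
  constructor
  · refine abs_le_of_sq_le_sq ?_ (by positivity)
    nlinarith [mul_self_nonneg (pd (0, 1) (sph ε i) z)]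
  · refine abs_le_of_sq_le_sq ?_ (by positivity)
    nlinarith [mul_self_nonneg (pd (1, 0) (sph ε i) z)]

theorem smoothPer_Pol (n : ℕ) : ∀ F ∈ Pol 𝕜 ε n, SmoothPer F := by
  induction n with
  | zero =>
    intro F hF
    rw [Pol, Submodule.mem_bot] at hF
    rw [hF]
    exact ⟨contDiff_const, fun _ _ => rfl⟩
  | succ n ih =>
    intro F hF
    obtain ⟨a, f, hf, rfl⟩ := mem_Pol_succ.1 hF
    refine ⟨contDiff_const.add (ContDiff.sum fun i _ =>
      (contDiff_sph h0 h1 i).smul (ih _ (hf i)).smooth), fun x y => ?_⟩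
    simp only [sph_periodic, (ih _ (hf _)).periodic]

theorem pd_Pol_succ {n : ℕ} (a : 𝕜) {f : Fin 3 → ℝ × ℝ → 𝕜} (hf : ∀ i, f i ∈ Pol 𝕜 ε n)
    (v z : ℝ × ℝ) : pd v (fun z => a + ∑ i, sph ε i z • f i z) z =
      ∑ i, (sph ε i z • pd v (f i) z + pd v (sph ε i) z • f i z) := by
  have ds := fun i => (contDiff_sph h0 h1 i).differentiable (by simp) z
  have df := fun i => (smoothPer_Pol h0 h1 n _ (hf i)).smooth.differentiable (by simp) z
  have k : ∀ i, DifferentiableAt ℝ (fun w => sph ε i w • f i w) z := fun i => (ds i).smul (df i)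
  rw [pd_add v (differentiableAt_const _) (DifferentiableAt.fun_sum fun i _ => k i), pd_const,
    zero_add, pd_sum v fun i _ => k i]
  exact Finset.sum_congr rfl fun i _ => pd_smul v (ds i) (df i)

/-- Polynomials are bounded, with gradient `O(e^{-|y|})`. -/
theorem bound_Pol (n : ℕ) : ∀ F ∈ Pol 𝕜 ε n, ∃ C, 0 ≤ C ∧ ∀ z, ‖F z‖ ≤ C ∧
    ‖pd (1, 0) F z‖ ≤ C / den ε z ∧ ‖pd (0, 1) F z‖ ≤ C / den ε z := by
  induction n with
  | zero =>
    intro F hF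
    rw [Pol, Submodule.mem_bot] at hF
    subst hF
    refine ⟨0, le_rfl, fun z => ⟨by simp, ?_, ?_⟩⟩ <;>
    · have := pd_const (E := 𝕜) (1, 0) 0 z
      simp [pd]
  | succ n ih =>
    intro F hF
    obtain ⟨a, f, hf, rfl⟩ := mem_Pol_succ.1 hF
    choose C hC0 hC using fun i => ih _ (hf i)
    have key : ∀ v z, (∀ i, ‖pd v (f i) z‖ ≤ C i / den ε z) →
        (∀ i, |pd v (sph ε i) z| ≤ 1 / den ε z) →
        ‖pd v (fun z => a + ∑ i, sph ε i z • f i z) z‖ ≤ (‖a‖ + ∑ i, 2 * C i) / den ε z := by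
      intro v z k1 k2
      have hd := den_pos h0 h1 z
      rw [pd_Pol_succ h0 h1 a hf]
      refine (norm_sum_le _ _).trans ?_
      rw [add_div, Finset.sum_div]
      refine (Finset.sum_le_sum fun i _ => ?_).trans (le_add_of_nonneg_left (by positivity))
      refine (norm_add_le _ _).trans ?_
      rw [norm_smul, norm_smul, two_mul, add_div]
      refine add_le_add ?_ ?_
      · exact (mul_le_of_le_one_left (norm_nonneg _) (abs_sph_le h0 h1 i z)).trans (k1 i)
      · calc _ ≤ 1 / den ε z * C i := by
              gcongr
              exacts [k2 i, (hC i z).1]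
          _ = _ := by ring
    refine ⟨‖a‖ + ∑ i, 2 * C i, ?_, fun z => ⟨?_, ?_, ?_⟩⟩
    · have := Finset.sum_nonneg fun i (_ : i ∈ Finset.univ) => mul_nonneg zero_le_two (hC0 i)
      positivity
    · refine (norm_add_le _ _).trans (add_le_add le_rfl ((norm_sum_le _ _).trans
        (Finset.sum_le_sum fun i _ => ?_)))
      rw [norm_smul]
      refine (mul_le_of_le_one_left (norm_nonneg _) (abs_sph_le h0 h1 i z)).trans ?_
      linarith [(hC i z).1, hC0 i]
    · exact key _ z (fun i => (hC i z).2.1) fun i => (abs_pd_sph_le h0 h1 i z).1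
    · exact key _ z (fun i => (hC i z).2.2) fun i => (abs_pd_sph_le h0 h1 i z).2

/-- The gradient on the sphere of a coordinate against that of a polynomial `F` of degree at most `n`
is, up to polynomials of the same degree, `-n` times their product: this is `grad_sph_mul` for the
leading part, which is homogeneous of degree `n`. -/
theorem grad_Pol (n : ℕ) : ∀ F ∈ Pol 𝕜 ε (n + 1), ∀ i, ∃ G ∈ Pol 𝕜 ε (n + 1), ∀ z,
    pd (1, 0) (sph ε i) z • pd (1, 0) F z + pd (0, 1) (sph ε i) z • pd (0, 1) F z =
      rho ε z • (G z - (n : ℝ) • sph ε i z • F z) := by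
  induction n with
  | zero =>
    intro F hF i
    obtain ⟨a, f, hf, rfl⟩ := mem_Pol_succ.1 hF
    refine ⟨0, Submodule.zero_mem _, fun z => ?_⟩
    have : ∀ i, f i = 0 := fun i => by simpa [Pol] using hf i
    simp [this, pd_const]
  | succ n ih =>
    intro F hF i
    obtain ⟨a, f, hf, rfl⟩ := mem_Pol_succ.1 hF
    choose G hG hGe using fun j => ih _ (hf j) i
    refine ⟨fun z => ((n + 1 : ℝ) • sph ε i z • a + f i z) + ∑ j, sph ε j z • G j z, ?_,
      fun z => ?_⟩
    · refine add_mem_Pol (add_mem_Pol (smul_mem_Pol _ ?_) (Pol_le_succ _ (hf i)))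
        (sum_mem_Pol fun j => sph_smul_mem_Pol (hG j) j)
      exact Pol_mono (by omega) (sph_smul_mem_Pol (const_mem_Pol a 0) i)
    · rw [pd_Pol_succ h0 h1 a hf, pd_Pol_succ h0 h1 a hf]
      have e1 : pd (1, 0) (sph ε i) z • ∑ j, (sph ε j z • pd (1, 0) (f j) z +
          pd (1, 0) (sph ε j) z • f j z) + pd (0, 1) (sph ε i) z • ∑ j,
          (sph ε j z • pd (0, 1) (f j) z + pd (0, 1) (sph ε j) z • f j z) =
        ∑ j, (sph ε j z • (rho ε z • (G j z - (n : ℝ) • sph ε i z • f j z)) +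
          (rho ε z * ((if i = j then 1 else 0) - sph ε i z * sph ε j z)) • f j z) := by
        rw [Finset.smul_sum, Finset.smul_sum, ← Finset.sum_add_distrib]
        refine Finset.sum_congr rfl fun j _ => ?_
        rw [← hGe j z, ← grad_sph_mul h0 h1 i j z]
        module
      rw [e1]
      simp only [Fin.sum_univ_three]
      push_cast
      fin_cases i <;> simp <;> module

/-- The Laplacian of the sphere is triangular for the filtration by degree, with diagonal entries
`-n (n + 1)`. -/
theorem lap_Pol (n : ℕ) : ∀ F ∈ Pol 𝕜 ε (n + 1), ∃ G ∈ Pol 𝕜 ε n, ∀ z,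
    lap F z = rho ε z • (G z - (n * (n + 1) : ℝ) • F z) := by
  induction n with
  | zero =>
    intro F hF
    obtain ⟨a, f, hf, rfl⟩ := mem_Pol_succ.1 hF
    refine ⟨0, Submodule.zero_mem _, fun z => ?_⟩
    have : ∀ i, f i = 0 := fun i => by simpa [Pol] using hf i
    have h2 : ∀ v, pd v (fun _ : ℝ × ℝ => a) = fun _ => 0 := fun v => funext fun w => pd_const v a w
    simp [this, lap, h2, pd_const]
  | succ n ih =>
    intro F hF
    obtain ⟨a, f, hf, rfl⟩ := mem_Pol_succ.1 hF
    choose G hG hGe using fun j => ih _ (hf j)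
    choose K hK hKe using fun j => grad_Pol h0 h1 n _ (hf j) j
    have ds := fun i => (contDiff_sph h0 h1 i)
    have df := fun i => (smoothPer_Pol h0 h1 _ _ (hf i)).smooth
    refine ⟨fun z => ((n + 1) * (n + 2) : ℝ) • a +
      (∑ j, sph ε j z • G j z + (2 : ℝ) • ∑ j, K j z), ?_, fun z => ?_⟩
    · exact add_mem_Pol (smul_mem_Pol _ (const_mem_Pol a n))
        (add_mem_Pol (sum_mem_Pol fun j => sph_smul_mem_Pol (hG j) j)
          (smul_mem_Pol _ (sum_mem_Pol hK)))
    · have e0 : lap (fun z => a + ∑ i, sph ε i z • f i z) z =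
          ∑ i, lap (fun w => sph ε i w • f i w) z := by
        have e1 : ∀ v, pd v (fun z => a + ∑ i, sph ε i z • f i z) =
            fun w => ∑ i, pd v (fun w => sph ε i w • f i w) w := fun v => by
          funext w
          have k : ∀ i, DifferentiableAt ℝ (fun w => sph ε i w • f i w) w := fun i =>
            ((ds i).smul (df i)).differentiable (by simp) w
          rw [pd_add v (differentiableAt_const _) (DifferentiableAt.fun_sum fun i _ => k i),
            pd_const, zero_add, pd_sum v fun i _ => k i]
        have e2 : ∀ v i, DifferentiableAt ℝ (pd v fun w => sph ε i w • f i w) z := fun v i =>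
          (contDiff_pd ((ds i).smul (df i)) v).differentiable (by simp) z
        simp only [lap, e1]
        rw [pd_sum _ fun i _ => e2 _ i, pd_sum _ fun i _ => e2 _ i, ← Finset.sum_add_distrib]
      have e3 : ∀ i, lap (fun w => sph ε i w • f i w) z =
          sph ε i z • (rho ε z • (G i z - (n * (n + 1) : ℝ) • f i z)) +
          (2 : ℝ) • (rho ε z • (K i z - (n : ℝ) • sph ε i z • f i z)) +
          (-2 * rho ε z * sph ε i z) • f i z := fun i => by
        rw [lap_smul (ds i) (df i), hGe, hKe, ← lap_sph h0 h1 i z]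
        rfl
      rw [e0]
      simp only [e3, Fin.sum_univ_three]
      push_cast
      module

theorem transport_mem_Pol (n : ℕ) : ∀ F ∈ Pol 𝕜 ε n, transport ε F ∈ Pol 𝕜 ε (n + 1) := by
  induction n with
  | zero =>
    intro F hF
    rw [Pol, Submodule.mem_bot] at hF
    have : transport ε F = 0 := by
      funext z
      have := fun v => pd_const (E := 𝕜) v 0 z
      simp [hF, transport, pd]
    rw [this]
    exact Submodule.zero_mem _
  | succ n ih =>
    intro F hF
    obtain ⟨a, f, hf, rfl⟩ := mem_Pol_succ.1 hF
    have e1 : transport ε (fun z => a + ∑ i, sph ε i z • f i z) = fun z =>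
        ∑ i, (sph ε i z • transport ε (f i) z + transport ε (sph ε i) z • f i z) := by
      funext z
      rw [transport, pd_Pol_succ h0 h1 a hf, pd_Pol_succ h0 h1 a hf, Finset.smul_sum,
        Finset.smul_sum, ← Finset.sum_add_distrib]
      refine Finset.sum_congr rfl fun i _ => ?_
      simp only [transport, smul_eq_mul]
      module
    rw [e1]
    refine sum_mem_Pol fun i => add_mem_Pol (sph_smul_mem_Pol (ih _ (hf i)) i) ?_
    have e2 := fun z => congrFun (transport_sph h0 h1 z) i
    simp only [e2]
    have m1 : ∀ j i, (fun z => sph ε j z • f i z) ∈ Pol 𝕜 ε (n + 1 + 1) := fun j i =>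
      Pol_le_succ _ (sph_smul_mem_Pol (hf i) j)
    have m2 : ∀ j k i, (fun z => sph ε j z • sph ε k z • f i z) ∈ Pol 𝕜 ε (n + 1 + 1) :=
      fun j k i => sph_smul_mem_Pol (sph_smul_mem_Pol (hf i) k) j
    fin_cases i
    · convert smul_mem_Pol (ε / (1 - ε ^ 2)) (add_mem_Pol (m1 1 0) (smul_mem_Pol (-ε) (m2 1 2 0)))
        using 2 with z
      simp
      module
    · convert smul_mem_Pol (1 / (1 - ε ^ 2)) (add_mem_Pol (m2 0 2 1) (smul_mem_Pol (-ε) (m1 0 1)))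
        using 2 with z
      simp
      module
    · convert smul_mem_Pol (-1) (m2 0 1 2) using 2 with z
      simp
      module

end Estimates

/-! ### Integration on the cylinder -/

theorem cyl_eq_prod :
    cyl = (volume.restrict (Ioc 0 (2 * Real.pi))).prod (volume : Measure ℝ) := by
  rw [cyl, Measure.volume_eq_prod, ← Measure.prod_restrict, Measure.restrict_univ]

theorem measurableSet_strip : MeasurableSet (Ioc 0 (2 * Real.pi) ×ˢ (univ : Set ℝ)) :=
  measurableSet_Ioc.prod MeasurableSet.univ

section Compact

variable {E : Type*} [NormedAddCommGroup E] [NormedSpace ℝ E]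

theorem isFiniteMeasure_cyl_restrict (R : ℝ) :
    IsFiniteMeasure (cyl.restrict (univ ×ˢ Icc (-R) R)) := by
  rw [cyl_eq_prod, ← Measure.prod_restrict, Measure.restrict_univ]
  infer_instance

omit [NormedSpace ℝ E] in
theorem integrable_of_compact {F : ℝ × ℝ → E} (hF : Continuous F)
    (hR : ∃ R : ℝ, ∀ x y, R < |y| → F (x, y) = 0) : Integrable F cyl := by
  obtain ⟨R, hR⟩ := hR
  have h1 : IntegrableOn F (Icc 0 (2 * Real.pi) ×ˢ Icc (-R) R) volume :=
    hF.continuousOn.integrableOn_compact (isCompact_Icc.prod isCompact_Icc)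
  rw [cyl]
  change IntegrableOn F _ volume
  refine h1.of_forall_sdiff_eq_zero measurableSet_strip ?_
  rintro ⟨x, y⟩ ⟨hz, hz'⟩
  refine hR x y ?_
  by_contra hy
  exact hz' ⟨Ioc_subset_Icc_self hz.1, abs_le.1 (not_lt.1 hy)⟩

/-- Smooth compactly supported functions on the cylinder, with values in a normed space. -/
structure CompactTest (φ : ℝ × ℝ → E) : Prop extends SmoothPer φ where
  compact : ∃ R : ℝ, ∀ x y, R < |y| → φ (x, y) = 0

theorem IsTest.compactTest {φ : ℝ × ℝ → ℝ} (h : IsTest φ) : CompactTest φ :=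
  ⟨⟨h.smooth, h.periodic⟩, h.compact⟩

theorem CompactTest.isTest {φ : ℝ × ℝ → ℝ} (h : CompactTest φ) : IsTest φ :=
  ⟨h.smooth, h.periodic, h.compact⟩

theorem SmoothPer.differentiable {F : ℝ × ℝ → E} (h : SmoothPer F) : Differentiable ℝ F :=
  h.smooth.differentiable (by simp)

theorem SmoothPer.pd {F : ℝ × ℝ → E} (h : SmoothPer F) (v : ℝ × ℝ) : SmoothPer (pd v F) := by
  refine ⟨contDiff_pd h.smooth v, fun x y => ?_⟩
  have h1 : (fun z : ℝ × ℝ => F (z + (2 * Real.pi, 0))) = F := by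
    funext z
    have := h.periodic z.1 z.2
    simpa [Prod.add_def] using this
  have h2 := fderiv_comp_add_right (𝕜 := ℝ) (f := F) (x := (x, y)) (2 * Real.pi, 0)
  rw [h1] at h2
  simp only [KelvinStuart.pd, h2]
  simp

theorem SmoothPer.smul {f : ℝ × ℝ → ℝ} {F : ℝ × ℝ → E} (hf : SmoothPer f) (hF : SmoothPer F) :
    SmoothPer fun z => f z • F z :=
  ⟨hf.smooth.smul hF.smooth, fun x y => by rw [hf.periodic, hF.periodic]⟩

theorem CompactTest.pd {φ : ℝ × ℝ → E} (h : CompactTest φ) (v : ℝ × ℝ) :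
    CompactTest (pd v φ) := by
  obtain ⟨R, hR⟩ := h.compact
  refine ⟨h.toSmoothPer.pd v, R, fun x y hy => ?_⟩
  have h1 : φ =ᶠ[𝓝 (x, y)] fun _ => 0 := by
    have : {z : ℝ × ℝ | R < |z.2|} ∈ 𝓝 (x, y) :=
      (isOpen_lt continuous_const (continuous_snd.abs)).mem_nhds hy
    filter_upwards [this] with z hz
    exact hR z.1 z.2 hz
  simp [KelvinStuart.pd, h1.fderiv_eq]

theorem CompactTest.smul {f : ℝ × ℝ → ℝ} {F : ℝ × ℝ → E} (hf : SmoothPer f)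
    (hF : CompactTest F) : CompactTest fun z => f z • F z := by
  obtain ⟨R, hR⟩ := hF.compact
  exact ⟨hf.smul hF.toSmoothPer, R, fun x y hy => by rw [hR x y hy, smul_zero]⟩

theorem CompactTest.smul' {f : ℝ × ℝ → ℝ} {F : ℝ × ℝ → E} (hf : CompactTest f)
    (hF : SmoothPer F) : CompactTest fun z => f z • F z := by
  obtain ⟨R, hR⟩ := hf.compact
  exact ⟨hf.toSmoothPer.smul hF, R, fun x y hy => by rw [hR x y hy, zero_smul]⟩

theorem CompactTest.integrable {φ : ℝ × ℝ → E} (h : CompactTest φ) : Integrable φ cyl :=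
  integrable_of_compact h.smooth.continuous h.compact

variable [CompleteSpace E]

theorem integral_pd_x {φ : ℝ × ℝ → E} (h : CompactTest φ) : ∫ z, pd (1, 0) φ z ∂cyl = 0 := by
  have hi := (h.pd (1, 0)).integrable
  rw [cyl_eq_prod] at hi ⊢
  rw [integral_prod_symm _ hi]
  refine integral_eq_zero_of_ae (ae_of_all _ fun y => ?_)
  have h2 : (0 : ℝ) ≤ 2 * Real.pi := by positivity
  simp only [Pi.zero_apply]
  rw [← intervalIntegral.integral_of_le h2,
    intervalIntegral.integral_eq_sub_of_hasDerivAt (f := fun x => φ (x, y))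
      (fun x _ => hasDerivAt_pd_x (h.differentiable (x, y)))]
  · have := h.periodic 0 y
    rw [zero_add] at this
    rw [this, sub_self]
  · exact (((h.pd (1, 0)).smooth.continuous.comp
      (continuous_id.prodMk continuous_const))).intervalIntegrable _ _

theorem integral_pd_y {φ : ℝ × ℝ → E} (h : CompactTest φ) : ∫ z, pd (0, 1) φ z ∂cyl = 0 := by
  have hi := (h.pd (0, 1)).integrable
  rw [cyl_eq_prod] at hi ⊢
  rw [integral_prod _ hi]
  refine integral_eq_zero_of_ae (ae_of_all _ fun x => ?_)
  obtain ⟨R, hR⟩ := h.compact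
  have hs : ∀ f : ℝ × ℝ → E, (∀ x y, R < |y| → f (x, y) = 0) →
      HasCompactSupport fun y => f (x, y) := by
    intro f hf
    refine HasCompactSupport.of_support_subset_isCompact (isCompact_Icc (a := -R) (b := R)) ?_
    intro y hy
    by_contra hy'
    exact hy (hf x y (not_le.1 fun h => hy' (abs_le.1 h)))
  have hd : ∀ y, HasDerivAt (fun t => φ (x, t)) (pd (0, 1) φ (x, y)) y := fun y =>
    hasDerivAt_pd_y (h.differentiable (x, y))
  have hzero : ∀ y, R < |y| → φ (x, y) = 0 := hR x
  have hbot : Tendsto (fun y => φ (x, y)) atBot (𝓝 0) := by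
    refine tendsto_const_nhds.congr' ?_
    filter_upwards [eventually_lt_atBot (-|R|)] with y hy
    refine (hzero y ?_).symm
    rw [lt_abs]; right; linarith [le_abs_self R]
  have htop : Tendsto (fun y => φ (x, y)) atTop (𝓝 0) := by
    refine tendsto_const_nhds.congr' ?_
    filter_upwards [eventually_gt_atTop |R|] with y hy
    refine (hzero y ?_).symm
    rw [lt_abs]; left; linarith [le_abs_self R]
  have hint : Integrable fun y => pd (0, 1) φ (x, y) := by
    obtain ⟨R', hR'⟩ := (h.pd (0, 1)).compact
    refine Continuous.integrable_of_hasCompactSupport ((h.pd (0, 1)).smooth.continuous.comp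
      (continuous_const.prodMk continuous_id)) ?_
    refine HasCompactSupport.of_support_subset_isCompact (isCompact_Icc (a := -R') (b := R')) ?_
    intro y hy
    by_contra hy'
    exact hy (hR' x y (not_le.1 fun h => hy' (abs_le.1 h)))
  have := integral_of_hasDerivAt_of_tendsto hd hint hbot htop
  simpa using this

end Compact

/-! ### Weights and cut-offs -/

/-- A cut-off which is `1` for `|y| ≤ n + 1` and `0` for `|y| ≥ 2 (n + 1)`. -/
def cutoff (n : ℕ) (z : ℝ × ℝ) : ℝ :=
  (⟨1, 2, one_pos, one_lt_two⟩ : ContDiffBump (0 : ℝ)) (z.2 / (n + 1))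

theorem cutoff_mem (n : ℕ) (z : ℝ × ℝ) : ‖cutoff n z‖ ≤ 1 := by
  rw [cutoff, Real.norm_of_nonneg (ContDiffBump.nonneg _)]
  exact ContDiffBump.le_one _

theorem compactTest_cutoff (n : ℕ) : CompactTest (cutoff n) := by
  refine ⟨⟨(ContDiffBump.contDiff _).comp (contDiff_snd.div_const _), fun x y => rfl⟩,
    2 * (n + 1), fun x y hy => ?_⟩
  refine ContDiffBump.zero_of_le_dist _ ?_
  have hn : (0 : ℝ) < n + 1 := by positivity
  rw [dist_zero_right, norm_div, Real.norm_eq_abs, Real.norm_of_nonneg hn.le, le_div_iff₀ hn]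
  exact hy.le

theorem eventually_cutoff (z : ℝ × ℝ) : ∀ᶠ n in atTop, cutoff n z = 1 := by
  obtain ⟨N, hN⟩ := exists_nat_ge |z.2|
  filter_upwards [eventually_ge_atTop N] with n hn
  refine ContDiffBump.one_of_mem_closedBall _ ?_
  have hn' : (0 : ℝ) < n + 1 := by positivity
  have h2 : (N : ℝ) ≤ n := by exact_mod_cast hn
  rw [mem_closedBall_zero_iff, norm_div, Real.norm_eq_abs, Real.norm_of_nonneg hn'.le,
    div_le_one hn']
  linarith

theorem pd_x_cutoff (n : ℕ) (z : ℝ × ℝ) : pd (1, 0) (cutoff n) z = 0 := by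
  obtain ⟨x, y⟩ := z
  have h : HasDerivAt (fun t => cutoff n (t, y)) 0 x := hasDerivAt_const x (cutoff n (0, y))
  exact pd_x_eq (compactTest_cutoff n).differentiable h

theorem exists_pd_y_cutoff : ∃ C, 0 ≤ C ∧ ∀ n z, ‖pd (0, 1) (cutoff n) z‖ ≤ C / (n + 1) := by
  set b : ContDiffBump (0 : ℝ) := ⟨1, 2, one_pos, one_lt_two⟩
  have hb : ContDiff ℝ 1 b := b.contDiff
  obtain ⟨C, hC⟩ := (hb.continuous_deriv le_rfl).bounded_above_of_compact_support
    b.hasCompactSupport.deriv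
  refine ⟨C, (norm_nonneg _).trans (hC 0), fun n z => ?_⟩
  have hn : (0 : ℝ) < n + 1 := by positivity
  have h1 : pd (0, 1) (cutoff n) (z.1, z.2) = deriv b (z.2 / (n + 1)) * (1 / (n + 1)) := by
    refine pd_y_eq (compactTest_cutoff n).differentiable ?_
    have h2 := (hb.differentiable (by simp) (z.2 / (n + 1))).hasDerivAt
    exact h2.comp z.2 ((hasDerivAt_id z.2).div_const _)
  rw [Prod.mk.eta] at h1
  rw [h1, norm_mul, Real.norm_of_nonneg (by positivity : (0 : ℝ) ≤ 1 / (n + 1)), mul_one_div]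
  gcongr
  exact hC _

section Limits

variable {E : Type*} [NormedAddCommGroup E] [NormedSpace ℝ E]

theorem tendsto_integral_cutoff_smul {F : ℝ × ℝ → E} (hF : Integrable F cyl) :
    Tendsto (fun n => ∫ z, cutoff n z • F z ∂cyl) atTop (𝓝 (∫ z, F z ∂cyl)) := by
  refine tendsto_integral_of_dominated_convergence (fun z => ‖F z‖) (fun n => ?_) hF.norm
    (fun n => ae_of_all _ fun z => ?_) (ae_of_all _ fun z => ?_)
  · exact (compactTest_cutoff n).smooth.continuous.aestronglyMeasurable.smul
      hF.aestronglyMeasurable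
  · rw [norm_smul]
    exact mul_le_of_le_one_left (norm_nonneg _) (cutoff_mem n z)
  · refine tendsto_const_nhds.congr' ?_
    filter_upwards [eventually_cutoff z] with n hn
    rw [hn, one_smul]

theorem tendsto_integral_pd_cutoff_smul {F : ℝ × ℝ → E} (hF : Integrable F cyl) :
    Tendsto (fun n => ∫ z, pd (0, 1) (cutoff n) z • F z ∂cyl) atTop (𝓝 0) := by
  obtain ⟨C, hC0, hC⟩ := exists_pd_y_cutoff
  have h : Tendsto (fun n : ℕ => C * (∫ z, ‖F z‖ ∂cyl) * (1 / ((n : ℝ) + 1))) atTop (𝓝 0) := by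
    simpa using (tendsto_one_div_add_atTop_nhds_zero_nat (𝕜 := ℝ)).const_mul
      (C * ∫ z, ‖F z‖ ∂cyl)
  refine squeeze_zero_norm (fun n => ?_) h
  refine (norm_integral_le_of_norm_le (hF.norm.const_mul (C / (n + 1)))
    (ae_of_all _ fun z => ?_)).trans_eq ?_
  · rw [norm_smul]
    exact mul_le_mul_of_nonneg_right (hC n z) (norm_nonneg _)
  · rw [integral_const_mul]
    ring

end Limits

/-- The constant `128` is not optimal: it comes from `(1 + y² / 8)² ≤ cosh y`. -/
theorem one_add_abs_div_cosh_le (y : ℝ) : (1 + |y|) / Real.cosh y ≤ 128 * (1 + y ^ 2)⁻¹ := by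
  have h1 : 1 + (y / 2) ^ 2 / 2 ≤ Real.cosh (y / 2) := by
    have h := Real.cosh_two_mul (y / 4)
    rw [show 2 * (y / 4) = y / 2 by ring, Real.cosh_sq] at h
    have h' : (y / 4) ^ 2 ≤ Real.sinh (y / 4) ^ 2 := by
      rw [sq_le_sq, Real.abs_sinh]
      exact Real.self_le_sinh_iff.2 (abs_nonneg _)
    rw [h]
    nlinarith
  have h2 : Real.cosh y = 2 * Real.cosh (y / 2) ^ 2 - 1 := by
    have := Real.cosh_two_mul (y / 2)
    rw [show 2 * (y / 2) = y by ring] at this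
    rw [this]
    linarith [Real.cosh_sq (y / 2)]
  have h3 : (1 + y ^ 2 / 8) ^ 2 ≤ Real.cosh y := by
    have : (1 + y ^ 2 / 8) ^ 2 ≤ Real.cosh (y / 2) ^ 2 := by
      gcongr
      linarith
    nlinarith [Real.one_le_cosh (y / 2)]
  rw [div_le_iff₀ (Real.cosh_pos y), mul_assoc, inv_mul_eq_div, mul_div_assoc',
    le_div_iff₀ (by positivity)]
  have h4 : |y| ≤ 1 + y ^ 2 := by nlinarith [sq_abs y, sq_nonneg (|y| - 1), abs_nonneg y]
  nlinarith [sq_nonneg (y ^ 2), abs_nonneg y, sq_nonneg y]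

theorem integrable_one_add_abs_div_cosh : Integrable fun y : ℝ => (1 + |y|) / Real.cosh y := by
  refine (integrable_inv_one_add_sq.const_mul 128).mono' ?_ (ae_of_all _ fun y => ?_)
  · exact Continuous.aestronglyMeasurable
      ((continuous_const.add continuous_abs).div Real.continuous_cosh fun y => (Real.cosh_pos y).ne')
  · rw [Real.norm_of_nonneg (div_nonneg (by positivity) (Real.cosh_pos y).le)]
    exact one_add_abs_div_cosh_le y

/-! ### Integration by parts on the cylinder -/

section Weights

variable {ε : ℝ} (h0 : 0 ≤ ε) (h1 : ε < 1)
include h0 h1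

omit h1 in
theorem mul_cosh_le_den (z : ℝ × ℝ) : (1 - ε) * Real.cosh z.2 ≤ den ε z := by
  rw [den]
  nlinarith [Real.one_le_cosh z.2, Real.neg_one_le_cos z.1]

theorem one_sub_le_den (z : ℝ × ℝ) : 1 - ε ≤ den ε z := by
  refine le_trans ?_ (mul_cosh_le_den h0 z)
  nlinarith [Real.one_le_cosh z.2]

theorem integrable_one_add_abs_div_den :
    Integrable (fun z : ℝ × ℝ => (1 + |z.2|) / den ε z) cyl := by
  have h : Integrable (fun z : ℝ × ℝ => (1 - ε)⁻¹ * ((1 + |z.2|) / Real.cosh z.2)) cyl := by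
    rw [cyl_eq_prod]
    exact (integrable_const (μ := volume.restrict (Ioc 0 (2 * Real.pi))) (1 - ε)⁻¹).mul_prod
      integrable_one_add_abs_div_cosh
  refine h.mono' ?_ (ae_of_all _ fun z => ?_)
  · exact Continuous.aestronglyMeasurable ((continuous_const.add continuous_snd.abs).div
      contDiff_den.continuous fun z => (den_pos h0 h1 z).ne')
  · have h2 : 0 < 1 - ε := by linarith
    rw [Real.norm_of_nonneg (div_nonneg (by positivity) (den_pos h0 h1 z).le), inv_mul_eq_div,
      div_div, mul_comm (Real.cosh _)]
    exact div_le_div_of_nonneg_left (by positivity) (mul_pos h2 (Real.cosh_pos _))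
      (mul_cosh_le_den h0 z)

theorem integrable_inv_den : Integrable (fun z => 1 / den ε z) cyl := by
  refine (integrable_one_add_abs_div_den h0 h1).mono' ?_ (ae_of_all _ fun z => ?_)
  · exact Continuous.aestronglyMeasurable (continuous_const.div
      contDiff_den.continuous fun z => (den_pos h0 h1 z).ne')
  · rw [Real.norm_of_nonneg (div_nonneg (by positivity) (den_pos h0 h1 z).le)]
    have := (den_pos h0 h1 z).le
    gcongr
    linarith [abs_nonneg z.2]

theorem inv_den_sq_le (z : ℝ × ℝ) : 1 / den ε z ^ 2 ≤ (1 - ε)⁻¹ * (1 / den ε z) := by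
  have hd := den_pos h0 h1 z
  have h2 : 0 < 1 - ε := by linarith
  rw [inv_mul_eq_div, div_div, sq]
  exact div_le_div_of_nonneg_left zero_le_one (mul_pos hd h2)
    (mul_le_mul_of_nonneg_left (one_sub_le_den h0 h1 z) hd.le)

theorem rho_le (z : ℝ × ℝ) : rho ε z ≤ (1 + ε) * (1 / den ε z) := by
  have h2 : 0 < 1 - ε := by linarith
  have h3 := mul_le_mul_of_nonneg_left (inv_den_sq_le h0 h1 z) (one_sub_sq_pos h0 h1).le
  rw [rho, div_eq_mul_one_div]
  refine h3.trans_eq ?_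
  field_simp
  ring

theorem integrable_rho : Integrable (rho ε) cyl := by
  refine ((integrable_inv_den h0 h1).const_mul (1 + ε)).mono'
    (contDiff_rho h0 h1).continuous.aestronglyMeasurable (ae_of_all _ fun z => ?_)
  rw [Real.norm_of_nonneg (rho_pos h0 h1 z).le]
  exact rho_le h0 h1 z

theorem integrable_gp : Integrable (gp ε) cyl := by
  rw [show gp ε = fun z => 2 * rho ε z from funext (gp_eq h0 h1)]
  exact (integrable_rho h0 h1).const_mul 2

theorem continuous_gp : Continuous (gp ε) := by
  rw [show gp ε = fun z => 2 * rho ε z from funext (gp_eq h0 h1)]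
  exact continuous_const.mul (contDiff_rho h0 h1).continuous

theorem memLp_inv_den : MemLp (fun z => 1 / den ε z) 2 cyl := by
  have hm : AEStronglyMeasurable (fun z => 1 / den ε z) cyl :=
    Continuous.aestronglyMeasurable (continuous_const.div
      contDiff_den.continuous fun z => (den_pos h0 h1 z).ne')
  refine (memLp_two_iff_integrable_sq hm).2 ?_
  refine ((integrable_inv_den h0 h1).const_mul (1 - ε)⁻¹).mono' (hm.pow 2)
    (ae_of_all _ fun z => ?_)
  rw [Real.norm_of_nonneg (by positivity), div_pow, one_pow]
  exact inv_den_sq_le h0 h1 z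

theorem smoothPer_gp_vel : SmoothPer (fun z => gp ε z * vel1 ε z) ∧
    SmoothPer (fun z => gp ε z * vel2 ε z) := by
  have hd := fun z => (den_pos h0 h1 z).ne'
  have hg : gp ε = fun z => 2 * rho ε z := funext (gp_eq h0 h1)
  have hgs : ContDiff ℝ (⊤ : ℕ∞) (gp ε) := by
    rw [hg]
    exact contDiff_const.mul (contDiff_rho h0 h1)
  have hgp : ∀ x y, gp ε (x + 2 * Real.pi, y) = gp ε (x, y) := fun x y => by
    simp [hg, rho, den]
  refine ⟨⟨hgs.mul ((Real.contDiff_sinh.comp contDiff_snd).div contDiff_den hd), fun x y => ?_⟩,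
    ⟨hgs.mul ((contDiff_const.mul (Real.contDiff_sin.comp contDiff_fst)).div contDiff_den hd),
      fun x y => ?_⟩⟩
  · simp [hgp, vel1]
  · simp [hgp, vel2]

theorem abs_vel_le (z : ℝ × ℝ) : |vel1 ε z| ≤ (1 - ε)⁻¹ ∧ |vel2 ε z| ≤ (1 - ε)⁻¹ := by
  have hd := den_pos h0 h1 z
  have h2 : 0 < 1 - ε := by linarith
  have h3 := mul_cosh_le_den h0 z
  have h4 := one_sub_le_den h0 h1 z
  change |_ / den ε z| ≤ _ ∧ |_ / den ε z| ≤ _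
  rw [abs_div, abs_div, abs_of_pos hd, div_le_iff₀ hd, div_le_iff₀ hd, inv_mul_eq_div,
    le_div_iff₀ h2, le_div_iff₀ h2]
  constructor
  · have h5 : |Real.sinh z.2| ≤ Real.cosh z.2 := by
      rw [Real.abs_sinh, ← Real.cosh_abs]
      exact (Real.sinh_lt_cosh _).le
    nlinarith
  · rw [abs_mul, abs_of_nonneg h0]
    have h6 : ε * |Real.sin z.1| ≤ 1 * 1 :=
      mul_le_mul h1.le (Real.abs_sin_le_one _) (abs_nonneg _) zero_le_one
    nlinarith

end Weights

section Transport

variable {𝕜 : Type*} [RCLike 𝕜] {ε : ℝ} (h0 : 0 ≤ ε) (h1 : ε < 1)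
include h0 h1

/-- `g'(ψ_ε) u_ε` is divergence free. -/
theorem integral_gp_smul_transport_of_compactTest {φ : ℝ × ℝ → 𝕜} (hφ : CompactTest φ) :
    ∫ z, gp ε z • transport ε φ z ∂cyl = 0 := by
  obtain ⟨hs1, hs2⟩ := smoothPer_gp_vel h0 h1
  have hc1 := CompactTest.smul hs1 hφ
  have hc2 := CompactTest.smul hs2 hφ
  have e : ∀ z, gp ε z • transport ε φ z =
      pd (1, 0) (fun w => (gp ε w * vel1 ε w) • φ w) z +
        pd (0, 1) (fun w => (gp ε w * vel2 ε w) • φ w) z := by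
    intro z
    rw [pd_smul _ (hs1.differentiable z) (hφ.differentiable z),
      pd_smul _ (hs2.differentiable z) (hφ.differentiable z), transport, smul_add, smul_smul,
      smul_smul]
    have h := congrArg (fun r : ℝ => r • φ z) (div_gp_vel h0 h1 z)
    simp only [add_smul, zero_smul] at h
    linear_combination (exp := 1) -h
  rw [integral_congr_ae (ae_of_all _ e),
    integral_add (hc1.pd (1, 0)).integrable (hc2.pd (0, 1)).integrable, integral_pd_x hc1,
    integral_pd_y hc2, add_zero]

omit h0 h1 in
theorem transport_smul {f : ℝ × ℝ → ℝ} {F : ℝ × ℝ → 𝕜} (hf : SmoothPer f) (hF : SmoothPer F)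
    (z : ℝ × ℝ) : transport ε (fun w => f w • F w) z =
      f z • transport ε F z + transport ε f z • F z := by
  simp only [transport, pd_smul _ (hf.differentiable z) (hF.differentiable z), smul_add, smul_smul,
    add_smul, smul_eq_mul]
  simp only [mul_comm]
  abel

theorem norm_transport_le {F : ℝ × ℝ → 𝕜} {C : ℝ} {z : ℝ × ℝ}
    (hx : ‖pd (1, 0) F z‖ ≤ C / den ε z) (hy : ‖pd (0, 1) F z‖ ≤ C / den ε z) :
    ‖transport ε F z‖ ≤ 2 * (1 - ε)⁻¹ * (C / den ε z) := by
  obtain ⟨hv1, hv2⟩ := abs_vel_le h0 h1 z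
  have h2 : 0 < 1 - ε := by linarith
  refine (norm_add_le _ _).trans ?_
  rw [norm_smul, norm_smul, Real.norm_eq_abs, Real.norm_eq_abs]
  have e1 := mul_le_mul hv1 hx (norm_nonneg _) (inv_nonneg.2 h2.le)
  have e2 := mul_le_mul hv2 hy (norm_nonneg _) (inv_nonneg.2 h2.le)
  linarith

/-- The divergence theorem for `g'(ψ_ε) u_ε`, for functions which need not have compact support. -/
theorem integral_gp_smul_transport {F : ℝ × ℝ → 𝕜} (hF : SmoothPer F) {C : ℝ}
    (hC : ∀ z, ‖F z‖ ≤ C ∧ ‖pd (1, 0) F z‖ ≤ C / den ε z ∧ ‖pd (0, 1) F z‖ ≤ C / den ε z) :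
    ∫ z, gp ε z • transport ε F z ∂cyl = 0 := by
  have h2 : 0 < 1 - ε := by linarith
  obtain ⟨hs1, hs2⟩ := smoothPer_gp_vel h0 h1
  have hi1 : Integrable (fun z => gp ε z • transport ε F z) cyl := by
    refine ((integrable_gp h0 h1).mul_const (2 * (1 - ε)⁻¹ * (C / (1 - ε)))).mono' ?_
      (ae_of_all _ fun z => ?_)
    · have : (fun z => gp ε z • transport ε F z) = fun z => (gp ε z * vel1 ε z) • pd (1, 0) F z +
          (gp ε z * vel2 ε z) • pd (0, 1) F z := by
        funext z
        rw [transport, smul_add, smul_smul, smul_smul]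
      rw [this]
      exact ((hs1.smul (hF.pd _)).smooth.continuous.add
        (hs2.smul (hF.pd _)).smooth.continuous).aestronglyMeasurable
    · rw [norm_smul, Real.norm_of_nonneg (gp_pos ε z).le]
      refine mul_le_mul_of_nonneg_left ((norm_transport_le h0 h1 (hC z).2.1 (hC z).2.2).trans ?_)
        (gp_pos ε z).le
      have hC0 : 0 ≤ C := (norm_nonneg _).trans (hC z).1
      gcongr
      exact one_sub_le_den h0 h1 z
  have hi2 : Integrable (fun z => (gp ε z * vel2 ε z) • F z) cyl := by
    refine ((integrable_gp h0 h1).mul_const ((1 - ε)⁻¹ * C)).mono'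
      (hs2.smul hF).smooth.continuous.aestronglyMeasurable (ae_of_all _ fun z => ?_)
    rw [norm_smul, norm_mul, Real.norm_of_nonneg (gp_pos ε z).le, mul_assoc]
    refine mul_le_mul_of_nonneg_left ?_ (gp_pos ε z).le
    exact mul_le_mul (abs_vel_le h0 h1 z).2 (hC z).1 (norm_nonneg _) (inv_nonneg.2 h2.le)
  have t1 := tendsto_integral_cutoff_smul hi1
  have t2 := tendsto_integral_pd_cutoff_smul hi2
  have t3 := t1.add t2
  refine tendsto_nhds_unique (by simpa using t3) ?_
  refine tendsto_const_nhds.congr fun n => ?_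
  have hc := compactTest_cutoff n
  rw [← integral_gp_smul_transport_of_compactTest h0 h1 (hc.smul' hF), ← integral_add]
  · refine integral_congr_ae (ae_of_all _ fun z => ?_)
    simp only [transport_smul hc.toSmoothPer hF z]
    simp only [transport, pd_x_cutoff, smul_add, mul_zero, zero_add, smul_smul, smul_eq_mul]
    simp only [mul_comm, mul_left_comm, mul_assoc]
  · exact hi1.bdd_smul 1 hc.smooth.continuous.aestronglyMeasurable
      (ae_of_all _ fun z => cutoff_mem n z)
  · exact (CompactTest.smul' (hc.pd (0, 1)) (hs2.smul hF)).integrable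

end Transport

section WeakGradient

variable {𝕜 : Type*} [RCLike 𝕜]

theorem MemLp.integrableOn_cyl {p : ℝ × ℝ → 𝕜} (h : MemLp p 2 cyl) (R : ℝ) :
    IntegrableOn p (univ ×ˢ Icc (-R) R) cyl := by
  have := isFiniteMeasure_cyl_restrict R
  exact (h.restrict _).integrable (by norm_num)

theorem integrable_compactTest_mul {φ : ℝ × ℝ → 𝕜} (hφ : CompactTest φ) {ψ : ℝ × ℝ → 𝕜}
    (hψ : ∀ R : ℝ, IntegrableOn ψ (univ ×ˢ Icc (-R) R) cyl) :
    Integrable (fun z => φ z * ψ z) cyl := by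
  obtain ⟨R, hR⟩ := hφ.compact
  obtain ⟨C, hC⟩ := (isCompact_Icc.prod isCompact_Icc :
    IsCompact (Icc 0 (2 * Real.pi) ×ˢ Icc (-R) R)).exists_bound_of_continuousOn
      hφ.smooth.continuous.continuousOn
  have hm : MeasurableSet (univ ×ˢ Icc (-R) R : Set (ℝ × ℝ)) :=
    MeasurableSet.univ.prod measurableSet_Icc
  have h1 : IntegrableOn (fun z => φ z * ψ z) (univ ×ˢ Icc (-R) R) cyl := by
    refine Integrable.bdd_mul (c := C) (hψ R) hφ.smooth.continuous.aestronglyMeasurable ?_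
    have : ∀ᵐ z ∂cyl, z ∈ Ioc 0 (2 * Real.pi) ×ˢ (univ : Set ℝ) :=
      ae_restrict_mem measurableSet_strip
    filter_upwards [ae_restrict_of_ae this, ae_restrict_mem hm] with z hz hz'
    exact hC z ⟨Ioc_subset_Icc_self hz.1, hz'.2⟩
  rw [← integrableOn_univ]
  refine h1.of_forall_sdiff_eq_zero MeasurableSet.univ fun z hz => ?_
  have : φ z = 0 := hR z.1 z.2 (not_le.1 fun h => hz.2 ⟨mem_univ _, abs_le.1 h⟩)
  rw [this, zero_mul]

theorem CompactTest.clm {E E' : Type*} [NormedAddCommGroup E] [NormedSpace ℝ E]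
    [NormedAddCommGroup E'] [NormedSpace ℝ E'] (L : E →L[ℝ] E') {φ : ℝ × ℝ → E}
    (h : CompactTest φ) : CompactTest fun z => L (φ z) := by
  obtain ⟨R, hR⟩ := h.compact
  exact ⟨⟨L.contDiff.comp h.smooth, fun x y => by rw [h.periodic]⟩, R, fun x y hy => by
    rw [hR x y hy, map_zero]⟩

/-- A linear relation between integrals against real test functions extends to `𝕜`-valued test
functions. -/
theorem integral_compactTest_mul_eq {a b : ℝ × ℝ → 𝕜} {u v : ℝ × ℝ → 𝕜}
    (ha : CompactTest a) (hb : CompactTest b)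
    (hu : ∀ R : ℝ, IntegrableOn u (univ ×ˢ Icc (-R) R) cyl)
    (hv : ∀ R : ℝ, IntegrableOn v (univ ×ˢ Icc (-R) R) cyl)
    (h : ∀ L : 𝕜 →L[ℝ] ℝ, ∫ z, L (a z) • u z ∂cyl = ∫ z, L (b z) • v z ∂cyl) :
    ∫ z, a z * u z ∂cyl = ∫ z, b z * v z ∂cyl := by
  have key : ∀ {a u : ℝ × ℝ → 𝕜}, CompactTest a →
      (∀ R : ℝ, IntegrableOn u (univ ×ˢ Icc (-R) R) cyl) →
      ∫ z, a z * u z ∂cyl = ∫ z, (RCLike.reCLM (a z) : ℝ) • u z ∂cyl +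
        RCLike.I * ∫ z, (RCLike.imCLM (a z) : ℝ) • u z ∂cyl := by
    intro a u ha hu
    have h1 := integrable_compactTest_mul
      ((ha.clm (RCLike.reCLM (K := 𝕜))).clm (RCLike.ofRealCLM (K := 𝕜))) hu
    have h2 := integrable_compactTest_mul
      ((ha.clm (RCLike.imCLM (K := 𝕜))).clm (RCLike.ofRealCLM (K := 𝕜))) hu
    simp only [RCLike.real_smul_eq_coe_mul]
    simp only [RCLike.ofRealCLM_apply] at h1 h2
    rw [← integral_const_mul, ← integral_add h1 (h2.const_mul _)]
    refine integral_congr_ae (ae_of_all _ fun z => ?_)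
    simp only [RCLike.reCLM_apply, RCLike.imCLM_apply]
    rw [← mul_assoc, ← add_mul, mul_comm RCLike.I, RCLike.re_add_im]
  rw [key ha hu, key hb hv, h RCLike.reCLM, h RCLike.imCLM]

namespace HasWeakGrad

variable {χ p q : ℝ × ℝ → 𝕜} (h : HasWeakGrad χ p q)
include h

theorem integral_pd_x_mul {φ : ℝ × ℝ → 𝕜} (hφ : CompactTest φ) :
    ∫ z, pd (1, 0) φ z * χ z ∂cyl = -∫ z, φ z * p z ∂cyl := by
  rw [← integral_neg]
  simp only [← mul_neg]
  refine integral_compactTest_mul_eq (hφ.pd _) hφ h.locInt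
    (fun R => (MemLp.integrableOn_cyl h.memLp_x R).neg) fun L => ?_
  have := h.weak_x _ (hφ.clm L).isTest
  simp only [dx_eq_pd, pd_clm L _ (hφ.differentiable _)] at this
  simpa [integral_neg] using this

theorem integral_pd_y_mul {φ : ℝ × ℝ → 𝕜} (hφ : CompactTest φ) :
    ∫ z, pd (0, 1) φ z * χ z ∂cyl = -∫ z, φ z * q z ∂cyl := by
  rw [← integral_neg]
  simp only [← mul_neg]
  refine integral_compactTest_mul_eq (hφ.pd _) hφ h.locInt
    (fun R => (MemLp.integrableOn_cyl h.memLp_y R).neg) fun L => ?_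
  have := h.weak_y _ (hφ.clm L).isTest
  simp only [dy_eq_pd, pd_clm L _ (hφ.differentiable _)] at this
  simpa [integral_neg] using this

/-- Constants have weak gradient zero. -/
theorem sub_const (c : 𝕜) : HasWeakGrad (fun z => χ z - c) p q := by
  have hc : ∀ R : ℝ, IntegrableOn (fun _ : ℝ × ℝ => c) (univ ×ˢ Icc (-R) R) cyl := fun R => by
    have := isFiniteMeasure_cyl_restrict R
    exact integrable_const c
  have key : ∀ φ, IsTest φ → ∀ v : ℝ × ℝ, ∫ z, pd v φ z ∂cyl = 0 →
      ∫ z, pd v φ z • (χ z - c) ∂cyl = ∫ z, pd v φ z • χ z ∂cyl := by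
    intro φ hφ v hv
    have hi := integrable_compactTest_mul
      ((hφ.compactTest.pd v).clm (RCLike.ofRealCLM (K := 𝕜))) h.locInt
    simp only [smul_sub]
    rw [integral_sub, integral_smul_const, hv, zero_smul, sub_zero]
    · simpa only [RCLike.real_smul_eq_coe_mul, RCLike.ofRealCLM_apply] using hi
    · exact (hφ.compactTest.pd v).integrable.smul_const c
  refine ⟨fun R => (h.locInt R).sub (hc R), h.memLp_x, h.memLp_y, fun φ hφ => ?_,
    fun φ hφ => ?_⟩
  · rw [← h.weak_x φ hφ]
    exact key φ hφ _ (integral_pd_x hφ.compactTest)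
  · rw [← h.weak_y φ hφ]
    exact key φ hφ _ (integral_pd_y hφ.compactTest)

end HasWeakGrad

section PolynomialGradient

variable {ε : ℝ} (h0 : 0 ≤ ε) (h1 : ε < 1)
include h0 h1

theorem memLp_pd_Pol {n : ℕ} {F : ℝ × ℝ → 𝕜} (hF : F ∈ Pol 𝕜 ε n) :
    MemLp (pd (1, 0) F) 2 cyl ∧ MemLp (pd (0, 1) F) 2 cyl := by
  obtain ⟨C, hC0, hC⟩ := bound_Pol h0 h1 n F hF
  have hs := smoothPer_Pol h0 h1 n F hF
  refine ⟨((memLp_inv_den h0 h1).const_mul C).mono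
    (hs.pd _).smooth.continuous.aestronglyMeasurable (ae_of_all _ fun z => ?_),
    ((memLp_inv_den h0 h1).const_mul C).mono
    (hs.pd _).smooth.continuous.aestronglyMeasurable (ae_of_all _ fun z => ?_)⟩
  · refine (hC z).2.1.trans ((le_abs_self _).trans_eq' ?_)
    rw [mul_one_div]
  · refine (hC z).2.2.trans ((le_abs_self _).trans_eq' ?_)
    rw [mul_one_div]

theorem hasWeakGrad_Pol {n : ℕ} {F : ℝ × ℝ → 𝕜} (hF : F ∈ Pol 𝕜 ε n) :
    HasWeakGrad F (pd (1, 0) F) (pd (0, 1) F) := by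
  obtain ⟨C, hC0, hC⟩ := bound_Pol h0 h1 n F hF
  obtain ⟨hx, hy⟩ := memLp_pd_Pol h0 h1 hF
  have hs := smoothPer_Pol h0 h1 n F hF
  have key : ∀ φ, IsTest φ → ∀ v : ℝ × ℝ, ∫ z, pd v (fun w => φ w • F w) z ∂cyl = 0 →
      ∫ z, pd v φ z • F z ∂cyl = -∫ z, φ z • pd v F z ∂cyl := by
    intro φ hφ v hv
    simp only [pd_smul _ (hφ.compactTest.differentiable _) (hs.differentiable _)] at hv
    rw [integral_add (hφ.compactTest.smul' (hs.pd v)).integrable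
      ((hφ.compactTest.pd v).smul' hs).integrable] at hv
    exact eq_neg_of_add_eq_zero_right hv
  refine ⟨fun R => ?_, hx, hy, fun φ hφ => ?_, fun φ hφ => ?_⟩
  · have := isFiniteMeasure_cyl_restrict R
    exact (integrable_const C).mono' hs.smooth.continuous.aestronglyMeasurable
      (ae_of_all _ fun z => (hC z).1)
  · exact key φ hφ _ (integral_pd_x (hφ.compactTest.smul' hs))
  · exact key φ hφ _ (integral_pd_y (hφ.compactTest.smul' hs))

theorem norm_lap_Pol_le {n : ℕ} {F : ℝ × ℝ → 𝕜} (hF : F ∈ Pol 𝕜 ε n) :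
    ∃ C, 0 ≤ C ∧ ∀ z, ‖lap F z‖ ≤ C * gp ε z := by
  obtain ⟨G, hG, hGe⟩ := lap_Pol h0 h1 n F (Pol_le_succ n hF)
  obtain ⟨C, hC0, hC⟩ := bound_Pol h0 h1 n F hF
  obtain ⟨C', hC0', hC'⟩ := bound_Pol h0 h1 n G hG
  refine ⟨C' + n * (n + 1) * C, by positivity, fun z => ?_⟩
  have hr := rho_pos h0 h1 z
  have hn : ‖(n * (n + 1) : ℝ)‖ = n * (n + 1) := Real.norm_of_nonneg (by positivity)
  rw [hGe, gp_eq h0 h1, norm_smul, Real.norm_of_nonneg hr.le]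
  have h2 : ‖G z - (n * (n + 1) : ℝ) • F z‖ ≤ C' + n * (n + 1) * C := by
    refine (norm_sub_le _ _).trans ?_
    rw [norm_smul, hn]
    gcongr
    · exact (hC' z).1
    · exact (hC z).1
  nlinarith [norm_nonneg (G z - (n * (n + 1) : ℝ) • F z)]

/-- Green's formula for polynomials on the sphere. -/
theorem integral_grad_Pol_mul {n : ℕ} {F : ℝ × ℝ → 𝕜} (hF : F ∈ Pol 𝕜 ε n)
    {χ p q : ℝ × ℝ → 𝕜} (hχ : HasWeakGrad χ p q) (hi : Integrable (fun z => (1 / den ε z) • χ z) cyl) :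
    ∫ z, (pd (1, 0) F z * p z + pd (0, 1) F z * q z) ∂cyl = -∫ z, lap F z * χ z ∂cyl := by
  obtain ⟨C, hC0, hC⟩ := bound_Pol h0 h1 n F hF
  -- Integrability of `χ / (cosh y + ε cos x)` suffices, because the gradient and the Laplacian of `F`
  -- decay at least like `1 / (cosh y + ε cos x)`.
  obtain ⟨C', hC0', hC'⟩ := norm_lap_Pol_le h0 h1 hF
  obtain ⟨hx, hy⟩ := memLp_pd_Pol h0 h1 hF
  have hs := smoothPer_Pol h0 h1 n F hF
  have hmχ : AEStronglyMeasurable χ cyl := by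
    have : χ = fun z => den ε z • (1 / den ε z) • χ z := by
      funext z
      rw [smul_smul, mul_one_div_cancel (den_pos h0 h1 z).ne', one_smul]
    rw [this]
    exact contDiff_den.continuous.aestronglyMeasurable.smul hi.aestronglyMeasurable
  have hlap : Continuous (lap F) := by
    exact ((hs.pd _).pd _).smooth.continuous.add ((hs.pd _).pd _).smooth.continuous
  have hi1 : Integrable (fun z => lap F z * χ z) cyl := by
    refine (hi.norm.const_mul (C' * (2 * (1 + ε)))).mono'
      (hlap.aestronglyMeasurable.mul hmχ) (ae_of_all _ fun z => ?_)
    have hd := den_pos h0 h1 z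
    rw [norm_mul, norm_smul, Real.norm_of_nonneg (by positivity : 0 ≤ 1 / den ε z), ← mul_assoc]
    refine mul_le_mul_of_nonneg_right ((hC' z).trans ?_) (norm_nonneg _)
    rw [mul_assoc]
    refine mul_le_mul_of_nonneg_left ?_ hC0'
    rw [gp_eq h0 h1]
    linarith [rho_le h0 h1 z]
  have hi2 : Integrable (fun z => pd (0, 1) F z * χ z) cyl := by
    refine (hi.norm.const_mul C).mono'
      ((hs.pd _).smooth.continuous.aestronglyMeasurable.mul hmχ) (ae_of_all _ fun z => ?_)
    have hd := den_pos h0 h1 z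
    rw [norm_mul, norm_smul, Real.norm_of_nonneg (by positivity : 0 ≤ 1 / den ε z), ← mul_assoc,
      mul_one_div]
    exact mul_le_mul_of_nonneg_right (hC z).2.2 (norm_nonneg _)
  have hi3 : Integrable (fun z => pd (1, 0) F z * p z + pd (0, 1) F z * q z) cyl :=
    (hx.integrable_mul hχ.memLp_x).add (hy.integrable_mul hχ.memLp_y)
  -- Integrate by parts with the cut-off; its gradient is `O(1 / m)` and points in the
  -- `y`-direction.
  have t1 := (tendsto_integral_cutoff_smul hi1).add (tendsto_integral_pd_cutoff_smul hi2)
  have t3 := (tendsto_integral_cutoff_smul hi3).neg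
  rw [add_zero] at t1
  rw [eq_neg_iff_add_eq_zero, add_eq_zero_iff_neg_eq]
  refine tendsto_nhds_unique t3 (t1.congr fun m => ?_)
  have hc := compactTest_cutoff m
  have hcx := hc.smul' (hs.pd (1, 0))
  have hcy := hc.smul' (hs.pd (0, 1))
  have ex := hχ.integral_pd_x_mul hcx
  have ey := hχ.integral_pd_y_mul hcy
  have hxp := integrable_compactTest_mul hcx (MemLp.integrableOn_cyl hχ.memLp_x)
  have hyq := integrable_compactTest_mul hcy (MemLp.integrableOn_cyl hχ.memLp_y)
  have hxc := integrable_compactTest_mul (hcx.pd (1, 0)) hχ.locInt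
  have hyc := integrable_compactTest_mul (hcy.pd (0, 1)) hχ.locInt
  have hl := integrable_compactTest_mul (φ := fun z => cutoff m z • lap F z)
    (hc.smul' (F := lap F) ⟨((hs.pd (1, 0)).pd (1, 0)).smooth.add
      ((hs.pd (0, 1)).pd (0, 1)).smooth, fun x y => by
        simp only [lap, ((hs.pd (1, 0)).pd (1, 0)).periodic x y,
          ((hs.pd (0, 1)).pd (0, 1)).periodic x y]⟩) hχ.locInt
  have hcd := integrable_compactTest_mul ((hc.pd (0, 1)).smul' (hs.pd (0, 1))) hχ.locInt
  simp only [smul_mul_assoc] at hxp hyq hl hcd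
  rw [← integral_add hl hcd]
  have e1 : ∫ z, cutoff m z • (pd (1, 0) F z * p z + pd (0, 1) F z * q z) ∂cyl =
      -(∫ z, pd (1, 0) (fun z => cutoff m z • pd (1, 0) F z) z * χ z ∂cyl) +
        -∫ z, pd (0, 1) (fun z => cutoff m z • pd (0, 1) F z) z * χ z ∂cyl := by
    rw [ex, ey, neg_neg, neg_neg]
    simp only [smul_mul_assoc]
    rw [← integral_add hxp hyq]
    simp only [smul_add]
  rw [e1, ← neg_add, neg_neg, ← integral_add hxc hyc]
  refine integral_congr_ae (ae_of_all _ fun z => ?_)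
  simp only
  rw [pd_smul _ (hc.differentiable z) ((hs.pd _).differentiable z),
    pd_smul _ (hc.differentiable z) ((hs.pd _).differentiable z), pd_x_cutoff, lap]
  simp only [zero_smul, add_zero, add_mul, smul_add, smul_mul_assoc]
  abel

end PolynomialGradient

end WeakGradient

/-! ### Regularity of functions with square integrable weak gradient -/

/-- Integration by parts for the primitive of an integrable function, by Fubini's theorem. -/
theorem setIntegral_deriv_smul_primitive {E : Type*} [NormedAddCommGroup E] [NormedSpace ℝ E]
    [CompleteSpace E] {a b : ℝ} {β β' : ℝ → ℝ} (hβ : ∀ x, HasDerivAt β (β' x) x)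
    (hc : Continuous β') {q : ℝ → E} (hq : IntegrableOn q (Ioc a b)) :
    ∫ y in Ioc a b, β' y • ∫ t in Ioc a y, q t =
      (β b • ∫ t in Ioc a b, q t) - ∫ t in Ioc a b, β t • q t := by
  have hβc : Continuous β := continuous_iff_continuousAt.2 fun x => (hβ x).continuousAt
  have e1 : ∫ y in Ioc a b, β' y • ∫ t in Ioc a y, q t =
      ∫ y in Ioc a b, ∫ t in Ioc a b, {z : ℝ × ℝ | z.2 ≤ z.1}.indicator
        (fun z => β' z.1 • q z.2) (y, t) := by
    refine setIntegral_congr_fun measurableSet_Ioc fun y hy => ?_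
    rw [← integral_smul, show Ioc a y = Ioc a b ∩ Iic y by
      rw [Ioc_inter_Iic, inf_eq_right.2 hy.2], ← setIntegral_indicator measurableSet_Iic]
    rfl
  have hi : Integrable (fun z : ℝ × ℝ => β' z.1 • q z.2)
      ((volume.restrict (Ioc a b)).prod (volume.restrict (Ioc a b))) := by
    have : Integrable β' (volume.restrict (Ioc a b)) :=
      (hc.integrableOn_Icc).mono_set Ioc_subset_Icc_self
    exact this.smul_prod hq
  rw [e1, integral_integral_swap (f := fun y t => {z : ℝ × ℝ | z.2 ≤ z.1}.indicator
    (fun z => β' z.1 • q z.2) (y, t)) (hi.indicator (measurableSet_le measurable_snd measurable_fst))]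
  have hb : IntegrableOn (fun t => β t • q t) (Ioc a b) := by
    obtain ⟨C, hC⟩ := isCompact_Icc.exists_bound_of_continuousOn (s := Icc a b) hβc.continuousOn
    refine Integrable.bdd_smul hq C hβc.aestronglyMeasurable ?_
    filter_upwards [ae_restrict_mem measurableSet_Ioc] with t ht
    exact hC t (Ioc_subset_Icc_self ht)
  rw [← integral_smul, ← integral_sub (f := fun t => β b • q t) (hq.smul _) hb]
  refine setIntegral_congr_fun measurableSet_Ioc fun t ht => ?_
  have e2 : ∀ y, {z : ℝ × ℝ | z.2 ≤ z.1}.indicator (fun z => β' z.1 • q z.2) (y, t) =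
      (Ici t).indicator (fun y => β' y • q t) y := fun y => rfl
  simp only [e2]
  rw [setIntegral_indicator measurableSet_Ici, integral_smul_const, ← sub_smul]
  congr 1
  rw [← intervalIntegral.integral_eq_sub_of_hasDerivAt (fun x _ => hβ x)
    (hc.intervalIntegrable _ _), intervalIntegral.integral_of_le ht.2]
  refine setIntegral_congr_set ?_
  have : Ioc a b ∩ Ici t = Icc t b := by
    ext y
    simp only [mem_inter_iff, mem_Ioc, mem_Ici, mem_Icc]
    exact ⟨fun h => ⟨h.2, h.1.2⟩, fun h => ⟨⟨ht.1.trans_le h.1, h.2⟩, h.1⟩⟩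
  rw [this]
  exact Ioc_ae_eq_Icc.symm

theorem integral_norm_mul_norm_le_sqrt {Z E F : Type*} [MeasurableSpace Z] {μ : Measure Z}
    [NormedAddCommGroup E] [NormedAddCommGroup F] {f : Z → E} {g : Z → F} (hf : MemLp f 2 μ)
    (hg : MemLp g 2 μ) :
    ∫ z, ‖f z‖ * ‖g z‖ ∂μ ≤ √(∫ z, ‖f z‖ ^ 2 ∂μ) * √(∫ z, ‖g z‖ ^ 2 ∂μ) := by
  have hpq : (2 : ℝ).HolderConjugate 2 := Real.HolderConjugate.two_two
  have h := integral_mul_norm_le_Lp_mul_Lq (f := fun z => ‖f z‖) (g := fun z => ‖g z‖) (μ := μ) hpq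
    (by simpa using hf.norm) (by simpa using hg.norm)
  simpa only [Real.rpow_two, ← Real.sqrt_eq_rpow, norm_norm] using h

theorem norm_setIntegral_le_sqrt_mul {E : Type*} [NormedAddCommGroup E] [NormedSpace ℝ E]
    {f : ℝ → E} (hf : MemLp f 2) (a b : ℝ) :
    ‖∫ t in a..b, f t‖ ≤ √(∫ t, ‖f t‖ ^ 2) * √|b - a| := by
  rw [intervalIntegral.norm_intervalIntegral_eq]
  have : IsFiniteMeasure (volume.restrict (uIoc a b)) := by
    rw [uIoc]
    infer_instance
  have h1 : MemLp (fun _ : ℝ => (1 : ℝ)) 2 (volume.restrict (uIoc a b)) := memLp_const 1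
  have h := integral_norm_mul_norm_le_sqrt (hf.restrict (uIoc a b)) h1
  simp only [norm_one, mul_one, one_pow] at h
  refine (norm_integral_le_integral_norm _).trans (h.trans ?_)
  have e1 : ∫ _ in uIoc a b, (1 : ℝ) = |b - a| := by
    rw [integral_const, smul_eq_mul, mul_one, measureReal_restrict_apply_univ, Measure.real,
      Real.volume_uIoc, ENNReal.toReal_ofReal (abs_nonneg _)]
  rw [e1]
  gcongr
  · exact ae_of_all _ fun t => by positivity
  · exact (memLp_two_iff_integrable_sq_norm hf.1).1 hf
  · exact Measure.restrict_le_self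

section OneDimension

theorem contDiff_of_hasDerivAt {β γ : ℝ → ℝ} (hγ : ContDiff ℝ (⊤ : ℕ∞) γ)
    (h : ∀ x, HasDerivAt β (γ x) x) : ContDiff ℝ (⊤ : ℕ∞) β := by
  refine contDiff_infty_iff_deriv.2 ⟨fun x => (h x).differentiableAt, ?_⟩
  rwa [show deriv β = γ from funext fun x => (h x).deriv]

/-- A test function of mean zero is the derivative of a test function. -/
theorem exists_primitive_of_compact {γ : ℝ → ℝ} (hγ : ContDiff ℝ (⊤ : ℕ∞) γ)
    (hc : ∃ R : ℝ, ∀ y, R < |y| → γ y = 0) (h0 : ∫ y, γ y = 0) :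
    ∃ β : ℝ → ℝ, ContDiff ℝ (⊤ : ℕ∞) β ∧ (∃ R : ℝ, ∀ y, R < |y| → β y = 0) ∧
      ∀ y, HasDerivAt β (γ y) y := by
  obtain ⟨R, hR⟩ := hc
  have hd : ∀ y, HasDerivAt (fun y => ∫ t in (-(|R| + 1))..y, γ t) (γ y) y := fun y =>
    intervalIntegral.integral_hasDerivAt_right (hγ.continuous.intervalIntegrable _ _)
      hγ.continuous.stronglyMeasurable.stronglyMeasurableAtFilter hγ.continuous.continuousAt
  refine ⟨_, contDiff_of_hasDerivAt hγ hd, ⟨|R| + 1, fun y hy => ?_⟩, hd⟩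
  have hR' : ∀ t, |R| + 1 ≤ |t| → γ t = 0 := fun t ht => hR t (by linarith [le_abs_self R])
  rcases lt_abs.1 hy with h | h
  · rw [intervalIntegral.integral_eq_integral_of_support_subset, h0]
    intro t ht
    by_contra h'
    refine ht (hR' t ?_)
    rw [mem_Ioc, not_and_or, not_lt, not_le] at h'
    rcases h' with h' | h'
    · exact le_abs.2 (Or.inr (by linarith))
    · exact le_abs.2 (Or.inl (by linarith))
  · refine intervalIntegral.integral_zero_ae (ae_of_all _ fun t ht => hR' t ?_)
    rw [uIoc_of_ge (by linarith)] at ht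
    exact le_abs.2 (Or.inr (by linarith [ht.2]))

/-- A smooth periodic function of mean zero is the derivative of a smooth periodic function. -/
theorem exists_primitive_of_periodic {a : ℝ → ℝ} (ha : ContDiff ℝ (⊤ : ℕ∞) a)
    (hp : Function.Periodic a (2 * Real.pi)) (h0 : ∫ x in Ioc 0 (2 * Real.pi), a x = 0) :
    ∃ α : ℝ → ℝ, ContDiff ℝ (⊤ : ℕ∞) α ∧ Function.Periodic α (2 * Real.pi) ∧
      ∀ x, HasDerivAt α (a x) x := by
  have hd : ∀ y, HasDerivAt (fun y => ∫ t in (0 : ℝ)..y, a t) (a y) y := fun y =>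
    intervalIntegral.integral_hasDerivAt_right (ha.continuous.intervalIntegrable _ _)
      ha.continuous.stronglyMeasurable.stronglyMeasurableAtFilter ha.continuous.continuousAt
  refine ⟨_, contDiff_of_hasDerivAt ha hd, fun x => ?_, hd⟩
  simp only
  rw [← intervalIntegral.integral_add_adjacent_intervals
    (ha.continuous.intervalIntegrable 0 x) (ha.continuous.intervalIntegrable x (x + 2 * Real.pi)),
    hp.intervalIntegral_add_eq x 0, zero_add,
    intervalIntegral.integral_of_le (b := 2 * Real.pi) (by positivity), h0, add_zero]

variable {𝕜 : Type*} [RCLike 𝕜]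

/-- An integrable function on the circle whose weak derivative is integrable is essentially
bounded, since it differs from a primitive of the derivative by a constant. -/
theorem exists_bound_of_weak_deriv {e P : ℝ → 𝕜} (he : IntegrableOn e (Ioc 0 (2 * Real.pi)))
    (hP : IntegrableOn P (Ioc 0 (2 * Real.pi)))
    (h : ∀ α a : ℝ → ℝ, ContDiff ℝ (⊤ : ℕ∞) α → Function.Periodic α (2 * Real.pi) →
      (∀ x, HasDerivAt α (a x) x) →
      ∫ x in Ioc 0 (2 * Real.pi), a x • e x = -∫ x in Ioc 0 (2 * Real.pi), α x • P x) :
    ∃ C, ∀ᵐ x ∂volume.restrict (Ioc 0 (2 * Real.pi)), ‖e x‖ ≤ C := by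
  set I := Ioc 0 (2 * Real.pi) with hI
  set E : ℝ → 𝕜 := fun x => ∫ t in Ioc 0 x, P t with hE
  have hpi := Real.pi_pos
  have hvol : volume.real I = 2 * Real.pi := by
    rw [hI, Real.volume_real_Ioc_of_le (by positivity), sub_zero]
  have hP0 : ∫ x in I, P x = 0 := by
    have := h (fun _ => 1) (fun _ => 0) contDiff_const (fun _ => rfl) fun x => hasDerivAt_const x 1
    simpa using this
  have hEb : ∀ x ∈ I, ‖E x‖ ≤ ∫ t in I, ‖P t‖ := fun x hx => by
    refine (norm_integral_le_integral_norm _).trans ?_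
    refine setIntegral_mono_set hP.norm (ae_of_all _ fun _ => norm_nonneg _) ?_
    exact (Ioc_subset_Ioc_right hx.2).eventuallyLE
  have hEm : AEStronglyMeasurable E (volume.restrict I) := by
    have h1 : ContinuousOn (fun x => ∫ t in Ioc 0 x, P t) (Icc 0 (2 * Real.pi)) :=
      intervalIntegral.continuousOn_primitive
        ((integrableOn_Icc_iff_integrableOn_Ioc).2 hP)
    exact (h1.mono Ioc_subset_Icc_self).aestronglyMeasurable measurableSet_Ioc
  have hEi : IntegrableOn E I := by
    refine Integrable.mono' (integrable_const (∫ t in I, ‖P t‖)) hEm ?_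
    filter_upwards [ae_restrict_mem measurableSet_Ioc] with x hx using hEb x hx
  set m : 𝕜 := (2 * Real.pi)⁻¹ • ∫ x in I, (e x - E x) with hm
  have hv : Integrable (fun x => e x - E x - m) (volume.restrict I) :=
    (he.sub hEi).sub (integrable_const m)
  have hbdd : ∀ a : ℝ → ℝ, ContDiff ℝ (⊤ : ℕ∞) a → ∀ f : ℝ → 𝕜, IntegrableOn f I →
      IntegrableOn (fun x => a x • f x) I := by
    intro a ha f hf
    obtain ⟨C, hC⟩ := isCompact_Icc.exists_bound_of_continuousOn (s := Icc 0 (2 * Real.pi))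
      ha.continuous.continuousOn
    refine Integrable.bdd_smul hf C ha.continuous.aestronglyMeasurable ?_
    filter_upwards [ae_restrict_mem measurableSet_Ioc] with t ht
    exact hC t (Ioc_subset_Icc_self ht)
  -- `e - E` is orthogonal to smooth functions of mean zero, so `e - E - m` is to all smooth functions.
  have key0 : ∀ a : ℝ → ℝ, ContDiff ℝ (⊤ : ℕ∞) a → Function.Periodic a (2 * Real.pi) →
      ∫ x in I, a x = 0 → ∫ x in I, a x • (e x - E x) = 0 := by
    intro a ha hp ha0
    obtain ⟨α, hα, hαp, hd⟩ := exists_primitive_of_periodic ha hp ha0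
    have h1 := h α a hα hαp hd
    have h2 := setIntegral_deriv_smul_primitive (a := 0) (b := 2 * Real.pi) hd ha.continuous hP
    rw [← hI, hP0, smul_zero, zero_sub] at h2
    simp only [smul_sub]
    rw [integral_sub (hbdd a ha e he) (hbdd a ha E hEi), h1, h2, sub_self]
  have key : ∀ a : ℝ → ℝ, ContDiff ℝ (⊤ : ℕ∞) a → Function.Periodic a (2 * Real.pi) →
      ∫ x in I, a x • (e x - E x - m) = 0 := by
    intro a ha hp
    have hai : IntegrableOn a I := ha.continuous.integrableOn_Icc.mono_set Ioc_subset_Icc_self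
    set c := (2 * Real.pi)⁻¹ * ∫ x in I, a x with hc
    have h1 := key0 (fun x => a x - c) (ha.sub contDiff_const) (fun x => by simp only [hp x]) (by
      rw [integral_sub hai (integrable_const c), integral_const, measureReal_restrict_apply_univ,
        hvol, smul_eq_mul, hc]
      field_simp
      ring)
    have hd : IntegrableOn (fun x => e x - E x) I := he.sub hEi
    have hcd : IntegrableOn (fun x => c • (e x - E x)) I := hd.smul c
    simp only [sub_smul] at h1
    rw [integral_sub (hbdd a ha _ hd) hcd, integral_smul, sub_eq_zero] at h1
    have hs : ∀ x, a x • (e x - E x - m) = a x • (e x - E x) - a x • m := fun x => smul_sub _ _ _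
    simp only [hs]
    rw [integral_sub (hbdd a ha _ hd) (hbdd a ha _ (integrable_const m)),
      integral_smul_const, h1, hm, hc, smul_smul, mul_comm, sub_self]
  -- `cos` and `sin` separate the points of the circle.
  have hz := ae_eq_zero_of_separating_smul (μ := volume.restrict I) (S := I) measurableSet_Ioc
    (by rw [Measure.restrict_apply measurableSet_Ioc.compl, compl_inter_self, measure_empty])
    (![Real.cos, Real.sin] : Fin 2 → ℝ → ℝ)
    (fun i => by fin_cases i; exacts [Real.measurable_cos, Real.measurable_sin])
    (fun i z => by
      fin_cases i
      exacts [⟨Real.neg_one_le_cos z, Real.cos_le_one z⟩,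
        ⟨Real.neg_one_le_sin z, Real.sin_le_one z⟩])
    (fun z hz w hw hzw => eq_of_cos_eq_of_sin_eq hz hw (hzw 0) (hzw 1)) hv (by
      intro F hF
      have : ContDiff ℝ (⊤ : ℕ∞) F ∧ Function.Periodic F (2 * Real.pi) := by
        induction hF using Submonoid.closure_induction with
        | mem F hF =>
          obtain ⟨i, rfl⟩ := hF
          fin_cases i
          exacts [⟨Real.contDiff_cos, Real.cos_periodic⟩, ⟨Real.contDiff_sin, Real.sin_periodic⟩]
        | one => exact ⟨contDiff_const, fun _ => rfl⟩
        | mul F G _ _ hF hG => exact ⟨hF.1.mul hG.1, hF.2.mul hG.2⟩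
      exact key F this.1 this.2)
  refine ⟨(∫ t in I, ‖P t‖) + ‖m‖, ?_⟩
  filter_upwards [hz, ae_restrict_mem measurableSet_Ioc] with x hx hxI
  have : e x = E x + m := by
    rw [Pi.zero_apply, sub_sub, sub_eq_zero] at hx
    exact hx
  rw [this]
  exact (norm_add_le _ _).trans (add_le_add_left (hEb x hxI) _)

end OneDimension

/-! ### Traces on `y = 0` -/

section Trace

variable {𝕜 : Type*} [RCLike 𝕜]

/-- Lebesgue measure on the circle `𝕋_{2π}`. -/
def circ : Measure ℝ := volume.restrict (Ioc 0 (2 * Real.pi))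

instance : IsFiniteMeasure circ := by rw [circ]; infer_instance

theorem cyl_eq_circ_prod : cyl = circ.prod (volume : Measure ℝ) := cyl_eq_prod

theorem cyl_restrict_eq (R : ℝ) :
    cyl.restrict (univ ×ˢ Icc (-R) R) = circ.prod (volume.restrict (Icc (-R) R)) := by
  rw [cyl_eq_circ_prod, ← Measure.prod_restrict, Measure.restrict_univ]

/-- The primitive in `y`, vanishing on `y = 0`. -/
def primY (q : ℝ × ℝ → 𝕜) (z : ℝ × ℝ) : 𝕜 := ∫ t in (0 : ℝ)..z.2, q (z.1, t)

theorem stronglyMeasurable_primY {q : ℝ × ℝ → 𝕜} (hq : StronglyMeasurable q) :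
    StronglyMeasurable (primY q) := by
  have hm : Measurable fun w : (ℝ × ℝ) × ℝ => (w.1.1, w.2) := by fun_prop
  have hqm : StronglyMeasurable fun w : (ℝ × ℝ) × ℝ => q (w.1.1, w.2) := hq.comp_measurable hm
  have h1 : MeasurableSet {w : (ℝ × ℝ) × ℝ | 0 < w.2 ∧ w.2 ≤ w.1.2} :=
    (measurableSet_lt measurable_const measurable_snd).inter
      (measurableSet_le measurable_snd (measurable_snd.comp measurable_fst))
  have h2 : MeasurableSet {w : (ℝ × ℝ) × ℝ | w.1.2 < w.2 ∧ w.2 ≤ 0} :=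
    (measurableSet_lt (measurable_snd.comp measurable_fst) measurable_snd).inter
      (measurableSet_le measurable_snd measurable_const)
  have e : primY q = fun z =>
      (∫ t, {w : (ℝ × ℝ) × ℝ | 0 < w.2 ∧ w.2 ≤ w.1.2}.indicator
        (fun w => q (w.1.1, w.2)) (z, t)) -
      ∫ t, {w : (ℝ × ℝ) × ℝ | w.1.2 < w.2 ∧ w.2 ≤ 0}.indicator
        (fun w => q (w.1.1, w.2)) (z, t) := by
    funext z
    rw [primY, intervalIntegral, ← integral_indicator measurableSet_Ioc,
      ← integral_indicator measurableSet_Ioc]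
    rfl
  rw [e]
  exact ((hqm.indicator h1).integral_prod_right').sub ((hqm.indicator h2).integral_prod_right')

/-- The `L²` norm over the fibre `{x} × ℝ`.  It is finite for almost every `x` if `q ∈ L²`; the value
at other points is irrelevant. -/
def fibreNorm (q : ℝ × ℝ → 𝕜) (x : ℝ) : ℝ := √(∫ t, ‖q (x, t)‖ ^ 2)

theorem memLp_fibre {q : ℝ × ℝ → 𝕜} (hq : StronglyMeasurable q) (h : MemLp q 2 cyl) :
    ∀ᵐ x ∂circ, MemLp (fun t => q (x, t)) 2 := by
  have hi := (memLp_two_iff_integrable_sq_norm h.1).1 h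
  rw [cyl_eq_circ_prod] at hi
  filter_upwards [hi.prod_right_ae] with x hx
  exact (memLp_two_iff_integrable_sq_norm (hq.comp_measurable
    measurable_prodMk_left).aestronglyMeasurable).2 hx

theorem memLp_fibreNorm {q : ℝ × ℝ → 𝕜} (hq : StronglyMeasurable q) (h : MemLp q 2 cyl) :
    MemLp (fibreNorm q) 2 circ := by
  have hi := (memLp_two_iff_integrable_sq_norm h.1).1 h
  rw [cyl_eq_circ_prod] at hi
  have hm : AEStronglyMeasurable (fibreNorm q) circ :=
    (Real.continuous_sqrt.comp_stronglyMeasurable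
      ((hq.norm.pow 2).integral_prod_right')).aestronglyMeasurable
  refine (memLp_two_iff_integrable_sq hm).2 (hi.integral_prod_left.congr (ae_of_all _ fun x => ?_))
  exact (Real.sq_sqrt (integral_nonneg fun t => by positivity)).symm

theorem norm_primY_le {q : ℝ × ℝ → 𝕜} {x : ℝ} (h : MemLp (fun t => q (x, t)) 2) (y : ℝ) :
    ‖primY q (x, y)‖ ≤ fibreNorm q x * √|y| := by
  have := norm_setIntegral_le_sqrt_mul h 0 y
  rwa [sub_zero] at this

theorem integrableOn_primY {q : ℝ × ℝ → 𝕜} (hq : StronglyMeasurable q) (h : MemLp q 2 cyl)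
    (R : ℝ) : IntegrableOn (primY q) (univ ×ˢ Icc (-R) R) cyl := by
  rw [IntegrableOn, cyl_restrict_eq]
  have hG : Integrable (fibreNorm q) circ := (memLp_fibreNorm hq h).integrable (by norm_num)
  have h1 : Integrable (fun z : ℝ × ℝ => fibreNorm q z.1 * √|R|)
      (circ.prod (volume.restrict (Icc (-R) R))) :=
    hG.mul_prod (integrable_const _)
  refine h1.mono' (stronglyMeasurable_primY hq).aestronglyMeasurable ?_
  rw [← cyl_restrict_eq]
  have h2 : ∀ᵐ z ∂cyl, MemLp (fun t => q (z.1, t)) 2 := by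
    rw [cyl_eq_circ_prod]
    exact Measure.quasiMeasurePreserving_fst.ae (memLp_fibre hq h)
  have hm : MeasurableSet (univ ×ˢ Icc (-R) R : Set (ℝ × ℝ)) :=
    MeasurableSet.univ.prod measurableSet_Icc
  filter_upwards [ae_restrict_of_ae h2, ae_restrict_mem hm] with z hz hz'
  refine (norm_primY_le hz z.2).trans ?_
  refine mul_le_mul_of_nonneg_left (Real.sqrt_le_sqrt ?_) (Real.sqrt_nonneg _)
  exact (abs_le.2 hz'.2).trans (le_abs_self R)

theorem integral_deriv_smul_primitive {β β' : ℝ → ℝ} (hβ : ∀ x, HasDerivAt β (β' x) x)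
    (hc : Continuous β') {R : ℝ} (hR : ∀ y, R < |y| → β y = 0) {f : ℝ → 𝕜} (hf : MemLp f 2) :
    ∫ y, β' y • ∫ t in (0 : ℝ)..y, f t = -∫ y, β y • f y := by
  set a := |R| + 1 with ha
  have ha0 : 0 < a := by positivity
  have hβa : ∀ t, a ≤ |t| → β t = 0 := fun t ht => hR t (by linarith [le_abs_self R])
  have hβ'a : ∀ t, a ≤ |t| → β' t = 0 := fun t ht => by
    refine (hβ t).unique ?_
    refine (hasDerivAt_const t (0 : ℝ)).congr_of_eventuallyEq ?_
    have : {s : ℝ | R < |s|} ∈ 𝓝 t :=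
      (isOpen_lt continuous_const continuous_abs).mem_nhds
        (show R < |t| by linarith [le_abs_self R])
    filter_upwards [this] with s hs using hR s hs
  have hout : ∀ t, t ∉ Ioc (-a) a → a ≤ |t| := fun t ht => by
    rw [mem_Ioc, not_and_or, not_lt, not_le] at ht
    rcases ht with ht | ht
    · exact le_abs.2 (Or.inr (by linarith))
    · exact le_abs.2 (Or.inl ht.le)
  have hfi : IntegrableOn f (Ioc (-a) a) := (hf.restrict _).integrable (by norm_num)
  have hii : ∀ u v, IntervalIntegrable f volume u v := fun u v => by
    rw [intervalIntegrable_iff]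
    have : IsFiniteMeasure (volume.restrict (uIoc u v)) := by
      rw [uIoc]
      infer_instance
    exact (hf.restrict _).integrable (by norm_num)
  have key := setIntegral_deriv_smul_primitive hβ hc hfi
  rw [hβa a (le_abs_self a), zero_smul, zero_sub] at key
  have e1 : ∫ y, β y • f y = ∫ y in Ioc (-a) a, β y • f y := by
    refine (setIntegral_eq_integral_of_forall_compl_eq_zero fun t ht => ?_).symm
    rw [hβa t (hout t ht), zero_smul]
  have e2 : ∫ y, β' y • ∫ t in (0 : ℝ)..y, f t =
      ∫ y in Ioc (-a) a, β' y • ∫ t in (0 : ℝ)..y, f t := by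
    refine (setIntegral_eq_integral_of_forall_compl_eq_zero fun t ht => ?_).symm
    rw [hβ'a t (hout t ht), zero_smul]
  have e3 : ∫ y in Ioc (-a) a, β' y = 0 := by
    rw [← intervalIntegral.integral_of_le (by linarith),
      intervalIntegral.integral_eq_sub_of_hasDerivAt (fun x _ => hβ x)
      (hc.intervalIntegrable _ _), hβa a (le_abs_self a),
      hβa (-a) (by rw [abs_neg]; exact le_abs_self a), sub_zero]
  rw [e1, e2, ← key]
  have e4 : ∫ y in Ioc (-a) a, β' y • ∫ t in (0 : ℝ)..y, f t =
      ∫ y in Ioc (-a) a, ((β' y • ∫ t in Ioc (-a) y, f t) - β' y • ∫ t in (-a)..0, f t) := by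
    refine setIntegral_congr_fun measurableSet_Ioc fun y hy => ?_
    have h1 := intervalIntegral.integral_add_adjacent_intervals (hii (-a) 0) (hii 0 y)
    rw [intervalIntegral.integral_of_le hy.1.le] at h1
    change β' y • _ = _
    rw [← h1, ← smul_sub, add_sub_cancel_left]
  have hβ'i : IntegrableOn β' (Ioc (-a) a) := hc.integrableOn_Icc.mono_set Ioc_subset_Icc_self
  rw [e4, integral_sub ?_ (hβ'i.smul_const _), integral_smul_const, e3, zero_smul, sub_zero]
  have hcont : ContinuousOn (fun y => β' y • ∫ t in Ioc (-a) y, f t) (Icc (-a) a) :=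
    hc.continuousOn.smul (intervalIntegral.continuousOn_primitive
      ((integrableOn_Icc_iff_integrableOn_Ioc).2 hfi))
  exact (hcont.integrableOn_compact isCompact_Icc).mono_set Ioc_subset_Icc_self

theorem isTest_mul {α β : ℝ → ℝ} (hα : ContDiff ℝ (⊤ : ℕ∞) α)
    (hp : Function.Periodic α (2 * Real.pi)) (hβ : ContDiff ℝ (⊤ : ℕ∞) β)
    (hc : ∃ R : ℝ, ∀ y, R < |y| → β y = 0) : IsTest fun z => α z.1 * β z.2 := by
  obtain ⟨R, hR⟩ := hc
  exact ⟨(hα.comp contDiff_fst).mul (hβ.comp contDiff_snd), fun x y => by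
    simp only [hp x], R, fun x y hy => by simp only [hR y hy, mul_zero]⟩

theorem dx_mul {α α' β : ℝ → ℝ} (hα : ∀ x, HasDerivAt α (α' x) x)
    (hβ : Differentiable ℝ β) (z : ℝ × ℝ) :
    dx (fun z => α z.1 * β z.2) z = α' z.1 * β z.2 := by
  have hd : Differentiable ℝ fun z : ℝ × ℝ => α z.1 * β z.2 :=
    (Differentiable.comp (fun x => (hα x).differentiableAt) differentiable_fst).mul
      (hβ.comp differentiable_snd)
  exact pd_x_eq hd ((hα z.1).mul_const (β z.2))

theorem dy_mul {α β β' : ℝ → ℝ} (hα : Differentiable ℝ α)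
    (hβ : ∀ x, HasDerivAt β (β' x) x) (z : ℝ × ℝ) :
    dy (fun z => α z.1 * β z.2) z = α z.1 * β' z.2 := by
  have hd : Differentiable ℝ fun z : ℝ × ℝ => α z.1 * β z.2 :=
    (hα.comp differentiable_fst).mul
      (Differentiable.comp (fun x => (hβ x).differentiableAt) differentiable_snd)
  exact pd_y_eq hd ((hβ z.2).const_mul (α z.1))

theorem integrable_isTest_smul {φ : ℝ × ℝ → ℝ} (hφ : IsTest φ) {ψ : ℝ × ℝ → 𝕜}
    (hψ : ∀ R : ℝ, IntegrableOn ψ (univ ×ˢ Icc (-R) R) cyl) :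
    Integrable (fun z => φ z • ψ z) cyl := by
  have := integrable_compactTest_mul (hφ.compactTest.clm (RCLike.ofRealCLM (K := 𝕜))) hψ
  simpa only [RCLike.real_smul_eq_coe_mul, RCLike.ofRealCLM_apply] using this

/-- A locally integrable function annihilated by the `y`-derivatives of product test functions does
not depend on `y`: it agrees with its average against any `η` of integral one. -/
theorem ae_eq_of_integral_deriv_eq_zero {r : ℝ × ℝ → 𝕜}
    (hr : ∀ R : ℝ, IntegrableOn r (univ ×ˢ Icc (-R) R) cyl)
    (h : ∀ α β β' : ℝ → ℝ, ContDiff ℝ (⊤ : ℕ∞) α → Function.Periodic α (2 * Real.pi) →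
      ContDiff ℝ (⊤ : ℕ∞) β → (∃ R : ℝ, ∀ y, R < |y| → β y = 0) →
      (∀ y, HasDerivAt β (β' y) y) → ∫ z, (α z.1 * β' z.2) • r z ∂cyl = 0)
    {η : ℝ → ℝ} (hη : ContDiff ℝ (⊤ : ℕ∞) η) (hηc : ∃ R : ℝ, ∀ y, R < |y| → η y = 0)
    (hη1 : ∫ y, η y = 1) :
    ∀ᵐ z ∂cyl, r z = ∫ y, η y • r (z.1, y) := by
  set s : ℝ → 𝕜 := fun x => ∫ y, η y • r (x, y) with hs
  have hηr : Integrable (fun z : ℝ × ℝ => η z.2 • r z) (circ.prod volume) := by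
    rw [← cyl_eq_circ_prod]
    simpa using integrable_isTest_smul (isTest_mul (α := fun _ => 1) contDiff_const
      (fun _ => rfl) hη hηc) hr
  have hsi : Integrable s circ := hηr.integral_prod_left
  have hsl : ∀ R : ℝ, IntegrableOn (fun z : ℝ × ℝ => s z.1) (univ ×ˢ Icc (-R) R) cyl := by
    intro R
    rw [IntegrableOn, cyl_restrict_eq]
    exact hsi.comp_fst _
  have key : ∀ α γ : ℝ → ℝ, ContDiff ℝ (⊤ : ℕ∞) α → Function.Periodic α (2 * Real.pi) →
      ContDiff ℝ (⊤ : ℕ∞) γ → (∃ R : ℝ, ∀ y, R < |y| → γ y = 0) →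
      ∫ z, (α z.1 * γ z.2) • (r z - s z.1) ∂cyl = 0 := by
    intro α γ hα hp hγ hγc
    have hint : ∀ {γ : ℝ → ℝ}, ContDiff ℝ (⊤ : ℕ∞) γ → (∃ R : ℝ, ∀ y, R < |y| → γ y = 0) →
        Integrable γ := by
      intro γ hγ hγc
      obtain ⟨R, hR⟩ := hγc
      refine hγ.continuous.integrable_of_hasCompactSupport
        (HasCompactSupport.of_support_subset_isCompact (isCompact_Icc (a := -R) (b := R)) ?_)
      intro y hy
      by_contra hy'
      exact hy (hR y (not_le.1 fun h => hy' (abs_le.1 h)))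
    set c := ∫ y, γ y with hc
    have hdiffc : ∃ R : ℝ, ∀ y, R < |y| → γ y - c * η y = 0 := by
      obtain ⟨R, hR⟩ := hγc
      obtain ⟨R', hR'⟩ := hηc
      exact ⟨max R R', fun y hy => by
        rw [hR y ((le_max_left _ _).trans_lt hy), hR' y ((le_max_right _ _).trans_lt hy)]
        simp⟩
    -- `γ - c η` has mean zero, hence is the derivative of a test function.
    obtain ⟨β, hβ, hβc, hβd⟩ := exists_primitive_of_compact
      (γ := fun y => γ y - c * η y) (hγ.sub (contDiff_const.mul hη)) hdiffc (by
        rw [integral_sub (hint hγ hγc) ((hint hη hηc).const_mul c), integral_const_mul, hη1,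
          mul_one, sub_self])
    have h1 := h α β _ hα hp hβ hβc hβd
    have hγr := integrable_isTest_smul (isTest_mul hα hp hγ hγc) hr
    have hγs := integrable_isTest_smul (isTest_mul hα hp hγ hγc) hsl
    have hηr' := integrable_isTest_smul (isTest_mul hα hp hη hηc) hr
    have e1 : ∫ z, (α z.1 * γ z.2) • r z ∂cyl = c • ∫ z, (α z.1 * η z.2) • r z ∂cyl := by
      have hcηr : Integrable (fun z => c • (α z.1 * η z.2) • r z) cyl := hηr'.smul c
      rw [← sub_eq_zero, ← integral_smul, ← integral_sub hγr hcηr, ← h1]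
      refine integral_congr_ae (ae_of_all _ fun z => ?_)
      simp only
      rw [smul_smul, ← sub_smul]
      congr 1
      ring
    have e2 : ∫ z, (α z.1 * η z.2) • r z ∂cyl = ∫ x, α x • s x ∂circ := by
      rw [cyl_eq_circ_prod] at hηr' ⊢
      rw [integral_prod _ hηr']
      simp only [mul_smul, integral_smul, hs]
    have e3 : ∫ z, (α z.1 * γ z.2) • s z.1 ∂cyl = c • ∫ x, α x • s x ∂circ := by
      rw [cyl_eq_circ_prod] at hγs ⊢
      rw [integral_prod _ hγs, ← integral_smul]
      refine integral_congr_ae (ae_of_all _ fun x => ?_)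
      simp only
      rw [integral_smul_const, integral_const_mul, mul_comm, mul_smul]
    simp only [smul_sub]
    rw [integral_sub hγr hγs, e1, e2, e3, sub_self]
  -- The cut-off makes the difference integrable; `cos x`, `sin x` and `arctan y` separate points.
  have hz : ∀ n : ℕ, ∀ᵐ z ∂cyl, cutoff n z • (r z - s z.1) = 0 := by
    intro n
    refine ae_eq_zero_of_separating_smul (μ := cyl) (S := Ioc 0 (2 * Real.pi) ×ˢ univ)
      measurableSet_strip
      (by rw [cyl, Measure.restrict_apply measurableSet_strip.compl, compl_inter_self,
        measure_empty])
      (![fun z => Real.cos z.1, fun z => Real.sin z.1, fun z => Real.arctan z.2 / 2] :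
        Fin 3 → ℝ × ℝ → ℝ)
      (fun i => ?_) (fun i z => ?_) (fun z hz w hw hzw => ?_)
      (integrable_isTest_smul (compactTest_cutoff n).isTest fun R => (hr R).sub (hsl R)) ?_
    · fin_cases i
      exacts [Real.measurable_cos.comp measurable_fst, Real.measurable_sin.comp measurable_fst,
        (Real.measurable_arctan.comp measurable_snd).div_const 2]
    · fin_cases i
      · exact ⟨Real.neg_one_le_cos _, Real.cos_le_one _⟩
      · exact ⟨Real.neg_one_le_sin _, Real.sin_le_one _⟩
      · have h1 := Real.arctan_lt_pi_div_two z.2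
        have h2 := Real.neg_pi_div_two_lt_arctan z.2
        have h3 := Real.pi_le_four
        change Real.arctan z.2 / 2 ∈ _
        exact ⟨by linarith, by linarith⟩
    · have h1 : Real.arctan z.2 / 2 = Real.arctan w.2 / 2 := hzw 2
      exact Prod.ext (eq_of_cos_eq_of_sin_eq hz.1 hw.1 (hzw 0) (hzw 1))
        (Real.arctan_injective (by linarith))
    · intro F hF
      have hF' : ∃ α γ : ℝ → ℝ, ContDiff ℝ (⊤ : ℕ∞) α ∧ Function.Periodic α (2 * Real.pi) ∧
          ContDiff ℝ (⊤ : ℕ∞) γ ∧ F = fun z => α z.1 * γ z.2 := by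
        induction hF using Submonoid.closure_induction with
        | mem F hF =>
          obtain ⟨i, rfl⟩ := hF
          fin_cases i
          · exact ⟨Real.cos, fun _ => 1, Real.contDiff_cos, Real.cos_periodic, contDiff_const, by
              simp⟩
          · exact ⟨Real.sin, fun _ => 1, Real.contDiff_sin, Real.sin_periodic, contDiff_const, by
              simp⟩
          · exact ⟨fun _ => 1, fun y => Real.arctan y / 2, contDiff_const, fun _ => rfl,
              Real.contDiff_arctan.div_const 2, by simp⟩
        | one => exact ⟨fun _ => 1, fun _ => 1, contDiff_const, fun _ => rfl, contDiff_const, by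
            funext z; simp⟩
        | mul F G _ _ hF hG =>
          obtain ⟨α, γ, h1, h2, h3, rfl⟩ := hF
          obtain ⟨α', γ', h1', h2', h3', rfl⟩ := hG
          refine ⟨fun x => α x * α' x, fun y => γ y * γ' y, h1.mul h1', fun x => ?_, h3.mul h3',
            ?_⟩
          · simp only [h2 x, h2' x]
          · funext z
            simp only [Pi.mul_apply]
            ring
      obtain ⟨α, γ, hα, hp, hγ, rfl⟩ := hF'
      obtain ⟨R, hR⟩ := (compactTest_cutoff n).compact
      have := key α (fun y => γ y * cutoff n (0, y)) hα hp
        (hγ.mul ((compactTest_cutoff n).smooth.comp (contDiff_const.prodMk contDiff_id)))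
        ⟨R, fun y hy => by rw [hR 0 y hy, mul_zero]⟩
      rw [← this]
      refine integral_congr_ae (ae_of_all _ fun z => ?_)
      simp only [smul_smul, mul_assoc]
      rfl
  filter_upwards [ae_all_iff.2 hz] with z hz
  obtain ⟨n, hn⟩ := (eventually_cutoff z).exists
  have := hz n
  rw [hn, one_smul, sub_eq_zero] at this
  exact this

/-- A function with square integrable weak gradient has a trace `r` on `y = 0`, from which it
deviates by `O(√|y|)` on almost every line `x = const`.  Removing the primitive in `y` of `∂_y χ`
leaves a function of `x` alone; it is square integrable because the average of `χ` over `y` has an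
integrable derivative and therefore is bounded. -/
theorem HasWeakGrad.exists_trace {χ p q : ℝ × ℝ → 𝕜} (h : HasWeakGrad χ p q) :
    ∃ (r : ℝ → 𝕜) (g : ℝ → ℝ), MemLp r 2 circ ∧ MemLp g 2 circ ∧
      ∀ᵐ z ∂cyl, ‖χ z - r z.1‖ ≤ g z.1 * √|z.2| := by
  obtain ⟨q', hq', hqq⟩ := h.memLp_y.1
  have hq2 : MemLp q' 2 cyl := h.memLp_y.ae_eq hqq
  set b : ContDiffBump (0 : ℝ) := ⟨1, 2, one_pos, one_lt_two⟩ with hb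
  set η : ℝ → ℝ := b.normed volume with hηdef
  have hη : ContDiff ℝ (⊤ : ℕ∞) η := b.contDiff_normed
  have hηR : ∀ y, 2 < |y| → η y = 0 := fun y hy => by
    rw [hηdef, ContDiffBump.normed_def, b.zero_of_le_dist, zero_div]
    rw [dist_zero_right]
    exact hy.le
  have hηc : ∃ R : ℝ, ∀ y, R < |y| → η y = 0 := ⟨2, hηR⟩
  have hη1 : ∫ y, η y = 1 := b.integral_normed
  have hη0 : ∀ y, 0 ≤ η y := b.nonneg_normed
  have hQl := integrableOn_primY hq' hq2
  set r : ℝ × ℝ → 𝕜 := fun z => χ z - primY q' z with hr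
  have hrl : ∀ R : ℝ, IntegrableOn r (univ ×ˢ Icc (-R) R) cyl := fun R =>
    (h.locInt R).sub (hQl R)
  set G := fibreNorm q' with hG
  have hGL : MemLp G 2 circ := memLp_fibreNorm hq' hq2
  have hfib := memLp_fibre hq' hq2
  have hkey := ae_eq_of_integral_deriv_eq_zero hrl (fun α β β' hα hp hβ hβc hβd => by
    have hβ' : ContDiff ℝ (⊤ : ℕ∞) β' := by
      have := (contDiff_infty_iff_deriv.1 hβ).2
      rwa [show deriv β = β' from funext fun x => (hβd x).deriv] at this
    have ht := isTest_mul hα hp hβ hβc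
    have hdy : ∀ z, dy (fun z => α z.1 * β z.2) z = α z.1 * β' z.2 :=
      dy_mul (hα.differentiable (by simp)) hβd
    have ht' : IsTest fun z => α z.1 * β' z.2 := by
      have := (ht.compactTest.pd (0, 1)).isTest
      rwa [show pd (0, 1) (fun z => α z.1 * β z.2) = fun z => α z.1 * β' z.2 from
        funext hdy] at this
    have h1 := h.weak_y _ ht
    simp only [hdy] at h1
    have h2 : ∫ z, (α z.1 * β' z.2) • primY q' z ∂cyl = -∫ z, (α z.1 * β z.2) • q z ∂cyl := by
      have i1 := integrable_isTest_smul ht' hQl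
      have i2 := integrable_isTest_smul ht (MemLp.integrableOn_cyl hq2)
      have e : ∫ z, (α z.1 * β z.2) • q z ∂cyl = ∫ z, (α z.1 * β z.2) • q' z ∂cyl := by
        refine integral_congr_ae ?_
        filter_upwards [hqq] with z hz
        rw [hz]
      rw [e]
      rw [cyl_eq_circ_prod] at i1 i2 ⊢
      rw [integral_prod _ i1, integral_prod _ i2, ← integral_neg]
      refine integral_congr_ae ?_
      filter_upwards [hfib] with x hx
      obtain ⟨R, hR⟩ := hβc
      have := integral_deriv_smul_primitive hβd hβ'.continuous hR hx
      simp only [mul_smul, integral_smul]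
      rw [← smul_neg, ← this]
      rfl
    simp only [hr, smul_sub]
    rw [integral_sub (integrable_isTest_smul ht' h.locInt) (integrable_isTest_smul ht' hQl), h1,
      h2, sub_self]) hη hηc hη1
  have hprod : ∀ {f : ℝ × ℝ → 𝕜}, (∀ R : ℝ, IntegrableOn f (univ ×ˢ Icc (-R) R) cyl) →
      ∀ {α : ℝ → ℝ}, ContDiff ℝ (⊤ : ℕ∞) α → Function.Periodic α (2 * Real.pi) →
        Integrable (fun z : ℝ × ℝ => (α z.1 * η z.2) • f z) (circ.prod volume) := by
    intro f hf α hα hp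
    rw [← cyl_eq_circ_prod]
    exact integrable_isTest_smul (isTest_mul hα hp hη hηc) hf
  have hprod1 : ∀ {f : ℝ × ℝ → 𝕜}, (∀ R : ℝ, IntegrableOn f (univ ×ˢ Icc (-R) R) cyl) →
      Integrable (fun z : ℝ × ℝ => η z.2 • f z) (circ.prod volume) := by
    intro f hf
    simpa using hprod hf (α := fun _ => 1) contDiff_const fun _ => rfl
  have hpl := MemLp.integrableOn_cyl h.memLp_x
  obtain ⟨C, hC⟩ := exists_bound_of_weak_deriv (e := fun x => ∫ y, η y • χ (x, y))
    (P := fun x => ∫ y, η y • p (x, y)) (hprod1 h.locInt).integral_prod_left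
    (hprod1 hpl).integral_prod_left (by
      intro α a hα hp hd
      have ha : ContDiff ℝ (⊤ : ℕ∞) a := by
        have := (contDiff_infty_iff_deriv.1 hα).2
        rwa [show deriv α = a from funext fun x => (hd x).deriv] at this
      have hap : Function.Periodic a (2 * Real.pi) := fun x => by
        have h1 := (hd (x + 2 * Real.pi)).comp_add_const x (2 * Real.pi)
        rw [show (fun x => α (x + 2 * Real.pi)) = α from funext hp] at h1
        exact h1.unique (hd x)
      have h1 := h.weak_x _ (isTest_mul hα hp hη hηc)
      have hdx := dx_mul hd (hη.differentiable (by simp))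
      simp only [hdx] at h1
      have i1 := hprod h.locInt ha hap
      have i2 := hprod hpl hα hp
      rw [cyl_eq_circ_prod, integral_prod _ i1, integral_prod _ i2] at h1
      simp only [mul_smul, integral_smul] at h1
      exact h1)
  have hri := (hprod1 hrl).integral_prod_left
  have hηi : Integrable fun y => η y * √|y| := by
    refine Continuous.integrable_of_hasCompactSupport
      (hη.continuous.mul (Real.continuous_sqrt.comp continuous_abs))
      (HasCompactSupport.of_support_subset_isCompact (isCompact_Icc (a := (-2 : ℝ)) (b := 2)) ?_)
    intro y hy
    by_contra hy'
    exact hy (by simp only [hηR y (not_le.1 fun h => hy' (abs_le.1 h)), zero_mul])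
  refine ⟨fun x => ∫ y, η y • r (x, y), G, ?_, hGL, ?_⟩
  · have hdom : MemLp (fun x => C + G x * ∫ y, η y * √|y|) 2 circ :=
      (memLp_const C).add (hGL.mul_const _)
    refine hdom.mono' hri.aestronglyMeasurable ?_
    have hχx := (hprod1 h.locInt).prod_right_ae
    have hQx := (hprod1 hQl).prod_right_ae
    filter_upwards [hC, hfib, hχx, hQx] with x h1 h2 h3 h4
    have e : ∫ y, η y • r (x, y) = (∫ y, η y • χ (x, y)) - ∫ y, η y • primY q' (x, y) := by
      simp only [hr, smul_sub]
      exact integral_sub h3 h4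
    rw [e]
    refine (norm_sub_le _ _).trans (add_le_add h1 ?_)
    rw [← integral_const_mul]
    refine norm_integral_le_of_norm_le (hηi.const_mul _) (ae_of_all _ fun y => ?_)
    rw [norm_smul, Real.norm_of_nonneg (hη0 y), mul_left_comm]
    exact mul_le_mul_of_nonneg_left (norm_primY_le h2 y) (hη0 y)
  · have h2 : ∀ᵐ z ∂cyl, MemLp (fun t => q' (z.1, t)) 2 := by
      rw [cyl_eq_circ_prod]
      exact Measure.quasiMeasurePreserving_fst.ae hfib
    filter_upwards [hkey, h2] with z hz hz'
    rw [← hz, hr]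
    simp only [sub_sub_cancel]
    exact norm_primY_le hz' z.2

end Trace

section TraceConsequences

variable {𝕜 : Type*} [RCLike 𝕜] {χ p q : ℝ × ℝ → 𝕜}

theorem aestronglyMeasurable_of_locInt
    (h : ∀ R : ℝ, IntegrableOn χ (univ ×ˢ Icc (-R) R) cyl) : AEStronglyMeasurable χ cyl := by
  have hu : (⋃ n : ℕ, (univ ×ˢ Icc (-(n : ℝ)) n : Set (ℝ × ℝ))) = univ := by
    refine eq_univ_of_forall fun z => ?_
    obtain ⟨n, hn⟩ := exists_nat_ge |z.2|
    exact mem_iUnion.2 ⟨n, mem_univ _, abs_le.1 hn⟩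
  rw [← Measure.restrict_univ (μ := cyl), ← hu]
  exact AEStronglyMeasurable.iUnion fun n => (h n).aestronglyMeasurable

namespace HasWeakGrad

variable {ε : ℝ} (h0 : 0 ≤ ε) (h1 : ε < 1) (h : HasWeakGrad χ p q)
include h0 h1 h

/-- Growth of order `√|y|` is compensated by the exponential decay of the weight. -/
theorem integrable_inv_den_mul_norm_sq :
    Integrable (fun z => 1 / den ε z * ‖χ z‖ ^ 2) cyl := by
  obtain ⟨r, g, hr, hg, hrg⟩ := h.exists_trace
  have hm := aestronglyMeasurable_of_locInt h.locInt
  have hd1 : 0 < 1 - ε := by linarith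
  have hri := (memLp_two_iff_integrable_sq_norm hr.1).1 hr
  have hgi := (memLp_two_iff_integrable_sq_norm hg.1).1 hg
  have hdom : Integrable (fun z : ℝ × ℝ => (2 * (1 - ε)⁻¹ * (‖r z.1‖ ^ 2 + ‖g z.1‖ ^ 2)) *
      ((1 + |z.2|) / Real.cosh z.2)) cyl := by
    rw [cyl_eq_circ_prod]
    exact ((hri.add hgi).const_mul (2 * (1 - ε)⁻¹)).mul_prod integrable_one_add_abs_div_cosh
  refine hdom.mono' ?_ ?_
  · exact (continuous_const.div contDiff_den.continuous
      fun z => (den_pos h0 h1 z).ne').aestronglyMeasurable.mul (hm.norm.pow 2)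
  · filter_upwards [hrg] with z hz
    have hd := den_pos h0 h1 z
    have hc := Real.cosh_pos z.2
    have e1 : ‖χ z‖ ≤ ‖r z.1‖ + ‖g z.1‖ * √|z.2| := by
      have e := norm_add_le (χ z - r z.1) (r z.1)
      rw [sub_add_cancel] at e
      have e' : g z.1 * √|z.2| ≤ ‖g z.1‖ * √|z.2| :=
        mul_le_mul_of_nonneg_right (le_abs_self _) (Real.sqrt_nonneg _)
      linarith
    have e2 : ‖χ z‖ ^ 2 ≤ 2 * (‖r z.1‖ ^ 2 + ‖g z.1‖ ^ 2) * (1 + |z.2|) := by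
      have hs := Real.sq_sqrt (abs_nonneg z.2)
      have hsq : ‖χ z‖ ^ 2 ≤ (‖r z.1‖ + ‖g z.1‖ * √|z.2|) ^ 2 := by gcongr
      have hy := abs_nonneg z.2
      have hmul : (‖r z.1‖ + ‖g z.1‖ * √|z.2|) ^ 2 ≤
          2 * (‖r z.1‖ ^ 2 + ‖g z.1‖ ^ 2 * |z.2|) := by
        have := sq_nonneg (‖r z.1‖ - ‖g z.1‖ * √|z.2|)
        nlinarith
      have h3 : 0 ≤ ‖r z.1‖ ^ 2 * |z.2| := by positivity
      have h4 := sq_nonneg ‖g z.1‖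
      linarith
    rw [Real.norm_of_nonneg (by positivity)]
    have e3 : 1 / den ε z ≤ (1 - ε)⁻¹ * (1 / Real.cosh z.2) := by
      rw [inv_mul_eq_div, div_div, mul_comm (Real.cosh _)]
      exact div_le_div_of_nonneg_left zero_le_one (mul_pos hd1 hc) (mul_cosh_le_den h0 z)
    calc 1 / den ε z * ‖χ z‖ ^ 2
        ≤ (1 - ε)⁻¹ * (1 / Real.cosh z.2) *
          (2 * (‖r z.1‖ ^ 2 + ‖g z.1‖ ^ 2) * (1 + |z.2|)) := by gcongr
      _ = _ := by ring

theorem integrable_inv_den_smul : Integrable (fun z => (1 / den ε z) • χ z) cyl := by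
  have hm := aestronglyMeasurable_of_locInt h.locInt
  refine ((integrable_inv_den h0 h1).add (h.integrable_inv_den_mul_norm_sq h0 h1)).mono' ?_
    (ae_of_all _ fun z => ?_)
  · exact (continuous_const.div contDiff_den.continuous
      fun z => (den_pos h0 h1 z).ne').aestronglyMeasurable.smul hm
  · have hd := den_pos h0 h1 z
    rw [norm_smul, Real.norm_of_nonneg (by positivity : 0 ≤ 1 / den ε z), Pi.add_apply]
    have : ‖χ z‖ ≤ 1 + ‖χ z‖ ^ 2 := by nlinarith [sq_nonneg (‖χ z‖ - 1), norm_nonneg (χ z)]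
    calc 1 / den ε z * ‖χ z‖ ≤ 1 / den ε z * (1 + ‖χ z‖ ^ 2) := by gcongr
      _ = _ := by ring

theorem integrable_gp_mul_norm_sq : Integrable (fun z => gp ε z * ‖χ z‖ ^ 2) cyl := by
  have hm := aestronglyMeasurable_of_locInt h.locInt
  refine ((h.integrable_inv_den_mul_norm_sq h0 h1).const_mul (2 * (1 + ε))).mono' ?_
    (ae_of_all _ fun z => ?_)
  · exact (continuous_gp h0 h1).aestronglyMeasurable.mul (hm.norm.pow 2)
  · have hg := gp_pos ε z
    rw [Real.norm_of_nonneg (by positivity), ← mul_assoc]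
    refine mul_le_mul_of_nonneg_right ?_ (by positivity)
    rw [gp_eq h0 h1]
    linarith [rho_le h0 h1 z]

/-- Subtracting a constant normalizes the trace, because averages over `|y| ≤ δ` deviate from the
average of the trace by `O(√δ)`. -/
theorem exists_traceZero_sub_const : ∃ c : 𝕜, TraceZero ε fun z => χ z - c := by
  obtain ⟨r, g, hr, hg, hrg⟩ := h.exists_trace
  have hd1 : 0 < 1 - ε := by linarith
  set w : ℝ → ℝ := fun x => (1 + ε * Real.cos x)⁻¹ with hw
  have hwle : ∀ x, 1 - ε ≤ 1 + ε * Real.cos x := fun x => by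
    nlinarith [Real.neg_one_le_cos x]
  have hwpos : ∀ x, 0 < w x := fun x => inv_pos.2 (hd1.trans_le (hwle x))
  have hwb : ∀ x, w x ≤ (1 - ε)⁻¹ := fun x => by
    have := hwle x
    simp only [hw]
    gcongr
  have hwc : Continuous w :=
    (continuous_const.add (continuous_const.mul Real.continuous_cos)).inv₀
      fun x => (hd1.trans_le (hwle x)).ne'
  have hwi : Integrable w circ :=
    (hwc.integrableOn_Icc (a := 0) (b := 2 * Real.pi)).mono_set Ioc_subset_Icc_self
  have hri : Integrable r circ := hr.integrable (by norm_num)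
  have hgi : Integrable g circ := hg.integrable (by norm_num)
  have hwn : ∀ x, ‖w x‖ ≤ (1 - ε)⁻¹ := fun x => by
    rw [Real.norm_of_nonneg (hwpos x).le]
    exact hwb x
  have hwr : Integrable (fun x => w x • r x) circ :=
    hri.bdd_smul _ hwc.aestronglyMeasurable (ae_of_all _ hwn)
  have hW : 0 < ∫ x, w x ∂circ := by
    refine (integral_pos_iff_support_of_nonneg (fun x => (hwpos x).le) hwi).2 ?_
    rw [show Function.support w = univ from eq_univ_of_forall fun x => (hwpos x).ne', circ,
      Measure.restrict_apply_univ, Real.volume_Ioc, sub_zero]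
    exact ENNReal.ofReal_pos.2 (by positivity)
  -- The average of the trace `r`, weighted as in the normalization.
  set c : 𝕜 := (∫ x, w x ∂circ)⁻¹ • ∫ x, w x • r x ∂circ with hc
  refine ⟨c, ?_⟩
  have hbound : Tendsto (fun δ : ℝ => (1 - ε)⁻¹ * (∫ x, ‖g x‖ ∂circ) * √δ) (𝓝[>] 0) (𝓝 0) := by
    have : Tendsto (fun δ : ℝ => (1 - ε)⁻¹ * (∫ x, ‖g x‖ ∂circ) * √δ) (𝓝 0)
        (𝓝 ((1 - ε)⁻¹ * (∫ x, ‖g x‖ ∂circ) * √0)) :=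
      (continuous_const.mul Real.continuous_sqrt).tendsto 0
    rw [Real.sqrt_zero, mul_zero] at this
    exact this.mono_left nhdsWithin_le_nhds
  refine squeeze_zero_norm' ?_ hbound
  filter_upwards [self_mem_nhdsWithin] with δ hδ
  rw [mem_Ioi] at hδ
  have hm : MeasurableSet (univ ×ˢ Icc (-δ) δ : Set (ℝ × ℝ)) :=
    MeasurableSet.univ.prod measurableSet_Icc
  have hvol : ∫ _ in Icc (-δ) δ, (1 : ℝ) = 2 * δ := by
    rw [integral_const, smul_eq_mul, mul_one, measureReal_restrict_apply_univ,
      Real.volume_real_Icc_of_le (by linarith)]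
    ring
  have hfin := isFiniteMeasure_cyl_restrict δ
  have i1 : IntegrableOn (fun z : ℝ × ℝ => w z.1 • (χ z - c)) (univ ×ˢ Icc (-δ) δ) cyl :=
    Integrable.bdd_smul ((h.locInt δ).sub (integrable_const c)) _
      (hwc.comp continuous_fst).aestronglyMeasurable (ae_of_all _ fun z => hwn z.1)
  have i2 : IntegrableOn (fun z : ℝ × ℝ => w z.1 • (r z.1 - c)) (univ ×ˢ Icc (-δ) δ) cyl := by
    rw [IntegrableOn, cyl_restrict_eq]
    refine Integrable.bdd_smul ((hri.comp_fst _).sub (integrable_const c)) _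
      (hwc.comp continuous_fst).aestronglyMeasurable (ae_of_all _ fun z => hwn z.1)
  have e0 : ∫ x, w x • (r x - c) ∂circ = 0 := by
    simp only [smul_sub]
    rw [integral_sub hwr (hwi.smul_const c), integral_smul_const, hc, smul_smul,
      mul_inv_cancel₀ hW.ne', one_smul, sub_self]
  have e1 : ∫ z in univ ×ˢ Icc (-δ) δ, w z.1 • (r z.1 - c) ∂cyl = 0 := by
    rw [cyl_restrict_eq]
    have i2' := i2
    rw [IntegrableOn, cyl_restrict_eq] at i2'
    rw [integral_prod_symm _ i2']
    simp only [e0, integral_zero]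
  have e2 : ∫ z in univ ×ˢ Icc (-δ) δ, w z.1 • (χ z - c) ∂cyl =
      ∫ z in univ ×ˢ Icc (-δ) δ, w z.1 • (χ z - r z.1) ∂cyl := by
    rw [← sub_zero (∫ z in univ ×ˢ Icc (-δ) δ, w z.1 • (χ z - c) ∂cyl), ← e1,
      ← integral_sub i1 i2]
    refine integral_congr_ae (ae_of_all _ fun z => ?_)
    simp only
    rw [← smul_sub, sub_sub_sub_cancel_right]
  have i3 : Integrable (fun z : ℝ × ℝ => ((1 - ε)⁻¹ * √δ * ‖g z.1‖) * 1)
      (circ.prod (volume.restrict (Icc (-δ) δ))) :=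
    (hgi.norm.const_mul _).mul_prod (integrable_const 1)
  have e3 : ‖∫ z in univ ×ˢ Icc (-δ) δ, w z.1 • (χ z - r z.1) ∂cyl‖ ≤
      (1 - ε)⁻¹ * √δ * (∫ x, ‖g x‖ ∂circ) * (2 * δ) := by
    have e4 : ∫ z : ℝ × ℝ, ((1 - ε)⁻¹ * √δ * ‖g z.1‖) * 1
        ∂(circ.prod (volume.restrict (Icc (-δ) δ))) =
        (1 - ε)⁻¹ * √δ * (∫ x, ‖g x‖ ∂circ) * (2 * δ) := by
      rw [integral_prod_mul (fun x => (1 - ε)⁻¹ * √δ * ‖g x‖) (fun _ : ℝ => (1 : ℝ)), hvol,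
        integral_const_mul]
    rw [← e4, ← cyl_restrict_eq]
    rw [← cyl_restrict_eq] at i3
    refine norm_integral_le_of_norm_le i3 ?_
    filter_upwards [ae_restrict_of_ae hrg, ae_restrict_mem hm] with z hz hz'
    rw [norm_smul, mul_one, mul_assoc]
    refine mul_le_mul (hwn _) (hz.trans ?_) (norm_nonneg _) (inv_nonneg.2 hd1.le)
    rw [mul_comm]
    have e5 : √|z.2| ≤ √δ := Real.sqrt_le_sqrt (abs_le.2 hz'.2)
    calc √|z.2| * g z.1 ≤ √|z.2| * ‖g z.1‖ :=
          mul_le_mul_of_nonneg_left (le_abs_self _) (Real.sqrt_nonneg _)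
      _ ≤ _ := mul_le_mul_of_nonneg_right e5 (norm_nonneg _)
  have e6 : (fun z : ℝ × ℝ => (1 + ε * Real.cos z.1)⁻¹ • (χ z - c)) =
      fun z => w z.1 • (χ z - c) := rfl
  rw [e6, e2, norm_smul, Real.norm_of_nonneg (by positivity : (0 : ℝ) ≤ (2 * δ)⁻¹),
    inv_mul_le_iff₀ (by positivity)]
  linarith

theorem exists_inStreamSpace : ∃ c : 𝕜, InStreamSpace ε (fun z => χ z - c) p q := by
  obtain ⟨c, hc⟩ := h.exists_traceZero_sub_const h0 h1
  exact ⟨c, h.sub_const c, hc⟩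

end HasWeakGrad

end TraceConsequences

/-! ### The Hilbert space `L²(Ω, dx dy / g'(ψ_ε))` -/

section Hilbert

variable {𝕜 : Type*} [RCLike 𝕜] {ε : ℝ}

theorem weighted_eq (ε : ℝ) :
    weighted ε = cyl.withDensity fun z => ((Real.toNNReal (gp ε z)⁻¹ : NNReal) : ℝ≥0∞) := by
  simp only [weighted, one_div]
  rfl

theorem measurable_inv_gp (ε : ℝ) : Measurable fun z => Real.toNNReal (gp ε z)⁻¹ :=
  (measurable_gp ε).inv.real_toNNReal

theorem integral_weighted {E : Type*} [NormedAddCommGroup E] [NormedSpace ℝ E] (f : ℝ × ℝ → E) :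
    ∫ z, f z ∂weighted ε = ∫ z, (gp ε z)⁻¹ • f z ∂cyl := by
  rw [weighted_eq, integral_withDensity_eq_integral_smul (measurable_inv_gp ε)]
  refine integral_congr_ae (ae_of_all _ fun z => ?_)
  simp only [NNReal.smul_def, Real.coe_toNNReal _ (inv_nonneg.2 (gp_pos ε z).le)]

theorem integrable_weighted_iff {E : Type*} [NormedAddCommGroup E] [NormedSpace ℝ E]
    {f : ℝ × ℝ → E} :
    Integrable f (weighted ε) ↔ Integrable (fun z => (gp ε z)⁻¹ • f z) cyl := by
  rw [weighted_eq, integrable_withDensity_iff_integrable_smul (measurable_inv_gp ε)]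
  simp only [NNReal.smul_def, Real.coe_toNNReal _ (inv_nonneg.2 (gp_pos ε _).le)]

theorem weighted_ac_cyl (ε : ℝ) : weighted ε ≪ cyl := withDensity_absolutelyContinuous _ _

theorem ae_weighted_iff {p : ℝ × ℝ → Prop} : (∀ᵐ z ∂weighted ε, p z) ↔ ∀ᵐ z ∂cyl, p z :=
  ⟨fun h => (cyl_ac_weighted ε).ae_le h, fun h => (weighted_ac_cyl ε).ae_le h⟩

theorem Lp_weighted_ext {u v : Lp 𝕜 2 (weighted ε)} (h : ∀ᵐ z ∂cyl, u z = v z) : u = v :=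
  Lp.ext (ae_weighted_iff.2 h)

/-- `F` is square integrable for `g'(ψ_ε) dx dy`, so that `g'(ψ_ε) F` belongs to
`L²(Ω, dx dy / g'(ψ_ε))`. -/
structure WeightedSq (ε : ℝ) (F : ℝ × ℝ → 𝕜) : Prop where
  meas : AEStronglyMeasurable F cyl
  int : Integrable (fun z => gp ε z * ‖F z‖ ^ 2) cyl

theorem WeightedSq.memLp {F : ℝ × ℝ → 𝕜} (h : WeightedSq ε F) :
    MemLp (fun z => gp ε z • F z) 2 (weighted ε) := by
  have hm : AEStronglyMeasurable (fun z => gp ε z • F z) (weighted ε) :=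
    ((measurable_gp ε).aestronglyMeasurable.smul h.meas).mono_ac (weighted_ac_cyl ε)
  refine (memLp_two_iff_integrable_sq_norm hm).2 ?_
  rw [integrable_weighted_iff]
  refine h.int.congr (ae_of_all _ fun z => ?_)
  have hg := gp_pos ε z
  simp only [norm_smul, Real.norm_of_nonneg hg.le, smul_eq_mul]
  field_simp

/-- The class of `g'(ψ_ε) F`. -/
def gpClass {F : ℝ × ℝ → 𝕜} (h : WeightedSq ε F) : Lp 𝕜 2 (weighted ε) := h.memLp.toLp _

theorem coeFn_gpClass {F : ℝ × ℝ → 𝕜} (h : WeightedSq ε F) :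
    ∀ᵐ z ∂cyl, gpClass h z = gp ε z • F z := ae_weighted_iff.1 h.memLp.coeFn_toLp

theorem inner_eq_integral (u v : Lp 𝕜 2 (weighted ε)) :
    inner 𝕜 u v = ∫ z, (gp ε z)⁻¹ • (v z * (starRingEnd 𝕜) (u z)) ∂cyl := by
  rw [L2.inner_def, integral_weighted]
  rfl

theorem integrable_inner_cyl (u v : Lp 𝕜 2 (weighted ε)) :
    Integrable (fun z => (gp ε z)⁻¹ • (v z * (starRingEnd 𝕜) (u z))) cyl :=
  integrable_weighted_iff.1 (L2.integrable_inner (𝕜 := 𝕜) u v)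

theorem inv_gp_smul_mul_conj {F : ℝ × ℝ → 𝕜} (h : WeightedSq ε F) (v : ℝ × ℝ → 𝕜) :
    ∀ᵐ z ∂cyl, (gp ε z)⁻¹ • (v z * (starRingEnd 𝕜) (gpClass h z)) =
      v z * (starRingEnd 𝕜) (F z) := by
  filter_upwards [coeFn_gpClass h] with z hz
  rw [hz, RCLike.real_smul_eq_coe_mul, RCLike.real_smul_eq_coe_mul, map_mul, RCLike.conj_ofReal]
  have hg : ((gp ε z : ℝ) : 𝕜) ≠ 0 := by exact_mod_cast (gp_pos ε z).ne'
  push_cast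
  field_simp

theorem integrable_mul_conj {F : ℝ × ℝ → 𝕜} (h : WeightedSq ε F) (v : Lp 𝕜 2 (weighted ε)) :
    Integrable (fun z => v z * (starRingEnd 𝕜) (F z)) cyl :=
  (integrable_inner_cyl (gpClass h) v).congr (inv_gp_smul_mul_conj h v)

theorem inner_gpClass {F : ℝ × ℝ → 𝕜} (h : WeightedSq ε F) (v : Lp 𝕜 2 (weighted ε)) :
    inner 𝕜 (gpClass h) v = ∫ z, v z * (starRingEnd 𝕜) (F z) ∂cyl := by
  rw [inner_eq_integral]
  exact integral_congr_ae (inv_gp_smul_mul_conj h v)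

theorem inner_gpClass_gpClass {F G : ℝ × ℝ → 𝕜} (hF : WeightedSq ε F) (hG : WeightedSq ε G) :
    inner 𝕜 (gpClass hF) (gpClass hG) = ∫ z, gp ε z • (G z * (starRingEnd 𝕜) (F z)) ∂cyl := by
  rw [inner_gpClass]
  refine integral_congr_ae ?_
  filter_upwards [coeFn_gpClass hG] with z hz
  rw [hz, smul_mul_assoc]

theorem WeightedSq.conj {F : ℝ × ℝ → 𝕜} (h : WeightedSq ε F) :
    WeightedSq ε fun z => (starRingEnd 𝕜) (F z) :=
  ⟨RCLike.continuous_conj.comp_aestronglyMeasurable h.meas, by simpa using h.int⟩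

theorem weightedSq_of_bounded (h0 : 0 ≤ ε) (h1 : ε < 1) {F : ℝ × ℝ → 𝕜}
    (hF : AEStronglyMeasurable F cyl) {C : ℝ} (hC : ∀ z, ‖F z‖ ≤ C) : WeightedSq ε F := by
  refine ⟨hF, ((integrable_gp h0 h1).mul_const (C ^ 2)).mono'
    ((measurable_gp ε).aestronglyMeasurable.mul (hF.norm.pow 2)) (ae_of_all _ fun z => ?_)⟩
  have hg := gp_pos ε z
  have := hC z
  rw [Real.norm_of_nonneg (by positivity)]
  gcongr

theorem HasWeakGrad.weightedSq (h0 : 0 ≤ ε) (h1 : ε < 1) {χ p q : ℝ × ℝ → 𝕜}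
    (h : HasWeakGrad χ p q) : WeightedSq ε χ :=
  ⟨aestronglyMeasurable_of_locInt h.locInt, h.integrable_gp_mul_norm_sq h0 h1⟩

/-- Integrability is automatic in the weighted space, because `g'(ψ_ε)` is integrable. -/
theorem integrable_Lp_weighted (h0 : 0 ≤ ε) (h1 : ε < 1) (v : Lp 𝕜 2 (weighted ε)) :
    Integrable v cyl := by
  have h := integrable_mul_conj (weightedSq_of_bounded h0 h1 (F := fun _ : ℝ × ℝ => (1 : 𝕜))
    aestronglyMeasurable_const (C := 1) fun _ => by simp) v
  simpa using h

end Hilbert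

/-! ### Polynomials on the sphere in the Hilbert space -/

section Model

variable (𝕜 : Type*) [RCLike 𝕜]

/-- Polynomials of arbitrary degree in the sphere coordinates. -/
def SphPol (ε : ℝ) : Submodule 𝕜 (ℝ × ℝ → 𝕜) where
  carrier := {F | ∃ n, F ∈ Pol 𝕜 ε n}
  zero_mem' := ⟨0, Submodule.zero_mem _⟩
  add_mem' := by
    rintro F G ⟨n, hF⟩ ⟨m, hG⟩
    exact ⟨max n m, Submodule.add_mem _ (Pol_mono (le_max_left n m) hF)
      (Pol_mono (le_max_right n m) hG)⟩
  smul_mem' := by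
    rintro c F ⟨n, hF⟩
    exact ⟨n, Submodule.smul_mem _ c hF⟩

variable {𝕜} {ε : ℝ} (h0 : 0 ≤ ε) (h1 : ε < 1)

theorem Pol_le_SphPol (n : ℕ) : Pol 𝕜 ε n ≤ SphPol 𝕜 ε := fun _ hF => ⟨n, hF⟩

include h0 h1

theorem smoothPer_SphPol (F : SphPol 𝕜 ε) : SmoothPer (F : ℝ × ℝ → 𝕜) := by
  obtain ⟨n, hF⟩ := F.2
  exact smoothPer_Pol h0 h1 n _ hF

theorem weightedSq_SphPol (F : SphPol 𝕜 ε) : WeightedSq ε (F : ℝ × ℝ → 𝕜) := by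
  obtain ⟨n, hF⟩ := F.2
  obtain ⟨C, -, hC⟩ := bound_Pol h0 h1 n _ hF
  exact weightedSq_of_bounded h0 h1 (smoothPer_SphPol h0 h1 F).smooth.continuous.aestronglyMeasurable
    fun z => (hC z).1

/-- The embedding `F ↦ g'(ψ_ε) F` of the polynomials into the space of vorticities. -/
def polEmb : SphPol 𝕜 ε →ₗ[𝕜] Lp 𝕜 2 (weighted ε) where
  toFun F := gpClass (weightedSq_SphPol h0 h1 F)
  map_add' F G := by
    refine Lp_weighted_ext ?_
    filter_upwards [coeFn_gpClass (weightedSq_SphPol h0 h1 F),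
      coeFn_gpClass (weightedSq_SphPol h0 h1 G), coeFn_gpClass (weightedSq_SphPol h0 h1 (F + G)),
      ae_weighted_iff.1 (Lp.coeFn_add (gpClass (weightedSq_SphPol h0 h1 F))
        (gpClass (weightedSq_SphPol h0 h1 G)))] with z e1 e2 e3 e4
    rw [e4, Pi.add_apply, e1, e2, e3, ← smul_add]
    rfl
  map_smul' c F := by
    refine Lp_weighted_ext ?_
    filter_upwards [coeFn_gpClass (weightedSq_SphPol h0 h1 F),
      coeFn_gpClass (weightedSq_SphPol h0 h1 (c • F)),
      ae_weighted_iff.1 (Lp.coeFn_smul c (gpClass (weightedSq_SphPol h0 h1 F)))] with z e1 e2 e3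
    rw [RingHom.id_apply, e3, Pi.smul_apply, e1, e2, smul_comm]
    rfl

/-- The transport operator `u_ε · ∇` on polynomials. -/
def polT : SphPol 𝕜 ε →ₗ[𝕜] SphPol 𝕜 ε where
  toFun F := ⟨transport ε F, by
    obtain ⟨n, hF⟩ := F.2
    exact ⟨n + 1, transport_mem_Pol h0 h1 n _ hF⟩⟩
  map_add' F G := by
    refine Subtype.ext (funext fun z => ?_)
    have e := fun v => pd_add v ((smoothPer_SphPol h0 h1 F).differentiable z)
      ((smoothPer_SphPol h0 h1 G).differentiable z)
    change transport ε (fun w => (F : ℝ × ℝ → 𝕜) w + (G : ℝ × ℝ → 𝕜) w) z =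
      transport ε F z + transport ε G z
    simp only [transport, e, smul_add]
    abel
  map_smul' c F := by
    refine Subtype.ext (funext fun z => ?_)
    have e := fun v => pd_clm (ContinuousLinearMap.mul ℝ 𝕜 c) v
      ((smoothPer_SphPol h0 h1 F).differentiable z)
    simp only [ContinuousLinearMap.mul_apply'] at e
    change transport ε (fun w => c * (F : ℝ × ℝ → 𝕜) w) z = c * transport ε F z
    simp only [transport, e, mul_add, mul_smul_comm]

omit h0 h1 in
theorem lap_add {F G : ℝ × ℝ → 𝕜} (hF : SmoothPer F) (hG : SmoothPer G) (z : ℝ × ℝ) :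
    lap (fun w => F w + G w) z = lap F z + lap G z := by
  have e : ∀ v, pd v (fun w => F w + G w) = fun w => pd v F w + pd v G w := fun v =>
    funext fun w => pd_add v (hF.differentiable w) (hG.differentiable w)
  simp only [lap, e]
  rw [pd_add _ ((hF.pd _).differentiable z) ((hG.pd _).differentiable z),
    pd_add _ ((hF.pd _).differentiable z) ((hG.pd _).differentiable z)]
  abel

omit h0 h1 in
theorem lap_clm {E' : Type*} [NormedAddCommGroup E'] [NormedSpace ℝ E'] (L : 𝕜 →L[ℝ] E')
    {F : ℝ × ℝ → 𝕜} (hF : SmoothPer F) (z : ℝ × ℝ) :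
    lap (fun w => L (F w)) z = L (lap F z) := by
  have e : ∀ v, pd v (fun w => L (F w)) = fun w => L (pd v F w) := fun v =>
    funext fun w => pd_clm L v (hF.differentiable w)
  simp only [lap, e, map_add]
  rw [pd_clm L _ ((hF.pd _).differentiable z), pd_clm L _ ((hF.pd _).differentiable z)]

/-- `-Δ / g'(ψ_ε)` is half the Laplacian of the sphere, with diagonal entries `n (n + 1) / 2`. -/
theorem neg_inv_gp_smul_lap_mem {n : ℕ} {F : ℝ × ℝ → 𝕜} (hF : F ∈ Pol 𝕜 ε (n + 1)) :
    ∃ G ∈ Pol 𝕜 ε n, (fun z => -(gp ε z)⁻¹ • lap F z) =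
      fun z => ((n : 𝕜) * (n + 1) / 2) • F z + G z := by
  obtain ⟨G, hG, hGe⟩ := lap_Pol h0 h1 n F hF
  refine ⟨fun z => (-(1 / 2 : ℝ)) • G z, smul_mem_Pol _ hG, funext fun z => ?_⟩
  have hr := (rho_pos h0 h1 z).ne'
  simp only
  rw [hGe, gp_eq h0 h1, smul_smul,
    show -(2 * rho ε z)⁻¹ * rho ε z = -(1 / 2 : ℝ) by field_simp]
  simp only [RCLike.real_smul_eq_coe_mul, smul_eq_mul]
  push_cast
  ring

/-- The operator `-Δ / g'(ψ_ε)` on polynomials. -/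
def polD : SphPol 𝕜 ε →ₗ[𝕜] SphPol 𝕜 ε where
  toFun F := ⟨fun z => -(gp ε z)⁻¹ • lap F z, by
    obtain ⟨n, hF⟩ := F.2
    obtain ⟨G, hG, e⟩ := neg_inv_gp_smul_lap_mem h0 h1 (Pol_le_succ n hF)
    rw [e]
    exact ⟨n, add_mem_Pol (Submodule.smul_mem _ _ hF) hG⟩⟩
  map_add' F G := by
    refine Subtype.ext (funext fun z => ?_)
    change -(gp ε z)⁻¹ • lap (fun w => (F : ℝ × ℝ → 𝕜) w + (G : ℝ × ℝ → 𝕜) w) z =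
      -(gp ε z)⁻¹ • lap F z + -(gp ε z)⁻¹ • lap G z
    rw [lap_add (smoothPer_SphPol h0 h1 F) (smoothPer_SphPol h0 h1 G), smul_add]
  map_smul' c F := by
    refine Subtype.ext (funext fun z => ?_)
    have e := lap_clm (ContinuousLinearMap.mul ℝ 𝕜 c) (smoothPer_SphPol h0 h1 F) z
    simp only [ContinuousLinearMap.mul_apply'] at e
    change -(gp ε z)⁻¹ • lap (fun w => c * (F : ℝ × ℝ → 𝕜) w) z = c * (-(gp ε z)⁻¹ • lap F z)
    rw [e, mul_smul_comm]

end Model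

section Model

variable {𝕜 : Type*} [RCLike 𝕜] {ε : ℝ} (h0 : 0 ≤ ε) (h1 : ε < 1)
include h0 h1

theorem inner_polEmb_left (F : SphPol 𝕜 ε) (v : Lp 𝕜 2 (weighted ε)) :
    inner 𝕜 (polEmb h0 h1 F) v = ∫ z, v z * (starRingEnd 𝕜) ((F : ℝ × ℝ → 𝕜) z) ∂cyl :=
  inner_gpClass (weightedSq_SphPol h0 h1 F) v

theorem inner_polEmb (F G : SphPol 𝕜 ε) :
    inner 𝕜 (polEmb h0 h1 F) (polEmb h0 h1 G) =
      ∫ z, gp ε z • ((G : ℝ × ℝ → 𝕜) z * (starRingEnd 𝕜) ((F : ℝ × ℝ → 𝕜) z)) ∂cyl :=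
  inner_gpClass_gpClass (weightedSq_SphPol h0 h1 F) (weightedSq_SphPol h0 h1 G)

omit h0 h1 in
theorem sph_mul_mem_SphPol {F : ℝ × ℝ → ℝ} (hF : F ∈ Submonoid.closure (range (sph ε))) :
    (fun z => (F z : 𝕜)) ∈ SphPol 𝕜 ε := by
  induction hF using Submonoid.closure_induction_left with
  | one => exact ⟨1, by simpa using const_mem_Pol (1 : 𝕜) 0⟩
  | mul_left G hG F _ ih =>
    obtain ⟨i, rfl⟩ := hG
    obtain ⟨n, hn⟩ := ih
    refine ⟨n + 1, ?_⟩
    have := sph_smul_mem_Pol hn i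
    simpa [RCLike.real_smul_eq_coe_mul] using this

/-- Polynomials are dense, since the sphere coordinates separate the points of the cylinder. -/
theorem denseRange_polEmb : DenseRange (polEmb (𝕜 := 𝕜) h0 h1) := by
  have key : (LinearMap.range (polEmb (𝕜 := 𝕜) h0 h1)).topologicalClosure = ⊤ := by
    rw [Submodule.topologicalClosure_eq_top_iff, Submodule.eq_bot_iff]
    intro v hv
    have hz := ae_eq_zero_of_separating_smul (μ := cyl) (S := Ioc 0 (2 * Real.pi) ×ˢ univ)
      measurableSet_strip
      (by rw [cyl, Measure.restrict_apply measurableSet_strip.compl, compl_inter_self,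
        measure_empty])
      (sph ε) (fun i => (contDiff_sph h0 h1 i).continuous.measurable)
      (fun i z => abs_le.1 (abs_sph_le h0 h1 i z))
      (fun z hz w hw h => sph_injOn h0 h1 hz.1 hw.1 h) (integrable_Lp_weighted h0 h1 v) (by
        intro F hF
        have h := Submodule.inner_right_of_mem_orthogonal
          (LinearMap.mem_range_self (polEmb (𝕜 := 𝕜) h0 h1) ⟨_, sph_mul_mem_SphPol hF⟩) hv
        rw [← h]
        rw [inner_polEmb_left]
        refine integral_congr_ae (ae_of_all _ fun z => ?_)
        simp only [RCLike.real_smul_eq_coe_mul, RCLike.conj_ofReal, mul_comm])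
    refine Lp_weighted_ext ?_
    filter_upwards [hz, ae_weighted_iff.1 (Lp.coeFn_zero 𝕜 2 (weighted ε))] with z e1 e2
    rw [e1, e2]
  have := (Submodule.dense_iff_topologicalClosure_eq_top).2 key
  exact this

omit h0 h1 in
theorem pd_conj {F : ℝ × ℝ → 𝕜} (hF : SmoothPer F) (v z : ℝ × ℝ) :
    pd v (fun w => (starRingEnd 𝕜) (F w)) z = (starRingEnd 𝕜) (pd v F z) := by
  have := pd_clm (RCLike.conjCLE (K := 𝕜) : 𝕜 →L[ℝ] 𝕜) v (hF.differentiable z)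
  simpa using this

omit h0 h1 in
theorem SmoothPer.conj {F : ℝ × ℝ → 𝕜} (hF : SmoothPer F) :
    SmoothPer fun w => (starRingEnd 𝕜) (F w) :=
  ⟨(RCLike.conjCLE (K := 𝕜) : 𝕜 →L[ℝ] 𝕜).contDiff.comp hF.smooth, fun x y => by
    rw [hF.periodic]⟩

omit h0 h1 in
theorem SmoothPer.mul {F G : ℝ × ℝ → 𝕜} (hF : SmoothPer F) (hG : SmoothPer G) :
    SmoothPer fun w => F w * G w :=
  ⟨hF.smooth.mul hG.smooth, fun x y => by rw [hF.periodic, hG.periodic]⟩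

omit h0 h1 in
theorem transport_conj {F : ℝ × ℝ → 𝕜} (hF : SmoothPer F) (z : ℝ × ℝ) :
    transport ε (fun w => (starRingEnd 𝕜) (F w)) z = (starRingEnd 𝕜) (transport ε F z) := by
  simp only [transport, pd_conj hF, map_add, RCLike.real_smul_eq_coe_mul, map_mul,
    RCLike.conj_ofReal]

omit h0 h1 in
theorem transport_mul {F G : ℝ × ℝ → 𝕜} (hF : SmoothPer F) (hG : SmoothPer G) (z : ℝ × ℝ) :
    transport ε (fun w => F w * G w) z = F z * transport ε G z + transport ε F z * G z := by
  simp only [transport, pd_mul _ (hF.differentiable z) (hG.differentiable z),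
    RCLike.real_smul_eq_coe_mul]
  ring

/-- Skew-symmetry of the transport operator, from the divergence theorem for `g'(ψ_ε) u_ε`. -/
theorem polT_skew (F G : SphPol 𝕜 ε) :
    inner 𝕜 (polEmb h0 h1 (polT h0 h1 F)) (polEmb h0 h1 G) =
      -inner 𝕜 (polEmb h0 h1 F) (polEmb h0 h1 (polT h0 h1 G)) := by
  have hF := smoothPer_SphPol h0 h1 F
  have hG := smoothPer_SphPol h0 h1 G
  obtain ⟨n, hFn⟩ := F.2
  obtain ⟨m, hGm⟩ := G.2
  obtain ⟨C, hC0, hC⟩ := bound_Pol h0 h1 n _ hFn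
  obtain ⟨C', hC0', hC'⟩ := bound_Pol h0 h1 m _ hGm
  have hb : ∀ v z, ‖pd v (F : ℝ × ℝ → 𝕜) z‖ ≤ C / den ε z →
      ‖pd v (G : ℝ × ℝ → 𝕜) z‖ ≤ C' / den ε z →
      ‖pd v (fun w => (G : ℝ × ℝ → 𝕜) w * (starRingEnd 𝕜) ((F : ℝ × ℝ → 𝕜) w)) z‖ ≤
        2 * C * C' / den ε z := by
    intro v z e1 e2
    rw [pd_mul _ (hG.differentiable z) (hF.conj.differentiable z), pd_conj hF]
    refine (norm_add_le _ _).trans ?_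
    rw [norm_mul, norm_mul, RCLike.norm_conj, RCLike.norm_conj]
    have hd := den_pos h0 h1 z
    have i1 := mul_le_mul (hC' z).1 e1 (norm_nonneg _) hC0'
    have i2 := mul_le_mul e2 (hC z).1 (norm_nonneg _) (by positivity)
    refine (add_le_add i1 i2).trans_eq ?_
    ring
  have key := integral_gp_smul_transport h0 h1 (hG.mul hF.conj) (C := 2 * C * C') (fun z => by
    refine ⟨?_, hb _ z (hC z).2.1 (hC' z).2.1, hb _ z (hC z).2.2 (hC' z).2.2⟩
    rw [norm_mul, RCLike.norm_conj]
    have := mul_le_mul (hC' z).1 (hC z).1 (norm_nonneg _) hC0'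
    nlinarith [mul_nonneg hC0 hC0'])
  have hint : ∀ A B : SphPol 𝕜 ε, Integrable (fun z => gp ε z • ((B : ℝ × ℝ → 𝕜) z *
      (starRingEnd 𝕜) ((A : ℝ × ℝ → 𝕜) z))) cyl := by
    intro A B
    refine (integrable_mul_conj (weightedSq_SphPol h0 h1 A)
      (gpClass (weightedSq_SphPol h0 h1 B))).congr ?_
    filter_upwards [coeFn_gpClass (weightedSq_SphPol h0 h1 B)] with z hz
    rw [hz, smul_mul_assoc]
  rw [eq_neg_iff_add_eq_zero, inner_polEmb, inner_polEmb, ← integral_add (hint _ _) (hint _ _), ← key]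
  refine integral_congr_ae (ae_of_all _ fun z => ?_)
  simp only [transport_mul hG hF.conj, transport_conj hF, smul_add]
  rfl

/-- The form of `-Δ / g'(ψ_ε)` in the weighted space is the Dirichlet form of the plane. -/
theorem inner_polEmb_polD (F G : SphPol 𝕜 ε) :
    inner 𝕜 (polEmb h0 h1 F) (polEmb h0 h1 (polD h0 h1 G)) =
      ∫ z, (pd (1, 0) (G : ℝ × ℝ → 𝕜) z * (starRingEnd 𝕜) (pd (1, 0) (F : ℝ × ℝ → 𝕜) z) +
        pd (0, 1) (G : ℝ × ℝ → 𝕜) z * (starRingEnd 𝕜) (pd (0, 1) (F : ℝ × ℝ → 𝕜) z)) ∂cyl := by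
  have hF := smoothPer_SphPol h0 h1 F
  obtain ⟨n, hFn⟩ := F.2
  obtain ⟨m, hGm⟩ := G.2
  have hw := hasWeakGrad_Pol h0 h1 (star_mem_Pol n _ hFn)
  have key := integral_grad_Pol_mul h0 h1 hGm hw (hw.integrable_inv_den_smul h0 h1)
  simp only [pd_conj hF] at key
  rw [key]
  rw [inner_polEmb, ← integral_neg]
  refine integral_congr_ae (ae_of_all _ fun z => ?_)
  change gp ε z • ((-(gp ε z)⁻¹ • lap (G : ℝ × ℝ → 𝕜) z) * _) = _
  rw [smul_mul_assoc, smul_smul, mul_neg, mul_inv_cancel₀ (gp_pos ε z).ne', neg_one_smul]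

theorem polD_symm (F G : SphPol 𝕜 ε) :
    inner 𝕜 (polEmb h0 h1 (polD h0 h1 F)) (polEmb h0 h1 G) =
      inner 𝕜 (polEmb h0 h1 F) (polEmb h0 h1 (polD h0 h1 G)) := by
  rw [← inner_conj_symm, inner_polEmb_polD, inner_polEmb_polD, ← integral_conj]
  refine integral_congr_ae (ae_of_all _ fun z => ?_)
  simp only [map_add, map_mul, RCLike.conj_conj, mul_comm]

theorem re_inner_polD_self (F : SphPol 𝕜 ε) :
    RCLike.re (inner 𝕜 (polEmb h0 h1 F) (polEmb h0 h1 (polD h0 h1 F))) =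
      ∫ z, (‖pd (1, 0) (F : ℝ × ℝ → 𝕜) z‖ ^ 2 + ‖pd (0, 1) (F : ℝ × ℝ → 𝕜) z‖ ^ 2) ∂cyl := by
  rw [inner_polEmb_polD]
  simp only [RCLike.mul_conj]
  have : ∀ z, (‖pd (1, 0) (F : ℝ × ℝ → 𝕜) z‖ : 𝕜) ^ 2 + (‖pd (0, 1) (F : ℝ × ℝ → 𝕜) z‖ : 𝕜) ^ 2 =
      ((‖pd (1, 0) (F : ℝ × ℝ → 𝕜) z‖ ^ 2 + ‖pd (0, 1) (F : ℝ × ℝ → 𝕜) z‖ ^ 2 : ℝ) : 𝕜) := by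
    intro z
    push_cast
    rfl
  simp only [this]
  rw [integral_ofReal, RCLike.ofReal_re]

theorem integrable_norm_sq_pd (F : SphPol 𝕜 ε) :
    Integrable (fun z => ‖pd (1, 0) (F : ℝ × ℝ → 𝕜) z‖ ^ 2) cyl ∧
      Integrable (fun z => ‖pd (0, 1) (F : ℝ × ℝ → 𝕜) z‖ ^ 2) cyl := by
  obtain ⟨n, hFn⟩ := F.2
  obtain ⟨hx, hy⟩ := memLp_pd_Pol h0 h1 hFn
  exact ⟨(memLp_two_iff_integrable_sq_norm hx.1).1 hx, (memLp_two_iff_integrable_sq_norm hy.1).1 hy⟩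

theorem gp_le (z : ℝ × ℝ) : gp ε z ≤ 2 * (1 + ε) * (1 - ε)⁻¹ := by
  have h2 : 0 < 1 - ε := by linarith
  have h3 : 1 / den ε z ≤ (1 - ε)⁻¹ := by
    rw [one_div]
    exact inv_anti₀ h2 (one_sub_le_den h0 h1 z)
  have := rho_le h0 h1 z
  rw [gp_eq h0 h1]
  nlinarith

/-- The transport operator is bounded by the Dirichlet form, because the velocity is bounded. -/
theorem polT_bound (F : SphPol 𝕜 ε) :
    ‖polEmb h0 h1 (polT h0 h1 F)‖ ^ 2 ≤ √(4 * (1 + ε) * (1 - ε)⁻¹ ^ 3) ^ 2 *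
      RCLike.re (inner 𝕜 (polEmb h0 h1 F) (polEmb h0 h1 (polD h0 h1 F))) := by
  have h2 : 0 < 1 - ε := by linarith
  obtain ⟨ix, iy⟩ := integrable_norm_sq_pd h0 h1 F
  rw [Real.sq_sqrt (by positivity), re_inner_polD_self, ← integral_const_mul]
  have e1 := inner_polEmb h0 h1 (polT h0 h1 F) (polT h0 h1 F)
  simp only [RCLike.mul_conj] at e1
  have e2 : ‖polEmb h0 h1 (polT h0 h1 F)‖ ^ 2 =
      ∫ z, gp ε z * ‖transport ε (F : ℝ × ℝ → 𝕜) z‖ ^ 2 ∂cyl := by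
    rw [← inner_self_eq_norm_sq (𝕜 := 𝕜)]
    refine (congrArg RCLike.re e1).trans ?_
    have : ∀ z, gp ε z • (‖(polT h0 h1 F : ℝ × ℝ → 𝕜) z‖ : 𝕜) ^ 2 =
        ((gp ε z * ‖transport ε (F : ℝ × ℝ → 𝕜) z‖ ^ 2 : ℝ) : 𝕜) := by
      intro z
      rw [RCLike.real_smul_eq_coe_mul]
      push_cast
      rfl
    simp only [this]
    rw [integral_ofReal, RCLike.ofReal_re]
  rw [e2]
  refine integral_mono (weightedSq_SphPol h0 h1 (polT h0 h1 F)).int ((ix.add iy).const_mul _)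
    fun z => ?_
  obtain ⟨v1, v2⟩ := abs_vel_le h0 h1 z
  have hg := gp_le h0 h1 z
  have hg0 := gp_pos ε z
  set a := ‖pd (1, 0) (F : ℝ × ℝ → 𝕜) z‖ with ha
  set b := ‖pd (0, 1) (F : ℝ × ℝ → 𝕜) z‖ with hb
  have ht : ‖transport ε (F : ℝ × ℝ → 𝕜) z‖ ≤ (1 - ε)⁻¹ * a + (1 - ε)⁻¹ * b := by
    refine (norm_add_le _ _).trans ?_
    rw [norm_smul, norm_smul, Real.norm_eq_abs, Real.norm_eq_abs]
    gcongr
  have hi := inv_pos.2 h2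
  have ht2 : ‖transport ε (F : ℝ × ℝ → 𝕜) z‖ ^ 2 ≤ (1 - ε)⁻¹ ^ 2 * (2 * (a ^ 2 + b ^ 2)) := by
    have : ‖transport ε (F : ℝ × ℝ → 𝕜) z‖ ^ 2 ≤ ((1 - ε)⁻¹ * a + (1 - ε)⁻¹ * b) ^ 2 := by gcongr
    refine this.trans ?_
    rw [← mul_add, mul_pow]
    gcongr
    nlinarith [sq_nonneg (a - b)]
  calc gp ε z * ‖transport ε (F : ℝ × ℝ → 𝕜) z‖ ^ 2
      ≤ (2 * (1 + ε) * (1 - ε)⁻¹) * ((1 - ε)⁻¹ ^ 2 * (2 * (a ^ 2 + b ^ 2))) := by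
        gcongr
    _ = _ := by ring

/-- The model given by the polynomials on the sphere, with `T = u_ε · ∇` and `D = -Δ / g'(ψ_ε)`. -/
def sphModel : BandModel 𝕜 (SphPol 𝕜 ε) (Lp 𝕜 2 (weighted ε)) where
  j := polEmb h0 h1
  T := polT h0 h1
  D := polD h0 h1
  F n := (Pol 𝕜 ε n).comap (SphPol 𝕜 ε).subtype
  mono n m h := Submodule.comap_mono (Pol_mono h)
  F_zero := by
    rw [Pol, Submodule.comap_bot, Submodule.ker_subtype]
  exhaust F := F.2
  finDim n := by
    have := finiteDimensional_Pol (𝕜 := 𝕜) (ε := ε) n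
    exact (Submodule.comapSubtypeEquivOfLe (Pol_le_SphPol n)).symm.finiteDimensional
  dense := denseRange_polEmb h0 h1
  T_mem n F hF := transport_mem_Pol h0 h1 n _ hF
  D_mem n F hF := by
    obtain ⟨G, hG, e⟩ := neg_inv_gp_smul_lap_mem h0 h1 hF
    have : ((polD h0 h1 F - ((n : 𝕜) * (n + 1) / 2) • F : SphPol 𝕜 ε) : ℝ × ℝ → 𝕜) = G := by
      funext z
      have := congrFun e z
      change -(gp ε z)⁻¹ • lap F z - ((n : 𝕜) * (n + 1) / 2) • (F : ℝ × ℝ → 𝕜) z = G z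
      rw [sub_eq_iff_eq_add']
      exact this
    rw [Submodule.mem_comap, Submodule.subtype_apply, this]
    exact hG
  T_skew := polT_skew h0 h1
  D_symm := polD_symm h0 h1
  C := √(4 * (1 + ε) * (1 - ε)⁻¹ ^ 3)
  C_nonneg := Real.sqrt_nonneg _
  T_bound := polT_bound h0 h1

end Model

/-! ### The Poisson equation -/

section Poisson

variable {𝕜 : Type*} [RCLike 𝕜] {ε : ℝ} (h0 : 0 ≤ ε) (h1 : ε < 1)

theorem exists_const_of_mem_Pol_one {F : ℝ × ℝ → 𝕜} (hF : F ∈ Pol 𝕜 ε 1) :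
    ∃ a : 𝕜, F = fun _ => a := by
  obtain ⟨a, f, hf, rfl⟩ := mem_Pol_succ.1 hF
  refine ⟨a, funext fun z => ?_⟩
  have : ∀ i, f i = 0 := fun i => by
    have := hf i
    rwa [Pol, Submodule.mem_bot] at this
  simp [this]

/-- Constants as polynomials. -/
def constPol (ε : ℝ) (a : 𝕜) : SphPol 𝕜 ε := ⟨fun _ => a, 1, const_mem_Pol a 0⟩

include h0 h1

theorem mem_U_one_iff {x : Lp 𝕜 2 (weighted ε)} : x ∈ (sphModel (𝕜 := 𝕜) h0 h1).U 1 ↔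
    ∃ a : 𝕜, polEmb h0 h1 (constPol ε a) = x := by
  constructor
  · rintro ⟨F, hF, rfl⟩
    obtain ⟨a, ha⟩ := exists_const_of_mem_Pol_one (ε := ε) (F := (F : ℝ × ℝ → 𝕜)) hF
    refine ⟨a, congrArg (polEmb h0 h1) (Subtype.ext ha.symm)⟩
  · rintro ⟨a, rfl⟩
    exact ⟨constPol ε a, const_mem_Pol a 0, rfl⟩

theorem inner_constPol (a : 𝕜) (v : Lp 𝕜 2 (weighted ε)) :
    inner 𝕜 (polEmb h0 h1 (constPol ε a)) v = (∫ z, v z ∂cyl) * (starRingEnd 𝕜) a := by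
  rw [inner_polEmb_left]
  exact integral_mul_const ((starRingEnd 𝕜) a) fun z => v z

theorem mem_X_iff {v : Lp 𝕜 2 (weighted ε)} : v ∈ X 𝕜 ε ↔ ∫ z, v z ∂cyl = 0 :=
  ⟨fun h => h.2, fun h => ⟨integrable_Lp_weighted h0 h1 v, h⟩⟩

/-- The condition `∬ ω = 0` says that the constant part of `ω / g'(ψ_ε)` vanishes. -/
theorem degProj_zero_eq_zero {v : Lp 𝕜 2 (weighted ε)} (hv : ∫ z, v z ∂cyl = 0) :
    degProj (sphModel (𝕜 := 𝕜) h0 h1).U 0 v = 0 := by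
  have e1 : ((sphModel (𝕜 := 𝕜) h0 h1).U 1).starProjection v = 0 := by
    rw [Submodule.starProjection_apply_eq_zero_iff, Submodule.mem_orthogonal]
    intro u hu
    obtain ⟨a, rfl⟩ := (mem_U_one_iff h0 h1).1 hu
    rw [inner_constPol, hv, zero_mul]
  have e0 : ((sphModel (𝕜 := 𝕜) h0 h1).U 0).starProjection v = 0 := by
    rw [Submodule.starProjection_apply_eq_zero_iff, Submodule.mem_orthogonal]
    rintro u ⟨F, hF, rfl⟩
    rw [(sphModel (𝕜 := 𝕜) h0 h1).F_zero] at hF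
    rw [(Submodule.mem_bot 𝕜).1 hF, map_zero, inner_zero_left]
  change ((sphModel (𝕜 := 𝕜) h0 h1).U 1).starProjection v -
    ((sphModel (𝕜 := 𝕜) h0 h1).U 0).starProjection v = 0
  rw [e1, e0, sub_zero]

theorem degProj_zero_mem (v : Lp 𝕜 2 (weighted ε)) :
    degProj (sphModel (𝕜 := 𝕜) h0 h1).U 0 v ∈ (sphModel (𝕜 := 𝕜) h0 h1).U 1 :=
  Submodule.sub_mem _ (Submodule.starProjection_apply_mem _ _)
    ((sphModel (𝕜 := 𝕜) h0 h1).U_mono zero_le_one (Submodule.starProjection_apply_mem _ _))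

theorem tendsto_integral_mul_inv_gp {w : ℝ × ℝ → ℝ} (hw : Continuous w)
    (hc : ∃ R : ℝ, ∀ x y, R < |y| → w (x, y) = 0) {g : ℕ → SphPol 𝕜 ε} {v : Lp 𝕜 2 (weighted ε)}
    (hg : Tendsto (fun n => polEmb h0 h1 (g n)) atTop (𝓝 v)) :
    Tendsto (fun n => ∫ z, w z • (g n : ℝ × ℝ → 𝕜) z ∂cyl) atTop
      (𝓝 (∫ z, w z • ((gp ε z)⁻¹ • v z) ∂cyl)) := by
  have hgp := continuous_gp h0 h1
  have hi : Continuous fun z => (gp ε z)⁻¹ := hgp.inv₀ fun z => (gp_pos ε z).ne'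
  have hF : WeightedSq ε fun z => (((gp ε z)⁻¹ * w z : ℝ) : 𝕜) := by
    refine ⟨(RCLike.continuous_ofReal.comp (hi.mul hw)).aestronglyMeasurable, ?_⟩
    obtain ⟨R, hR⟩ := hc
    refine integrable_of_compact ?_ ⟨R, fun x y hy => by simp [hR x y hy]⟩
    exact hgp.mul ((RCLike.continuous_ofReal.comp (hi.mul hw)).norm.pow 2)
  have e1 : ∀ u : Lp 𝕜 2 (weighted ε),
      inner 𝕜 (gpClass hF) u = ∫ z, w z • ((gp ε z)⁻¹ • u z) ∂cyl := by
    intro u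
    rw [inner_gpClass]
    refine integral_congr_ae (ae_of_all _ fun z => ?_)
    simp only [RCLike.conj_ofReal, RCLike.real_smul_eq_coe_mul]
    push_cast
    ring
  have ht := ((continuous_const (y := gpClass hF)).inner continuous_id).tendsto (f := fun u =>
    inner 𝕜 (gpClass hF) u) v
  have ht2 := ht.comp hg
  simp only [e1] at ht2
  refine ht2.congr fun n => ?_
  simp only [Function.comp_apply]
  refine integral_congr_ae ?_
  filter_upwards [coeFn_gpClass (weightedSq_SphPol h0 h1 (g n))] with z hz
  have hz' : polEmb h0 h1 (g n) z = gp ε z • (g n : ℝ × ℝ → 𝕜) z := hz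
  rw [hz', smul_smul (gp ε z)⁻¹, inv_mul_cancel₀ (gp_pos ε z).ne', one_smul]

omit h0 h1 in
theorem tendsto_integral_mul_of_tendsto {a : ℝ × ℝ → 𝕜} (ha : MemLp a 2 cyl)
    {f : ℕ → ℝ × ℝ → 𝕜} (hf : ∀ n, MemLp (f n) 2 cyl) {p : Lp 𝕜 2 cyl}
    (hp : Tendsto (fun n => (hf n).toLp (f n)) atTop (𝓝 p)) :
    Tendsto (fun n => ∫ z, f n z * a z ∂cyl) atTop (𝓝 (∫ z, p z * a z ∂cyl)) := by
  have hac : MemLp (fun z => (starRingEnd 𝕜) (a z)) 2 cyl :=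
    ha.congr_norm (RCLike.continuous_conj.comp_aestronglyMeasurable ha.1)
      (ae_of_all _ fun z => by simp)
  have e1 : ∀ u : Lp 𝕜 2 cyl, inner 𝕜 (hac.toLp _) u = ∫ z, u z * a z ∂cyl := by
    intro u
    rw [L2.inner_def]
    refine integral_congr_ae ?_
    filter_upwards [hac.coeFn_toLp] with z hz
    rw [hz, RCLike.inner_apply, RCLike.conj_conj]
  have ht := ((continuous_const (y := hac.toLp _)).inner continuous_id).tendsto (f := fun u =>
    inner 𝕜 (hac.toLp _) u) p
  have ht2 := ht.comp hp
  simp only [e1] at ht2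
  refine ht2.congr fun n => ?_
  simp only [Function.comp_apply]
  refine integral_congr_ae ?_
  filter_upwards [(hf n).coeFn_toLp] with z hz
  rw [hz]

theorem memLp_pd_SphPol (F : SphPol 𝕜 ε) : MemLp (pd (1, 0) (F : ℝ × ℝ → 𝕜)) 2 cyl ∧
    MemLp (pd (0, 1) (F : ℝ × ℝ → 𝕜)) 2 cyl := by
  obtain ⟨n, hFn⟩ := F.2
  exact memLp_pd_Pol h0 h1 hFn

omit h0 h1 in
theorem norm_toLp_sq {f : ℝ × ℝ → 𝕜} (hf : MemLp f 2 cyl) :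
    ‖hf.toLp f‖ ^ 2 = ∫ z, ‖f z‖ ^ 2 ∂cyl := by
  rw [← inner_self_eq_norm_sq (𝕜 := 𝕜), L2.inner_def]
  have : ∫ z, inner 𝕜 (hf.toLp f z) (hf.toLp f z) ∂cyl = ∫ z, ((‖f z‖ ^ 2 : ℝ) : 𝕜) ∂cyl := by
    refine integral_congr_ae ?_
    filter_upwards [hf.coeFn_toLp] with z hz
    rw [hz, RCLike.inner_apply, RCLike.mul_conj]
    push_cast
    rfl
  rw [this, integral_ofReal, RCLike.ofReal_re]

/-- The gradients are controlled by the graph norm of `-Δ / g'(ψ_ε)`. -/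
theorem norm_sq_pd_sub_le (F G : SphPol 𝕜 ε) :
    ‖(memLp_pd_SphPol h0 h1 F).1.toLp _ - (memLp_pd_SphPol h0 h1 G).1.toLp _‖ ^ 2 ≤
        ‖polEmb h0 h1 F - polEmb h0 h1 G‖ *
          ‖polEmb h0 h1 (polD h0 h1 F) - polEmb h0 h1 (polD h0 h1 G)‖ ∧
    ‖(memLp_pd_SphPol h0 h1 F).2.toLp _ - (memLp_pd_SphPol h0 h1 G).2.toLp _‖ ^ 2 ≤
        ‖polEmb h0 h1 F - polEmb h0 h1 G‖ *
          ‖polEmb h0 h1 (polD h0 h1 F) - polEmb h0 h1 (polD h0 h1 G)‖ := by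
  have e := re_inner_polD_self h0 h1 (F - G)
  obtain ⟨ix, iy⟩ := integrable_norm_sq_pd h0 h1 (F - G)
  have hb : RCLike.re (inner 𝕜 (polEmb h0 h1 (F - G)) (polEmb h0 h1 (polD h0 h1 (F - G)))) ≤
      ‖polEmb h0 h1 F - polEmb h0 h1 G‖ *
          ‖polEmb h0 h1 (polD h0 h1 F) - polEmb h0 h1 (polD h0 h1 G)‖ := by
    refine (RCLike.re_le_norm _).trans ((norm_inner_le_norm _ _).trans_eq ?_)
    simp only [map_sub]
  rw [e, integral_add ix iy] at hb
  have nx : 0 ≤ ∫ z, ‖pd (1, 0) ((F - G : SphPol 𝕜 ε) : ℝ × ℝ → 𝕜) z‖ ^ 2 ∂cyl :=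
    integral_nonneg fun z => by positivity
  have ny : 0 ≤ ∫ z, ‖pd (0, 1) ((F - G : SphPol 𝕜 ε) : ℝ × ℝ → 𝕜) z‖ ^ 2 ∂cyl :=
    integral_nonneg fun z => by positivity
  have hpd : ∀ v z, pd v ((F - G : SphPol 𝕜 ε) : ℝ × ℝ → 𝕜) z =
      pd v (F : ℝ × ℝ → 𝕜) z - pd v (G : ℝ × ℝ → 𝕜) z := by
    intro v z
    have h := fderiv_sub ((smoothPer_SphPol h0 h1 F).differentiable z)
      ((smoothPer_SphPol h0 h1 G).differentiable z)
    change fderiv ℝ ((F : ℝ × ℝ → 𝕜) - (G : ℝ × ℝ → 𝕜)) z v = _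
    rw [h]
    rfl
  constructor
  · rw [← MemLp.toLp_sub, norm_toLp_sq]
    have : ∀ z, (pd (1, 0) (F : ℝ × ℝ → 𝕜) - pd (1, 0) (G : ℝ × ℝ → 𝕜)) z =
      pd (1, 0) ((F - G : SphPol 𝕜 ε) : ℝ × ℝ → 𝕜) z := fun z => (hpd _ z).symm
    simp only [this]
    linarith
  · rw [← MemLp.toLp_sub, norm_toLp_sq]
    have : ∀ z, (pd (0, 1) (F : ℝ × ℝ → 𝕜) - pd (0, 1) (G : ℝ × ℝ → 𝕜)) z =
      pd (0, 1) ((F - G : SphPol 𝕜 ε) : ℝ × ℝ → 𝕜) z := fun z => (hpd _ z).symm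
    simp only [this]
    linarith

omit h0 h1 in
theorem cauchySeq_of_norm_sq_le {E E' : Type*} [NormedAddCommGroup E] [NormedAddCommGroup E']
    {u : ℕ → E} {a b : ℕ → E'} (ha : CauchySeq a) (hb : CauchySeq b)
    (h : ∀ m n, ‖u m - u n‖ ^ 2 ≤ ‖a m - a n‖ * ‖b m - b n‖) : CauchySeq u := by
  rw [Metric.cauchySeq_iff] at ha hb ⊢
  intro e he
  obtain ⟨N, hN⟩ := ha e he
  obtain ⟨N', hN'⟩ := hb e he
  refine ⟨max N N', fun m hm n hn => ?_⟩
  have h1 := hN m ((le_max_left _ _).trans hm) n ((le_max_left _ _).trans hn)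
  have h2 := hN' m ((le_max_right _ _).trans hm) n ((le_max_right _ _).trans hn)
  rw [dist_eq_norm] at h1 h2 ⊢
  have h3 := h m n
  by_contra hcon
  rw [not_lt] at hcon
  nlinarith [norm_nonneg (a m - a n), norm_nonneg (b m - b n), norm_nonneg (u m - u n)]

theorem locInt_inv_gp_smul (v : Lp 𝕜 2 (weighted ε)) (R : ℝ) :
    IntegrableOn (fun z => (gp ε z)⁻¹ • v z) (univ ×ˢ Icc (-R) R) cyl := by
  have hi : Continuous fun z => (gp ε z)⁻¹ :=
    (continuous_gp h0 h1).inv₀ fun z => (gp_pos ε z).ne'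
  obtain ⟨C, hC⟩ := (isCompact_Icc.prod isCompact_Icc :
    IsCompact (Icc 0 (2 * Real.pi) ×ˢ Icc (-R) R)).exists_bound_of_continuousOn hi.continuousOn
  have hm : MeasurableSet (univ ×ˢ Icc (-R) R : Set (ℝ × ℝ)) :=
    MeasurableSet.univ.prod measurableSet_Icc
  refine Integrable.bdd_smul (integrable_Lp_weighted h0 h1 v).integrableOn C
    hi.aestronglyMeasurable ?_
  have : ∀ᵐ z ∂cyl, z ∈ Ioc 0 (2 * Real.pi) ×ˢ (univ : Set ℝ) :=
    ae_restrict_mem measurableSet_strip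
  filter_upwards [ae_restrict_of_ae this, ae_restrict_mem hm] with z hz hz'
  exact hC z ⟨Ioc_subset_Icc_self hz.1, hz'.2⟩

omit h0 h1 in
theorem IsTest.memLp {φ : ℝ × ℝ → ℝ} (hφ : IsTest φ) :
    MemLp (fun z => (φ z : 𝕜)) 2 cyl := by
  refine (memLp_two_iff_integrable_sq_norm (RCLike.continuous_ofReal.comp
    hφ.smooth.continuous).aestronglyMeasurable).2 ?_
  obtain ⟨R, hR⟩ := hφ.compact
  exact integrable_of_compact ((RCLike.continuous_ofReal.comp hφ.smooth.continuous).norm.pow 2)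
    ⟨R, fun x y hy => by simp [hR x y hy]⟩

/-- A weak solution of the Poisson equation, as the limit of polynomials whose Laplacians converge; the
gradients then converge in `L²`.  Test functions need no normalization of the trace here, as
`∬ w = 0`. -/
theorem exists_hasWeakGrad_Dinv {w : Lp 𝕜 2 (weighted ε)} (hw : ∫ z, w z ∂cyl = 0) :
    ∃ p q : ℝ × ℝ → 𝕜,
      HasWeakGrad (fun z => (gp ε z)⁻¹ • (sphModel (𝕜 := 𝕜) h0 h1).Dinv w z) p q ∧
      ∀ χ a b : ℝ × ℝ → 𝕜, HasWeakGrad χ a b →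
        ∫ z, (p z * a z + q z * b z) ∂cyl = ∫ z, w z * χ z ∂cyl := by
  obtain ⟨g, hg, hDg⟩ := (sphModel (𝕜 := 𝕜) h0 h1).exists_approx_Dinv
    (degProj_zero_eq_zero h0 h1 hw)
  replace hg : Tendsto (fun n => polEmb h0 h1 (g n)) atTop
    (𝓝 ((sphModel (𝕜 := 𝕜) h0 h1).Dinv w)) := hg
  replace hDg : Tendsto (fun n => polEmb h0 h1 (polD h0 h1 (g n))) atTop (𝓝 w) := hDg
  obtain ⟨p, hp⟩ := cauchySeq_tendsto_of_complete (cauchySeq_of_norm_sq_le hg.cauchySeq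
    hDg.cauchySeq fun m n => (norm_sq_pd_sub_le h0 h1 (g m) (g n)).1)
  obtain ⟨q, hq⟩ := cauchySeq_tendsto_of_complete (cauchySeq_of_norm_sq_le hg.cauchySeq
    hDg.cauchySeq fun m n => (norm_sq_pd_sub_le h0 h1 (g m) (g n)).2)
  have hgw : ∀ n, HasWeakGrad (g n : ℝ × ℝ → 𝕜) (pd (1, 0) (g n : ℝ × ℝ → 𝕜))
      (pd (0, 1) (g n : ℝ × ℝ → 𝕜)) := fun n => by
    obtain ⟨m, hm⟩ := (g n).2
    exact hasWeakGrad_Pol h0 h1 hm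
  refine ⟨p, q, ⟨locInt_inv_gp_smul h0 h1 _, Lp.memLp p, Lp.memLp q, fun φ hφ => ?_,
    fun φ hφ => ?_⟩, fun χ a b hχ => ?_⟩
  · have hc := hφ.compactTest.pd (1, 0)
    have t1 := tendsto_integral_mul_inv_gp h0 h1 hc.smooth.continuous hc.compact hg
    have t2 := (tendsto_integral_mul_of_tendsto (hφ.memLp (𝕜 := 𝕜))
      (fun n => (memLp_pd_SphPol h0 h1 (g n)).1) hp).neg
    have e : ∀ n, ∫ z, pd (1, 0) φ z • (g n : ℝ × ℝ → 𝕜) z ∂cyl =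
        -∫ z, pd (1, 0) (g n : ℝ × ℝ → 𝕜) z * (φ z : 𝕜) ∂cyl := fun n => by
      have := (hgw n).weak_x φ hφ
      simp only [RCLike.real_smul_eq_coe_mul, mul_comm] at this ⊢
      exact this
    simp only [e] at t1
    have := tendsto_nhds_unique t1 t2
    simp only [RCLike.real_smul_eq_coe_mul (φ _), mul_comm (φ _ : 𝕜)]
    exact this
  · have hc := hφ.compactTest.pd (0, 1)
    have t1 := tendsto_integral_mul_inv_gp h0 h1 hc.smooth.continuous hc.compact hg
    have t2 := (tendsto_integral_mul_of_tendsto (hφ.memLp (𝕜 := 𝕜))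
      (fun n => (memLp_pd_SphPol h0 h1 (g n)).2) hq).neg
    have e : ∀ n, ∫ z, pd (0, 1) φ z • (g n : ℝ × ℝ → 𝕜) z ∂cyl =
        -∫ z, pd (0, 1) (g n : ℝ × ℝ → 𝕜) z * (φ z : 𝕜) ∂cyl := fun n => by
      have := (hgw n).weak_y φ hφ
      simp only [RCLike.real_smul_eq_coe_mul, mul_comm] at this ⊢
      exact this
    simp only [e] at t1
    have := tendsto_nhds_unique t1 t2
    simp only [RCLike.real_smul_eq_coe_mul (φ _), mul_comm (φ _ : 𝕜)]
    exact this
  · have t1 := tendsto_integral_mul_of_tendsto hχ.memLp_x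
      (fun n => (memLp_pd_SphPol h0 h1 (g n)).1) hp
    have t2 := tendsto_integral_mul_of_tendsto hχ.memLp_y
      (fun n => (memLp_pd_SphPol h0 h1 (g n)).2) hq
    have hW := (hχ.weightedSq h0 h1).conj
    have e1 : ∀ u : Lp 𝕜 2 (weighted ε), inner 𝕜 (gpClass hW) u = ∫ z, u z * χ z ∂cyl := by
      intro u
      rw [inner_gpClass]
      simp only [RCLike.conj_conj]
    have t3 := (((continuous_const (y := gpClass hW)).inner continuous_id).tendsto (f := fun u =>
      inner 𝕜 (gpClass hW) u) w).comp hDg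
    simp only [e1] at t3
    have ip : Integrable (fun z => p z * a z) cyl := (Lp.memLp p).integrable_mul hχ.memLp_x
    have iq : Integrable (fun z => q z * b z) cyl := (Lp.memLp q).integrable_mul hχ.memLp_y
    rw [integral_add ip iq]
    refine tendsto_nhds_unique (t1.add t2) (t3.congr fun n => ?_)
    obtain ⟨m, hm⟩ := (g n).2
    have hG := integral_grad_Pol_mul h0 h1 hm hχ (hχ.integrable_inv_den_smul h0 h1)
    obtain ⟨mx, my⟩ := memLp_pd_SphPol h0 h1 (g n)
    have ix : Integrable (fun z => pd (1, 0) (g n : ℝ × ℝ → 𝕜) z * a z) cyl :=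
      mx.integrable_mul hχ.memLp_x
    have iy : Integrable (fun z => pd (0, 1) (g n : ℝ × ℝ → 𝕜) z * b z) cyl :=
      my.integrable_mul hχ.memLp_y
    rw [← integral_add ix iy, hG, ← integral_neg]
    simp only [Function.comp_apply]
    refine integral_congr_ae ?_
    filter_upwards [coeFn_gpClass (weightedSq_SphPol h0 h1 (polD h0 h1 (g n)))] with z hz
    have hz' : polEmb h0 h1 (polD h0 h1 (g n)) z =
        gp ε z • (-(gp ε z)⁻¹ • lap (g n : ℝ × ℝ → 𝕜) z) := hz
    rw [hz', smul_smul, mul_neg, mul_inv_cancel₀ (gp_pos ε z).ne', neg_one_smul, neg_mul]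

/-- Existence for the Poisson equation; thus the choice in `invLaplace` is a genuine solution. -/
theorem exists_isPoissonSolution (ω : X 𝕜 ε) : ∃ ψ, IsPoissonSolution ω ψ := by
  obtain ⟨p, q, hw, h⟩ := exists_hasWeakGrad_Dinv h0 h1 ω.2.2
  obtain ⟨c, hc⟩ := hw.exists_inStreamSpace h0 h1
  exact ⟨_, p, q, hc, fun χ a b hχ => h χ a b hχ.1⟩

/-- Up to a constant, `(-Δ)⁻¹` is division by the eigenvalues `n (n + 1) / 2`.  Testing with
polynomials, whose traces may be normalized by constants, determines all parts of the solution except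
the constant one. -/
theorem IsPoissonSolution.ae_eq {ω : X 𝕜 ε} {ψ : ℝ × ℝ → 𝕜} (h : IsPoissonSolution ω ψ) :
    ∃ c : 𝕜, ∀ᵐ z ∂cyl, ψ z =
      (gp ε z)⁻¹ • (sphModel (𝕜 := 𝕜) h0 h1).Dinv (ω : Lp 𝕜 2 (weighted ε)) z + c := by
  obtain ⟨p, q, hψ, h⟩ := h
  have hW := hψ.1.weightedSq h0 h1
  have hωi := integrable_Lp_weighted h0 h1 (ω : Lp 𝕜 2 (weighted ε))
  have key : ∀ f : SphPol 𝕜 ε, inner 𝕜 (polEmb h0 h1 (polD h0 h1 f)) (gpClass hW) =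
      inner 𝕜 (polEmb h0 h1 f) (ω : Lp 𝕜 2 (weighted ε)) := by
    intro f
    obtain ⟨n, hn⟩ := f.2
    have hn' := star_mem_Pol n _ hn
    have hfw := hasWeakGrad_Pol h0 h1 hn'
    obtain ⟨c, hc⟩ := hfw.exists_inStreamSpace h0 h1
    have e1 := h _ _ _ hc
    have e2 := integral_grad_Pol_mul h0 h1 hn' hψ.1 (hψ.1.integrable_inv_den_smul h0 h1)
    -- The constant drops out because `∬ ω = 0`.
    have e3 : ∫ z, rep ω z * ((starRingEnd 𝕜) ((f : ℝ × ℝ → 𝕜) z) - c) ∂cyl =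
        inner 𝕜 (polEmb h0 h1 f) (ω : Lp 𝕜 2 (weighted ε)) := by
      simp only [mul_sub]
      have i1 : Integrable (fun z => rep ω z * (starRingEnd 𝕜) ((f : ℝ × ℝ → 𝕜) z)) cyl :=
        integrable_mul_conj (weightedSq_SphPol h0 h1 f) _
      have i2 : Integrable (fun z => rep ω z * c) cyl := hωi.mul_const c
      have e4 : ∫ z, rep ω z * c ∂cyl = 0 := by
        rw [integral_mul_const, show ∫ z, rep ω z ∂cyl = 0 from ω.2.2, zero_mul]
      rw [integral_sub i1 i2, e4, sub_zero, inner_polEmb_left]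
      rfl
    rw [← e3, ← e1]
    simp only [mul_comm (p _), mul_comm (q _)]
    rw [e2, inner_polEmb_left, ← integral_neg]
    refine integral_congr_ae ?_
    have hl := fun z => lap_clm (RCLike.conjCLE (K := 𝕜) : 𝕜 →L[ℝ] 𝕜)
      (smoothPer_SphPol h0 h1 f) z
    filter_upwards [coeFn_gpClass hW] with z hz
    have hl' : lap (fun w => (starRingEnd 𝕜) ((f : ℝ × ℝ → 𝕜) w)) z =
        (starRingEnd 𝕜) (lap (f : ℝ × ℝ → 𝕜) z) := by simpa using hl z
    change gpClass hW z * (starRingEnd 𝕜) (-(gp ε z)⁻¹ • lap (f : ℝ × ℝ → 𝕜) z) = _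
    rw [hz, hl', RCLike.real_smul_eq_coe_mul, RCLike.real_smul_eq_coe_mul, map_mul,
      RCLike.conj_ofReal]
    have hg : ((gp ε z : ℝ) : 𝕜) ≠ 0 := by exact_mod_cast (gp_pos ε z).ne'
    push_cast
    field_simp
  have hD := (sphModel (𝕜 := 𝕜) h0 h1).sub_degProj_eq_Dinv (y := gpClass hW)
    (degProj_zero_eq_zero h0 h1 ω.2.2) key
  obtain ⟨c, hc⟩ := (mem_U_one_iff h0 h1).1 (degProj_zero_mem h0 h1 (gpClass hW))
  refine ⟨c, ?_⟩
  rw [← hc, sub_eq_iff_eq_add] at hD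
  have hA := ae_weighted_iff.1 (Lp.coeFn_add ((sphModel (𝕜 := 𝕜) h0 h1).Dinv
    (ω : Lp 𝕜 2 (weighted ε))) (polEmb h0 h1 (constPol ε c)))
  rw [← hD] at hA
  filter_upwards [hA, coeFn_gpClass hW,
    coeFn_gpClass (weightedSq_SphPol h0 h1 (constPol ε c))] with z e1 e2 e3
  have e3' : polEmb h0 h1 (constPol ε c) z = gp ε z • c := e3
  rw [Pi.add_apply, e2, e3'] at e1
  have hg := (gp_pos ε z).ne'
  have := congrArg (fun t => (gp ε z)⁻¹ • t) e1
  simp only [smul_add, smul_smul, inv_mul_cancel₀ hg, one_smul] at this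
  exact this

/-- Up to a constant, `L_ε ω` is `P ω / g'(ψ_ε)`. -/
theorem exists_Lfun_ae_eq (ω : X 𝕜 ε) : ∃ c : 𝕜, ∀ᵐ z ∂cyl, Lfun ω z =
    (gp ε z)⁻¹ • (sphModel (𝕜 := 𝕜) h0 h1).P (ω : Lp 𝕜 2 (weighted ε)) z - c := by
  have hs : IsPoissonSolution ω (invLaplace ω) :=
    Classical.epsilon_spec (exists_isPoissonSolution h0 h1 ω)
  obtain ⟨c, hc⟩ := hs.ae_eq h0 h1
  refine ⟨c, ?_⟩
  have hsub := ae_weighted_iff.1 (Lp.coeFn_sub (ω : Lp 𝕜 2 (weighted ε))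
    ((sphModel (𝕜 := 𝕜) h0 h1).Dinv (ω : Lp 𝕜 2 (weighted ε))))
  filter_upwards [hc, hsub] with z e1 e2
  rw [Lfun, e1, BandModel.P_apply, e2, Pi.sub_apply, smul_sub, sub_add_eq_sub_sub]
  rfl

end Poisson

/-! ### The transport operator in the sense of distributions -/

section Transport

variable {𝕜 : Type*} [RCLike 𝕜] {ε : ℝ} (h0 : 0 ≤ ε) (h1 : ε < 1)

theorem CompactTest.add {E : Type*} [NormedAddCommGroup E] [NormedSpace ℝ E] {φ ψ : ℝ × ℝ → E}
    (hφ : CompactTest φ) (hψ : CompactTest ψ) : CompactTest fun z => φ z + ψ z := by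
  obtain ⟨R, hR⟩ := hφ.compact
  obtain ⟨R', hR'⟩ := hψ.compact
  exact ⟨⟨hφ.smooth.add hψ.smooth, fun x y => by rw [hφ.periodic, hψ.periodic]⟩, max R R',
    fun x y hy => by rw [hR x y ((le_max_left _ _).trans_lt hy),
      hR' x y ((le_max_right _ _).trans_lt hy), add_zero]⟩

include h0 h1

theorem compactTest_gp_smul_transport {φ : ℝ × ℝ → 𝕜} (hφ : CompactTest φ) :
    CompactTest fun z => gp ε z • transport ε φ z := by
  obtain ⟨hs1, hs2⟩ := smoothPer_gp_vel h0 h1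
  have := (CompactTest.smul hs1 (hφ.pd (1, 0))).add (CompactTest.smul hs2 (hφ.pd (0, 1)))
  simpa only [transport, smul_add, smul_smul] using this

theorem weightedSq_compactTest {φ : ℝ × ℝ → 𝕜} (hφ : CompactTest φ) : WeightedSq ε φ := by
  obtain ⟨R, hR⟩ := hφ.compact
  exact ⟨hφ.smooth.continuous.aestronglyMeasurable, integrable_of_compact
    ((continuous_gp h0 h1).mul (hφ.smooth.continuous.norm.pow 2))
    ⟨R, fun x y hy => by simp [hR x y hy]⟩⟩

theorem weightedSq_transport {φ : ℝ × ℝ → 𝕜} (hφ : CompactTest φ) :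
    WeightedSq ε (transport ε φ) := by
  have h := compactTest_gp_smul_transport h0 h1 hφ
  obtain ⟨R, hR⟩ := h.compact
  have hgp := continuous_gp h0 h1
  have hc : Continuous (transport ε φ) := by
    have : transport ε φ = fun z => (gp ε z)⁻¹ • gp ε z • transport ε φ z := by
      funext z
      rw [smul_smul, inv_mul_cancel₀ (gp_pos ε z).ne', one_smul]
    rw [this]
    exact (hgp.inv₀ fun z => (gp_pos ε z).ne').smul h.smooth.continuous
  refine ⟨hc.aestronglyMeasurable, integrable_of_compact (hgp.mul (hc.norm.pow 2)) ⟨R, ?_⟩⟩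
  intro x y hy
  have := (smul_eq_zero.1 (hR x y hy)).resolve_left (gp_pos ε _).ne'
  rw [this, norm_zero]
  simp

/-- The constant by which `L_ε ω` differs from `P ω / g'(ψ_ε)` is invisible to `J_ε`. -/
theorem isJ_Lfun_iff (ω f : X 𝕜 ε) : IsJ (Lfun ω) f ↔ ∀ φ, IsTest φ →
    ∫ z, (gp ε z * transport ε φ z) •
      ((gp ε z)⁻¹ • (sphModel (𝕜 := 𝕜) h0 h1).P (ω : Lp 𝕜 2 (weighted ε)) z) ∂cyl =
      ∫ z, φ z • rep f z ∂cyl := by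
  obtain ⟨c, hc⟩ := exists_Lfun_ae_eq h0 h1 ω
  refine forall₂_congr fun φ hφ => ?_
  have ht := compactTest_gp_smul_transport h0 h1 hφ.compactTest
  simp only [smul_eq_mul] at ht
  have e : ∫ z, (gp ε z * (vel1 ε z * dx φ z + vel2 ε z * dy φ z)) • Lfun ω z ∂cyl =
      ∫ z, (gp ε z * transport ε φ z) •
        ((gp ε z)⁻¹ • (sphModel (𝕜 := 𝕜) h0 h1).P (ω : Lp 𝕜 2 (weighted ε)) z) ∂cyl := by
    have i1 := integrable_isTest_smul ht.isTest (locInt_inv_gp_smul h0 h1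
      ((sphModel (𝕜 := 𝕜) h0 h1).P (ω : Lp 𝕜 2 (weighted ε))))
    have i2 : Integrable (fun z => (gp ε z * transport ε φ z) • c) cyl :=
      ht.integrable.smul_const c
    have e2 : ∫ z, (gp ε z * transport ε φ z) • c ∂cyl = 0 := by
      have := integral_gp_smul_transport_of_compactTest h0 h1 hφ.compactTest
      simp only [smul_eq_mul] at this
      rw [integral_smul_const, this, zero_smul]
    rw [← sub_zero (∫ z, (gp ε z * transport ε φ z) • _ ∂cyl), ← e2, ← integral_sub i1 i2]
    refine integral_congr_ae ?_
    filter_upwards [hc] with z hz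
    rw [hz, smul_sub]
    rfl
  rw [e]

/-- Distributional solutions of the transport equation may be tested with polynomials `F`: multiply
`F` by a cut-off in `y`, whose contribution is `O(1 / m)`. -/
theorem weak_of_isJ {ω f : X 𝕜 ε} (h : IsJ (Lfun ω) f) :
    (sphModel (𝕜 := 𝕜) h0 h1).Weak
      ((sphModel (𝕜 := 𝕜) h0 h1).P (ω : Lp 𝕜 2 (weighted ε))) (-(f : Lp 𝕜 2 (weighted ε))) := by
  rw [isJ_Lfun_iff h0 h1] at h
  set v := (sphModel (𝕜 := 𝕜) h0 h1).P (ω : Lp 𝕜 2 (weighted ε)) with hv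
  have hvi := integrable_Lp_weighted h0 h1 v
  have hfi := integrable_Lp_weighted h0 h1 (f : Lp 𝕜 2 (weighted ε))
  have hfl : ∀ R : ℝ, IntegrableOn (rep f) (univ ×ˢ Icc (-R) R) cyl := fun R => hfi.integrableOn
  intro F
  rw [inner_neg_right, neg_neg]
  change inner 𝕜 (polEmb h0 h1 (polT h0 h1 F)) v =
    inner 𝕜 (polEmb h0 h1 F) (f : Lp 𝕜 2 (weighted ε))
  have hF := smoothPer_SphPol h0 h1 F
  obtain ⟨n, hFn⟩ := F.2
  obtain ⟨C, hC0, hC⟩ := bound_Pol h0 h1 n _ hFn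
  rw [inner_polEmb_left, inner_polEmb_left]
  set G : ℝ × ℝ → 𝕜 := fun z => (starRingEnd 𝕜) ((F : ℝ × ℝ → 𝕜) z) with hG
  have hGs : SmoothPer G := hF.conj
  have hTG : ∀ z, transport ε G z = (starRingEnd 𝕜) (transport ε (F : ℝ × ℝ → 𝕜) z) :=
    fun z => transport_conj hF z
  have i1 : Integrable (fun z => transport ε G z * v z) cyl := by
    have := integrable_mul_conj (weightedSq_SphPol h0 h1 (polT h0 h1 F)) v
    refine this.congr (ae_of_all _ fun z => ?_)
    change v z * (starRingEnd 𝕜) (transport ε (F : ℝ × ℝ → 𝕜) z) = transport ε G z * v z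
    rw [hTG, mul_comm]
  have i2 : Integrable (fun z => (vel2 ε z • G z) * v z) cyl := by
    refine hvi.bdd_mul (c := (1 - ε)⁻¹ * C) ?_ (ae_of_all _ fun z => ?_)
    · obtain ⟨-, hs2⟩ := smoothPer_gp_vel h0 h1
      have : vel2 ε = fun z => (gp ε z)⁻¹ * (gp ε z * vel2 ε z) := by
        funext z
        rw [← mul_assoc, inv_mul_cancel₀ (gp_pos ε z).ne', one_mul]
      rw [this]
      exact ((((continuous_gp h0 h1).inv₀ fun z => (gp_pos ε z).ne').mul
        hs2.smooth.continuous).smul hGs.smooth.continuous).aestronglyMeasurable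
    · rw [norm_smul, RCLike.norm_conj]
      exact mul_le_mul (abs_vel_le h0 h1 z).2 (hC z).1 (norm_nonneg _)
        (inv_nonneg.2 (by linarith))
  have i3 : Integrable (fun z => G z * rep f z) cyl :=
    (integrable_mul_conj (weightedSq_SphPol h0 h1 F) (f : Lp 𝕜 2 (weighted ε))).congr
      (ae_of_all _ fun z => mul_comm _ _)
  have t1 := (tendsto_integral_cutoff_smul i1).add (tendsto_integral_pd_cutoff_smul i2)
  have t2 := tendsto_integral_cutoff_smul i3
  rw [add_zero] at t1
  have e : ∀ m, ∫ z, cutoff m z • (transport ε G z * v z) ∂cyl +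
      ∫ z, pd (0, 1) (cutoff m) z • ((vel2 ε z • G z) * v z) ∂cyl =
        ∫ z, cutoff m z • (G z * rep f z) ∂cyl := by
    intro m
    have hc := compactTest_cutoff m
    have hcG := hc.smul' hGs
    have key := integral_compactTest_mul_eq (compactTest_gp_smul_transport h0 h1 hcG) hcG
      (locInt_inv_gp_smul h0 h1 v) hfl (fun L => by
        have := h _ (hcG.clm L).isTest
        rw [← this]
        refine integral_congr_ae (ae_of_all _ fun z => ?_)
        simp only [transport, pd_clm L _ (hcG.differentiable z)]
        simp only [map_smul, map_add, smul_eq_mul])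
    simp only [smul_mul_assoc] at key ⊢
    rw [← key, ← integral_add]
    · refine integral_congr_ae (ae_of_all _ fun z => ?_)
      simp only [transport_smul hc.toSmoothPer hGs, mul_smul_comm, smul_smul,
        mul_inv_cancel₀ (gp_pos ε z).ne', one_smul, add_mul, smul_mul_assoc]
      congr 2
      simp only [transport, pd_x_cutoff, smul_eq_mul, mul_zero, zero_add]
      rw [mul_comm]
    · exact i1.bdd_smul 1 hc.smooth.continuous.aestronglyMeasurable
        (ae_of_all _ fun z => cutoff_mem m z)
    · obtain ⟨C', hC0', hC'⟩ := exists_pd_y_cutoff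
      have := i2.bdd_smul (C' / (m + 1)) (hc.pd (0, 1)).smooth.continuous.aestronglyMeasurable
        (ae_of_all _ fun z => hC' m z)
      simp only [smul_mul_assoc] at this
      exact this
  simp only [e] at t1
  have := tendsto_nhds_unique t1 t2
  simp only [mul_comm _ (v _), mul_comm _ (rep f _)] at this
  simp only [hTG] at this
  exact this

/-- Solutions tested with polynomials are solutions in the sense of distributions.  A test function
itself lies in the domain of the maximal operator, so this is an instance of the skew-symmetry of that
operator. -/
theorem isJ_of_weak {ω f : X 𝕜 ε} (h : (sphModel (𝕜 := 𝕜) h0 h1).Weak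
      ((sphModel (𝕜 := 𝕜) h0 h1).P (ω : Lp 𝕜 2 (weighted ε))) (-(f : Lp 𝕜 2 (weighted ε)))) :
    IsJ (Lfun ω) f := by
  rw [isJ_Lfun_iff h0 h1]
  intro φ hφ
  have hΦ : CompactTest fun z => (φ z : 𝕜) := hφ.compactTest.clm (RCLike.ofRealCLM (K := 𝕜))
  have hT : ∀ z, transport ε (fun z => (φ z : 𝕜)) z = ((transport ε φ z : ℝ) : 𝕜) := by
    intro z
    have e := fun v => pd_clm (RCLike.ofRealCLM (K := 𝕜)) v (hφ.compactTest.differentiable z)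
    simp only [RCLike.ofRealCLM_apply] at e
    simp only [transport, e, RCLike.real_smul_eq_coe_mul, smul_eq_mul]
    push_cast
    rfl
  have hw1 := weightedSq_compactTest h0 h1 hΦ
  have hw2 := weightedSq_transport h0 h1 hΦ
  have hweak : (sphModel (𝕜 := 𝕜) h0 h1).Weak (gpClass hw1) (gpClass hw2) := by
    intro F
    change inner 𝕜 (gpClass (weightedSq_SphPol h0 h1 (polT h0 h1 F))) (gpClass hw1) =
      -inner 𝕜 (gpClass (weightedSq_SphPol h0 h1 F)) (gpClass hw2)
    have hF := smoothPer_SphPol h0 h1 F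
    have hint : ∀ {A B : ℝ × ℝ → 𝕜} (hA : WeightedSq ε A) (hB : WeightedSq ε B),
        Integrable (fun z => gp ε z • (B z * (starRingEnd 𝕜) (A z))) cyl := by
      intro A B hA hB
      refine (integrable_mul_conj hA (gpClass hB)).congr ?_
      filter_upwards [coeFn_gpClass hB] with z hz
      rw [hz, smul_mul_assoc]
    have hc : CompactTest fun z => (φ z : 𝕜) * (starRingEnd 𝕜) ((F : ℝ × ℝ → 𝕜) z) := by
      simpa only [RCLike.real_smul_eq_coe_mul] using hφ.compactTest.smul' hF.conj
    have key := integral_gp_smul_transport_of_compactTest h0 h1 hc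
    have hw3 := weightedSq_SphPol h0 h1 (polT h0 h1 F)
    have hw4 := weightedSq_SphPol h0 h1 F
    rw [eq_neg_iff_add_eq_zero, inner_gpClass_gpClass hw3 hw1, inner_gpClass_gpClass hw4 hw2,
      ← integral_add (hint hw3 hw1) (hint hw4 hw2), ← key]
    refine integral_congr_ae (ae_of_all _ fun z => ?_)
    simp only [transport_mul hΦ.toSmoothPer hF.conj, transport_conj hF, smul_add]
    rfl
  have key := hweak.inner_eq _ h
  rw [inner_neg_right, neg_neg, inner_gpClass, inner_gpClass] at key
  simp only [hT, RCLike.conj_ofReal] at key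
  simp only [RCLike.real_smul_eq_coe_mul]
  simp only [mul_comm _ ((φ _ : ℝ) : 𝕜), mul_comm _ ((transport ε φ _ : ℝ) : 𝕜)] at key
  rw [show ∫ z, (φ z : 𝕜) * rep f z ∂cyl = _ from key.symm]
  refine integral_congr_ae (ae_of_all _ fun z => ?_)
  have hg : ((gp ε z : ℝ) : 𝕜) ≠ 0 := by exact_mod_cast (gp_pos ε z).ne'
  simp only
  push_cast
  field_simp

end Transport

/-! ### Spectral stability -/

section Spectrum

variable {ε : ℝ} (h0 : 0 ≤ ε) (h1 : ε < 1)
include h0 h1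

/-- Off the imaginary axis, the resolvent of the model maps `X_ε` to itself, and it inverts
`λ - J_ε L_ε` there. -/
theorem spectrallyStable : SpectrallyStable ε := by
  intro lam hlam
  by_contra hre
  refine hlam ?_
  set B := sphModel (𝕜 := ℂ) h0 h1 with hB
  obtain ⟨R, hR⟩ := B.exists_resolvent (lam := lam) hre
  have hmem : ∀ h : X ℂ ε, R h ∈ X ℂ ε := by
    intro h
    rw [mem_X_iff h0 h1]
    -- Testing with the constant `1`, which `T` annihilates, gives `λ ∬ R h = ∬ h = 0`, and `λ ≠ 0`.
    have hw := (hR (R h) h).2 rfl (constPol ε 1)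
    have hT : B.T (constPol ε 1) = 0 := by
      refine Subtype.ext (funext fun z => ?_)
      change transport ε (fun _ => (1 : ℂ)) z = 0
      simp [transport, pd_const]
    rw [hT, map_zero, inner_zero_left, inner_sub_right, inner_smul_right] at hw
    have e1 := inner_constPol h0 h1 (1 : ℂ) (h : Lp ℂ 2 (weighted ε))
    have e2 := inner_constPol h0 h1 (1 : ℂ) (R h)
    rw [map_one, mul_one] at e1 e2
    replace hw : (0 : ℂ) = -(inner ℂ (polEmb h0 h1 (constPol ε 1)) (h : Lp ℂ 2 (weighted ε)) -
      lam * inner ℂ (polEmb h0 h1 (constPol ε 1)) (R h)) := hw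
    rw [e1, e2, h.2.2, zero_sub, neg_neg] at hw
    refine (mul_eq_zero.1 hw.symm).resolve_left fun h => hre ?_
    rw [h, Complex.zero_re]
  refine ⟨(R.comp (X ℂ ε).subtypeL).codRestrict (X ℂ ε) hmem, fun w f hwf => ?_, fun h => ?_⟩
  · have hw := weak_of_isJ h0 h1 hwf
    refine Subtype.ext ?_
    refine (hR (w : Lp ℂ 2 (weighted ε)) (lam • w - f : X ℂ ε)).1 ?_
    rw [Submodule.coe_sub, Submodule.coe_smul, sub_sub_cancel_left]
    exact hw
  · refine isJ_of_weak h0 h1 ?_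
    have hw := (hR (R h) h).2 rfl
    rw [Submodule.coe_sub, Submodule.coe_smul, neg_sub]
    exact hw

end Spectrum

/-! ### The energy form -/

section Energy

variable {ε : ℝ} (h0 : 0 ≤ ε) (h1 : ε < 1)
include h0 h1

/-- The constant by which `L_ε ω` differs from `P ω / g'(ψ_ε)` does not contribute, as `∬ ω' = 0`. -/
theorem Lform_eq_inner (ω ω' : X ℝ ε) : Lform ω ω' =
    inner ℝ ((sphModel (𝕜 := ℝ) h0 h1).P (ω : Lp ℝ 2 (weighted ε)))
      (ω' : Lp ℝ 2 (weighted ε)) := by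
  obtain ⟨c, hc⟩ := exists_Lfun_ae_eq h0 h1 ω
  set v := (sphModel (𝕜 := ℝ) h0 h1).P (ω : Lp ℝ 2 (weighted ε))
  have i1 := integrable_inner_cyl v (ω' : Lp ℝ 2 (weighted ε))
  have i2 : Integrable (fun z => c * rep ω' z) cyl :=
    (integrable_Lp_weighted h0 h1 (ω' : Lp ℝ 2 (weighted ε))).const_mul c
  have e2 : ∫ z, c * rep ω' z ∂cyl = 0 := by
    rw [integral_const_mul, show ∫ z, rep ω' z ∂cyl = 0 from ω'.2.2, mul_zero]
  rw [inner_eq_integral, ← sub_zero (∫ z, (gp ε z)⁻¹ • _ ∂cyl), ← e2, ← integral_sub i1 i2, Lform]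
  refine integral_congr_ae ?_
  filter_upwards [hc] with z hz
  rw [hz]
  simp only [smul_eq_mul, conj_trivial, rep]
  ring

theorem Lform_self_nonneg (ω : X ℝ ε) : 0 ≤ Lform ω ω := by
  rw [Lform_eq_inner h0 h1, real_inner_comm]
  exact (sphModel (𝕜 := ℝ) h0 h1).inner_P_nonneg _

omit h0 h1 in
theorem sph_mem_Pol (i : Fin 3) : sph ε i ∈ Pol ℝ ε 2 := by
  simpa using sph_smul_mem_Pol (const_mem_Pol (1 : ℝ) 0 (ε := ε)) i

/-- The sphere coordinates as polynomials. -/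
def sphPol (ε : ℝ) (i : Fin 3) : SphPol ℝ ε := ⟨sph ε i, 2, sph_mem_Pol i⟩

/-- The sphere coordinates are eigenfunctions of `-Δ / g'(ψ_ε)` with eigenvalue `1`. -/
theorem polD_sphPol (i : Fin 3) : polD h0 h1 (sphPol ε i) = sphPol ε i := by
  refine Subtype.ext (funext fun z => ?_)
  change -(gp ε z)⁻¹ • lap (sph ε i) z = sph ε i z
  have hr := (rho_pos h0 h1 z).ne'
  rw [lap, lap_sph h0 h1, gp_eq h0 h1, smul_eq_mul]
  field_simp

theorem inner_const_sphPol (a : ℝ) (i : Fin 3) :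
    inner ℝ (polEmb h0 h1 (constPol ε a)) (polEmb h0 h1 (sphPol ε i)) = 0 := by
  rw [← polD_sphPol h0 h1 i, inner_polEmb_polD]
  refine integral_eq_zero_of_ae (ae_of_all _ fun z => ?_)
  have : ∀ v, pd v (constPol ε a : ℝ × ℝ → ℝ) z = 0 := fun v => pd_const v a z
  simp [this]

/-- The sphere coordinates are orthogonal with equal norms.  Both `D Yₖ = Yₖ` and
`∇Yᵢ · ∇Yₖ = ρ (δᵢₖ - Yᵢ Yₖ)` express the inner product by itself, which determines it. -/
theorem inner_sphPol (i k : Fin 3) :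
    inner ℝ (polEmb h0 h1 (sphPol ε i)) (polEmb h0 h1 (sphPol ε k)) =
      if i = k then (∫ z, gp ε z ∂cyl) / 3 else 0 := by
  have e1 := inner_polEmb_polD h0 h1 (sphPol ε i) (sphPol ε k)
  rw [polD_sphPol] at e1
  have e2 := inner_polEmb h0 h1 (sphPol ε i) (sphPol ε k)
  have hi : Integrable (fun z => gp ε z * (sph ε k z * sph ε i z)) cyl := by
    refine (integrable_gp h0 h1).mul_bdd (c := 1) ?_ (ae_of_all _ fun z => ?_)
    · exact ((contDiff_sph h0 h1 k).continuous.mul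
        (contDiff_sph h0 h1 i).continuous).aestronglyMeasurable
    · rw [norm_mul]
      exact mul_le_one₀ (abs_sph_le h0 h1 k z) (norm_nonneg _) (abs_sph_le h0 h1 i z)
  have e3 : ∫ z, (pd (1, 0) (sph ε k) z * pd (1, 0) (sph ε i) z +
      pd (0, 1) (sph ε k) z * pd (0, 1) (sph ε i) z) ∂cyl =
      2⁻¹ * ((if i = k then ∫ z, gp ε z ∂cyl else 0) -
        ∫ z, gp ε z * (sph ε k z * sph ε i z) ∂cyl) := by
    have e4 : (if i = k then ∫ z, gp ε z ∂cyl else 0) =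
        ∫ z, gp ε z * (if k = i then 1 else 0) ∂cyl := by
      by_cases h : i = k
      · simp [h]
      · simp [h, Ne.symm h]
    rw [e4, ← integral_sub ((integrable_gp h0 h1).mul_const _) hi, ← integral_const_mul]
    refine integral_congr_ae (ae_of_all _ fun z => ?_)
    simp only [grad_sph_mul h0 h1 k i z, gp_eq h0 h1]
    ring
  simp only [conj_trivial, smul_eq_mul] at e1 e2
  replace e1 : inner ℝ (polEmb h0 h1 (sphPol ε i)) (polEmb h0 h1 (sphPol ε k)) = _ := e1.trans e3
  replace e2 : inner ℝ (polEmb h0 h1 (sphPol ε i)) (polEmb h0 h1 (sphPol ε k)) =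
    ∫ z, gp ε z * (sph ε k z * sph ε i z) ∂cyl := e2
  rw [← e2] at e1
  split_ifs at e1 ⊢ <;> linarith

theorem integral_gp_pos : 0 < ∫ z, gp ε z ∂cyl := by
  refine (integral_pos_iff_support_of_nonneg (fun z => (gp_pos ε z).le) (integrable_gp h0 h1)).2 ?_
  rw [show Function.support (gp ε) = univ from eq_univ_of_forall fun z => (gp_pos ε z).ne', cyl,
    Measure.restrict_apply_univ, Measure.volume_eq_prod, Measure.prod_prod, Real.volume_Ioc,
    Real.volume_univ, sub_zero]
  exact ENNReal.mul_pos (ENNReal.ofReal_pos.2 (by positivity)).ne' ENNReal.top_ne_zero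

theorem linearIndependent_polEmb_sphPol :
    LinearIndependent ℝ fun i => polEmb h0 h1 (sphPol ε i) := by
  refine linearIndependent_of_ne_zero_of_inner_eq_zero (𝕜 := ℝ) (fun i hi => ?_) fun i k hik => ?_
  · have := inner_sphPol h0 h1 i i
    rw [if_pos rfl, hi, inner_zero_left] at this
    linarith [integral_gp_pos h0 h1]
  · change inner ℝ (polEmb h0 h1 (sphPol ε i)) (polEmb h0 h1 (sphPol ε k)) = 0
    rw [inner_sphPol, if_neg hik]

/-- The kernel of `P` in `X_ε` is spanned by the functions `g'(ψ_ε) sph ε i`. -/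
theorem mem_span_sphPol_iff (x : Lp ℝ 2 (weighted ε)) :
    x ∈ Submodule.span ℝ (range fun i => polEmb h0 h1 (sphPol ε i)) ↔
      x ∈ X ℝ ε ∧ (sphModel (𝕜 := ℝ) h0 h1).P x = 0 := by
  constructor
  · intro hx
    induction hx using Submodule.span_induction with
    | mem x hx =>
      obtain ⟨i, rfl⟩ := hx
      have h2 : ∀ a, inner ℝ (polEmb h0 h1 (constPol ε a)) (polEmb h0 h1 (sphPol ε i)) = 0 :=
        fun a => inner_const_sphPol h0 h1 a i
      constructor
      · rw [mem_X_iff h0 h1]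
        have := inner_constPol h0 h1 (1 : ℝ) (polEmb h0 h1 (sphPol ε i))
        rw [h2, map_one, mul_one] at this
        exact this.symm
      · refine ((sphModel (𝕜 := ℝ) h0 h1).P_eq_zero_iff).2 ⟨?_, fun y hy => ?_⟩
        · exact ⟨sphPol ε i, sph_mem_Pol i, rfl⟩
        · obtain ⟨a, rfl⟩ := (mem_U_one_iff h0 h1).1 hy
          rw [real_inner_comm]
          exact h2 a
    | zero => exact ⟨Submodule.zero_mem _, map_zero _⟩
    | add x y _ _ hx hy => exact ⟨Submodule.add_mem _ hx.1 hy.1, by rw [map_add, hx.2, hy.2, add_zero]⟩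
    | smul c x _ hx => exact ⟨Submodule.smul_mem _ c hx.1, by rw [map_smul, hx.2, smul_zero]⟩
  · rintro ⟨-, hP⟩
    obtain ⟨⟨F, hF, hFx⟩, hort⟩ := ((sphModel (𝕜 := ℝ) h0 h1).P_eq_zero_iff).1 hP
    obtain ⟨a, f, hf, hFe⟩ := mem_Pol_succ.1 (show (F : ℝ × ℝ → ℝ) ∈ Pol ℝ ε (1 + 1) from hF)
    choose c hc using fun i => exists_const_of_mem_Pol_one (hf i)
    have e1 : F = constPol ε a + ∑ i, c i • sphPol ε i := by
      refine Subtype.ext (funext fun z => ?_)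
      rw [hFe, Submodule.coe_add, Submodule.coe_sum]
      simp only [Pi.add_apply, Finset.sum_apply, Submodule.coe_smul, Pi.smul_apply, smul_eq_mul, hc]
      exact congrArg _ (Finset.sum_congr rfl fun i _ => mul_comm _ _)
    have e2 : x = polEmb h0 h1 (constPol ε a) + ∑ i, c i • polEmb h0 h1 (sphPol ε i) := by
      rw [← hFx, e1]
      change polEmb h0 h1 _ = _
      simp only [map_add, map_sum, map_smul]
    -- The constant part vanishes since elements of the kernel are orthogonal to constants.
    have e3 : polEmb h0 h1 (constPol ε a) = 0 := by
      have := hort _ ((mem_U_one_iff h0 h1).2 ⟨a, rfl⟩)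
      rw [e2, inner_add_left, sum_inner] at this
      have hz : ∀ i, inner ℝ (c i • polEmb h0 h1 (sphPol ε i)) (polEmb h0 h1 (constPol ε a)) = 0 :=
        fun i => by
          rw [inner_smul_left, real_inner_comm, inner_const_sphPol, mul_zero]
      simp only [hz, Finset.sum_const_zero, add_zero] at this
      exact inner_self_eq_zero.1 this
    rw [e2, e3, zero_add]
    exact Submodule.sum_mem _ fun i _ => Submodule.smul_mem _ _ (Submodule.subset_span ⟨i, rfl⟩)

/-- For `ω` with `⟨L_ε ω, ω'⟩ = 0` for all `ω'`, take `ω' = ω`: the nonnegative form of `P` vanishes,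
hence `P ω = 0`. -/
theorem exists_kernel : ∃ K : Submodule ℝ (X ℝ ε), Module.finrank ℝ K = 3 ∧
    ∀ ω : X ℝ ε, ω ∈ K ↔ ∀ ω' : X ℝ ε, Lform ω ω' = 0 := by
  set V := Submodule.span ℝ (range fun i => polEmb h0 h1 (sphPol ε i)) with hV
  have hVX : V ≤ X ℝ ε := fun x hx => ((mem_span_sphPol_iff h0 h1 x).1 hx).1
  refine ⟨V.comap (X ℝ ε).subtype, ?_, fun ω => ?_⟩
  · rw [(Submodule.comapSubtypeEquivOfLe hVX).finrank_eq,
      finrank_span_eq_card (linearIndependent_polEmb_sphPol h0 h1), Fintype.card_fin]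
  · rw [Submodule.mem_comap, Submodule.subtype_apply, mem_span_sphPol_iff]
    constructor
    · rintro ⟨-, h⟩ ω'
      rw [Lform_eq_inner h0 h1, h, inner_zero_left]
    · intro h
      refine ⟨ω.2, (sphModel (𝕜 := ℝ) h0 h1).P_eq_zero_of_re_inner ?_⟩
      have := h ω
      rw [Lform_eq_inner h0 h1, real_inner_comm] at this
      exact this

end Energy

end KelvinStuart

end

theorem theorem1p3 (ε : ℝ) (hε0 : 0 ≤ ε) (hε1 : ε < 1) :
    KelvinStuart.SpectrallyStable ε ∧
    (∀ ω : KelvinStuart.X ℝ ε, 0 ≤ KelvinStuart.Lform ω ω) ∧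
    (∃ K : Submodule ℝ (KelvinStuart.X ℝ ε), Module.finrank ℝ K = 3 ∧
      ∀ ω : KelvinStuart.X ℝ ε, ω ∈ K ↔ ∀ ω' : KelvinStuart.X ℝ ε, KelvinStuart.Lform ω ω' = 0) :=
  ⟨KelvinStuart.spectrallyStable hε0 hε1, KelvinStuart.Lform_self_nonneg hε0 hε1,
    KelvinStuart.exists_kernel hε0 hε1⟩
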